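/- **Conventions.** $[m]=\{1,\dots,m\}$ with uniform probability measure $u_m$ ($m\ge 1$), $\mathrm{Sym}(m)$ is the symmetric group of $[m]$, and $\mathrm{Sym}(m)^{\mathbb Z}$ is the set of all maps $\mathbb Z\to \mathrm{Sym}(m)$ with the product $\sigma$-algebra. $H(\nu)=-\sum_x \nu(\{x\})\log\nu(\{x\})$ for a probability measure $\nu$ on a finite set. An *approximate process* over $\mathbb Z$ with finite range $A$ is $\overline X=(T,X,\mu,\phi)$, where $(X,\mu)$ is a probability space, $T=(T_g)_{g\in\mathbb Z}$ are measure-preserving maps of $X$ and $\phi:X\to A$ is measurable; it is a *process* if $T$ is an action of $\mathbb Z$. For finite $W\subset\mathbb Z$ let $\phi^W(x)=(\phi(T_wx))_{w\in W}\in A^W$, and let $d_W(\overline X,\overline Y)$ be the total variation distance of the laws $\phi^W_*\mu$ and $\psi^W_*\nu$ on $A^W$, where $\overline Y=(S,Y,\nu,\psi)$. Say $\overline X_j\to\overline X$ if $d_W(\overline X_j,\overline X)\to0$ for every finite $W$. For $\beta:A\to B$ with $B$ finite, $\beta\circ\overline X=(T,X,\mu,\beta\circ\phi)$. A *random sofic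 approximation* of $\mathbb Z$ is a sequence $\mathbb K=\{\kappa_i\}$ of probability measures $\kappa_i$ on $\mathrm{Sym}(m_i)^{\mathbb Z}$ such that $(\kappa_i\times u_{m_i})\{(\sigma,p):\sigma(g)\sigma(h)p=\sigma(g+h)p\}\to1$ for all $g,h\in\mathbb Z$ and $(\kappa_i\times u_{m_i})\{(\sigma,p):\sigma(g)p\ne\sigma(h)p\}\to1$ for all $g\neq h$. A probability measure $\eta$ on $\mathrm{Sym}(m)^{\mathbb Z}\times A^{[m]}$ *constructs* the approximate process on $\mathrm{Sym}(m)^{\mathbb Z}\times A^{[m]}\times[m]$ with measure $\eta\times u_m$, maps $(\sigma,\psi,p)\mapsto(\sigma,\psi,\sigma(g)p)$ and observable $(\sigma,\psi,p)\mapsto\psi(p)$. If $\overline Y$ is constructed from $\eta=\int\nu_\sigma\,d\kappa(\sigma)$, with $\kappa$ the first marginal of $\eta$, put $h(\overline Y)=\frac1m\int H(\nu_\sigma)\,d\kappa(\sigma)$; $h(\beta\circ\overline Y)$ is this quantity for the image of $\eta$ under $(\sigma,\psi)\mapsto(\sigma,\beta\circ\psi)$. A sequence $\{\overline X_j\}$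 is *adapted* to a subsequence $\{\kappa_{i_j}\}$ of $\mathbb K$ (with $i_1<i_2<\cdots$) if each $\overline X_j$ is constructed from some $\eta_j$ with first marginal $\kappa_{i_j}$. It converges to $\overline X$ *strongly* if $\overline X_j\to\overline X$ and, for every finite $W$ and $\epsilon>0$, $\eta_j\{(\sigma,\psi): d_W((\sigma,\psi),\phi)<\epsilon\}\to1$, where $d_W((\sigma,\psi),\phi)$ is the total variation distance between $\phi^W_*\mu$ and the law of $(\psi(\sigma(w)p))_{w\in W}$ for uniform $p$. For a process $\overline X$ with range $A$, let $$\bar h(\mathbb K,\overline X|\beta\circ\overline X)=\sup\ \limsup_{j\to\infty}\big(h(\overline X_j)-h(\beta\circ\overline X_j)\big)\in[-\infty,\infty],$$ the supremum being over all sequences $\{\overline X_j\}$ adapted to a subsequence of $\mathbb K$ with $\overline X_j\to\overline X$ (with $\sup\emptyset=-\infty$), and let $h(\mathbb K,\overline X|\beta\circ\overline X)$ be the same supremum over those sequences which converge to $\overline X$ strongly. The classical entropy of a process with finite range is $h(\overline X)=h_\mu(\phi)=\lim_{n\to\infty}\frac1n H(\phi^{\{0,\dots,n-1\}}_*\mu)$.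 The classical relative entropy is $$h(\overline X|\beta\circ\overline X)=\inf_\psi\big(h_\mu(\phi\vee\psi)-h_\mu(\psi)\big),$$ the infimum being over all finite-range observables $\psi$ which are measurable with respect to the $T$-invariant $\sigma$-algebra generated by $\beta\circ\phi$, where $(\phi\vee\psi)(x)=(\phi(x),\psi(x))$. **Proposition.** Let $\mathbb K$ be a random sofic approximation of $\mathbb Z$, let $\overline X$ be a process over $\mathbb Z$ with finite range $A$, and let $\beta:A\to B$ be a map to a finite set $B$. Then $$\bar h(\mathbb K,\overline X|\beta\circ\overline X)=h(\mathbb K,\overline X|\beta\circ\overline X)=h(\overline X|\beta\circ\overline X),$$ and moreover $h(\overline X|\beta\circ\overline X)=h(\overline X)-h(\beta\circ\overline X)$. -/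

import Mathlib

open MeasureTheory ProbabilityTheory Filter Topology

noncomputable section

namespace SoficEntropy

/-! ## Approximate processes and processes over the group of integers -/

/-- An approximate process over `ℤ` with range `A`: a probability space with a family of
measure-preserving maps indexed by `ℤ` and a measurable observable. -/
structure ApproxProc (Ω A : Type*) [MeasurableSpace Ω] [MeasurableSpace A] where
  μ : Measure Ω
  isProb : IsProbabilityMeasure μ
  T : ℤ → Ω → Ω
  measurePreserving_T : ∀ g, MeasurePreserving (T g) μ μ
  φ : Ω → A
  measurable_φ : Measurable φ

attribute [instance] ApproxProc.isProb

/-- A process over `ℤ`: an approximate process whose maps form an action of `ℤ`. -/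
structure ZProc (Ω A : Type*) [MeasurableSpace Ω] [MeasurableSpace A] extends
    ApproxProc Ω A where
  T_zero : T 0 = id
  T_add : ∀ g h, T (g + h) = T g ∘ T h

/-- The approximate process obtained by composing the observable with a map `β`. -/
def ApproxProc.factor {Ω A B : Type*} [MeasurableSpace Ω] [MeasurableSpace A]
    [DiscreteMeasurableSpace A] [MeasurableSpace B] (X : ApproxProc Ω A) (β : A → B) :
    ApproxProc Ω B where
  μ := X.μ
  isProb := X.isProb
  T := X.T
  measurePreserving_T := X.measurePreserving_T
  φ := β ∘ X.φ
  measurable_φ := (Measurable.of_discrete (f := β)).comp X.measurable_φ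

/-- The factor process `β ∘ X`. -/
def ZProc.factor {Ω A B : Type*} [MeasurableSpace Ω] [MeasurableSpace A]
    [DiscreteMeasurableSpace A] [MeasurableSpace B] (X : ZProc Ω A) (β : A → B) :
    ZProc Ω B where
  toApproxProc := X.toApproxProc.factor β
  T_zero := X.T_zero
  T_add := X.T_add

/-- The map `x ↦ (w ↦ φ (T w x))` for a window `W`. -/
def windowMap {Ω A : Type*} (T : ℤ → Ω → Ω) (φ : Ω → A) (W : Finset ℤ) (x : Ω) : W → A :=
  fun w => φ (T w x)

/-- Total variation distance of two (probability) measures on a finite set. -/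
def tvDist {α : Type*} [Fintype α] [MeasurableSpace α] (μ ν : Measure α) : ℝ :=
  (1 / 2) * ∑ a, |μ.real {a} - ν.real {a}|

/-- The `W`-local statistics of an approximate process. -/
def ApproxProc.localStatistics {Ω A : Type*} [MeasurableSpace Ω] [MeasurableSpace A]
    (X : ApproxProc Ω A) (W : Finset ℤ) : Measure (W → A) :=
  X.μ.map (windowMap X.T X.φ W)

/-- The distance `d_W` between two approximate processes with the same finite range. -/
def processDist {Ω Ω' A : Type*} [MeasurableSpace Ω] [MeasurableSpace Ω'] [Fintype A]
    [MeasurableSpace A] (W : Finset ℤ) (X : ApproxProc Ω A) (Y : ApproxProc Ω' A) : ℝ :=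
  tvDist (X.localStatistics W) (Y.localStatistics W)

/-! ## Random sofic approximations to the integers -/

/-- Finite symmetric groups carry the discrete σ-algebra. -/
instance instMeasurableSpacePermFin (m : ℕ) : MeasurableSpace (Equiv.Perm (Fin m)) := ⊤

instance instDiscretePermFin (m : ℕ) : DiscreteMeasurableSpace (Equiv.Perm (Fin m)) :=
  ⟨fun _ => trivial⟩

/-- The set of all maps from `ℤ` to `Sym(m)`, with the product σ-algebra. -/
abbrev SymMaps (m : ℕ) : Type := ℤ → Equiv.Perm (Fin m)

/-- The uniform probability measure on `[m]`. -/
def unif (m : ℕ) : Measure (Fin m) := uniformOn Set.univ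

instance instIsProbUnif (m : ℕ) [NeZero m] : IsProbabilityMeasure (unif m) :=
  isProbabilityMeasure_uniformOn Set.finite_univ Set.univ_nonempty

/-- A random sofic approximation to `ℤ`. -/
structure RandomSoficApprox where
  m : ℕ → ℕ
  neZero_m : ∀ i, NeZero (m i)
  κ : ∀ i, Measure (SymMaps (m i))
  isProb : ∀ i, IsProbabilityMeasure (κ i)
  asymp_hom : ∀ g h : ℤ, Tendsto (fun i => ((κ i).prod (unif (m i)))
    {q | q.1 g (q.1 h q.2) = q.1 (g + h) q.2}) atTop (𝓝 1)
  asymp_free : ∀ g h : ℤ, g ≠ h → Tendsto (fun i => ((κ i).prod (unif (m i)))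
    {q | q.1 g q.2 ≠ q.1 h q.2}) atTop (𝓝 1)

attribute [instance] RandomSoficApprox.neZero_m RandomSoficApprox.isProb

/-! ## Approximate processes constructed from random sofic approximations -/

theorem measurePreserving_unif {m : ℕ} (e : Equiv.Perm (Fin m)) :
    MeasurePreserving e (unif m) (unif m) := by
  refine ⟨Measurable.of_discrete, ?_⟩
  refine Measure.ext_of_singleton fun a => ?_
  rw [Measure.map_apply Measurable.of_discrete (measurableSet_singleton a)]
  have h : e ⁻¹' {a} = {e.symm a} := by
    ext x; simp [Equiv.eq_symm_apply]
  rw [h, unif, uniformOn, ProbabilityTheory.cond_apply MeasurableSet.univ,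
    ProbabilityTheory.cond_apply MeasurableSet.univ]
  simp

/-- The approximate process constructed from a probability measure `η` on
`Sym(m)^ℤ × A^[m]`: the space is `(Sym(m)^ℤ × A^[m]) × [m]` with measure `η × u_m`, the maps are
`(σ, ψ, p) ↦ (σ, ψ, σ(g) p)` and the observable is `(σ, ψ, p) ↦ ψ p`. -/
def constructed {m : ℕ} [NeZero m] {A : Type*} [MeasurableSpace A]
    (η : Measure (SymMaps m × (Fin m → A))) [IsProbabilityMeasure η] :
    ApproxProc ((SymMaps m × (Fin m → A)) × Fin m) A where
  μ := η.prod (unif m)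
  isProb := inferInstance
  T := fun g q => (q.1, q.1.1 g q.2)
  measurePreserving_T := fun g => by
    refine MeasurePreserving.skew_product (f := id) (g := fun s p => s.1 g p)
      (MeasurePreserving.id η) ?_ ?_
    · have h : Measurable (fun q : Equiv.Perm (Fin m) × Fin m => q.1 q.2) :=
        Measurable.of_discrete
      exact h.comp (Measurable.prodMk
        ((measurable_pi_apply g).comp (measurable_fst.comp measurable_fst)) measurable_snd)
    · exact Filter.Eventually.of_forall fun s => (measurePreserving_unif (s.1 g)).map_eq
  φ := fun q => q.1.2 q.2
  measurable_φ := measurable_from_prod_countable_left fun p =>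
    (measurable_pi_apply p).comp measurable_snd

/-- `d_W((σ, ψ), φ)`: the total variation distance between the `W`-local statistics of `X` and the
law of `p ↦ (w ↦ ψ (σ(w) p))` for `p` uniform in `[m]`. -/
def modelDist {Ω A : Type*} [MeasurableSpace Ω] [Fintype A] [MeasurableSpace A] {m : ℕ}
    (W : Finset ℤ) (s : SymMaps m × (Fin m → A)) (X : ApproxProc Ω A) : ℝ :=
  tvDist (X.localStatistics W)
    ((unif m).map (windowMap (fun g p => s.1 g p) s.2 W))

/-- Shannon entropy of a probability measure on a finite set. -/
def shannon {α : Type*} [Fintype α] [MeasurableSpace α] (μ : Measure α) : ℝ :=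
  ∑ a, Real.negMulLog (μ.real {a})

/-- The entropy `(1/m) ∫ H(ν_σ) dκ(σ)` of the approximate process constructed from `η`, where `κ`
is the first marginal of `η` and `η = ∫ ν_σ dκ(σ)` is the disintegration of `η` over `κ`. -/
def modelEntropy {m : ℕ} {A : Type*} [Fintype A] [Nonempty A] [MeasurableSpace A]
    [DiscreteMeasurableSpace A] (η : Measure (SymMaps m × (Fin m → A))) [IsFiniteMeasure η] : ℝ :=
  (1 / (m : ℝ)) * ∫ σ, shannon (η.condKernel σ) ∂η.fst

/-- The push-forward of `η` under `(σ, ξ) ↦ (σ, β ∘ ξ)`; it defines the factor by `β` of the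
approximate process constructed from `η`. -/
def pushFactor {m : ℕ} {A B : Type*} [MeasurableSpace A] [MeasurableSpace B] (β : A → B)
    (η : Measure (SymMaps m × (Fin m → A))) : Measure (SymMaps m × (Fin m → B)) :=
  η.map (fun s => (s.1, β ∘ s.2))

instance instIsFinitePushFactor {m : ℕ} {A B : Type*} [MeasurableSpace A] [MeasurableSpace B]
    (β : A → B) (η : Measure (SymMaps m × (Fin m → A))) [IsFiniteMeasure η] :
    IsFiniteMeasure (pushFactor β η) := by
  unfold pushFactor; infer_instance

/-- A sequence of approximate processes with range `A` adapted to a subsequence of `K`, given by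
the measures `η j` from which its members are constructed. -/
structure AdaptedSeq (K : RandomSoficApprox) (A : Type*) [MeasurableSpace A] where
  idx : ℕ → ℕ
  strictMono_idx : StrictMono idx
  η : ∀ j, Measure (SymMaps (K.m (idx j)) × (Fin (K.m (idx j)) → A))
  isProb : ∀ j, IsProbabilityMeasure (η j)
  fst_eq : ∀ j, (η j).fst = K.κ (idx j)

attribute [instance] AdaptedSeq.isProb

/-- Convergence of the approximate processes constructed from `S.η j` to `X`. -/
def AdaptedSeq.ConvergesTo {K : RandomSoficApprox} {Ω A : Type*} [MeasurableSpace Ω] [Fintype A]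
    [MeasurableSpace A] (S : AdaptedSeq K A) (X : ApproxProc Ω A) : Prop :=
  ∀ W : Finset ℤ, Tendsto (fun j => processDist W (constructed (S.η j)) X) atTop (𝓝 0)

/-- Strong convergence of the approximate processes constructed from `S.η j` to `X`. -/
def AdaptedSeq.ConvergesStronglyTo {K : RandomSoficApprox} {Ω A : Type*} [MeasurableSpace Ω]
    [Fintype A] [MeasurableSpace A] (S : AdaptedSeq K A) (X : ApproxProc Ω A) : Prop :=
  S.ConvergesTo X ∧ ∀ W : Finset ℤ, ∀ ε : ℝ, 0 < ε →
    Tendsto (fun j => S.η j {s | modelDist W s X < ε}) atTop (𝓝 1)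

/-- `limsup_j (h(X_j) - h(β ∘ X_j))` for an adapted sequence. -/
def AdaptedSeq.relRate {K : RandomSoficApprox} {A B : Type*} [Fintype A] [Nonempty A]
    [MeasurableSpace A] [DiscreteMeasurableSpace A] [Fintype B] [Nonempty B] [MeasurableSpace B]
    [DiscreteMeasurableSpace B] (S : AdaptedSeq K A) (β : A → B) : EReal :=
  limsup (fun j => ((modelEntropy (S.η j) - modelEntropy (pushFactor β (S.η j)) : ℝ) : EReal))
    atTop

/-- Relative upper-sofic entropy of `X` with respect to `K`, relative to the factor by `β`
(`⊥` if no adapted sequence converges to `X`). -/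
def upperRelSoficEntropy {Ω A B : Type*} [MeasurableSpace Ω] [Fintype A] [Nonempty A]
    [MeasurableSpace A] [DiscreteMeasurableSpace A] [Fintype B] [Nonempty B] [MeasurableSpace B]
    [DiscreteMeasurableSpace B] (K : RandomSoficApprox) (X : ZProc Ω A) (β : A → B) : EReal :=
  ⨆ (S : AdaptedSeq K A) (_ : S.ConvergesTo X.toApproxProc), S.relRate β

/-- Relative (lower-)sofic entropy: the same supremum over strongly convergent sequences. -/
def relSoficEntropy {Ω A B : Type*} [MeasurableSpace Ω] [Fintype A] [Nonempty A]
    [MeasurableSpace A] [DiscreteMeasurableSpace A] [Fintype B] [Nonempty B] [MeasurableSpace B]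
    [DiscreteMeasurableSpace B] (K : RandomSoficApprox) (X : ZProc Ω A) (β : A → B) : EReal :=
  ⨆ (S : AdaptedSeq K A) (_ : S.ConvergesStronglyTo X.toApproxProc), S.relRate β

/-! ## Classical entropy and relative entropy -/

/-- The Shannon entropy of the law of the observable along the interval `{0, …, n - 1}`. -/
def blockEntropy {Ω A : Type*} [MeasurableSpace Ω] [Fintype A] [MeasurableSpace A]
    (T : ℤ → Ω → Ω) (μ : Measure Ω) (φ : Ω → A) (n : ℕ) : ℝ :=
  shannon (μ.map (windowMap T φ (Finset.Ico (0 : ℤ) n)))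

/-- Classical mean entropy rate `h_μ(T, φ) = lim_n H(φ^{F_n}_* μ) / |F_n|` along the Følner sequence
`F_n = {0, …, n - 1}` of `ℤ`. The limit exists, see `tendsto_blockEntropy`. -/
def entropyRate {Ω A : Type*} [MeasurableSpace Ω] [Fintype A] [MeasurableSpace A]
    (T : ℤ → Ω → Ω) (μ : Measure Ω) (φ : Ω → A) : ℝ :=
  limUnder atTop (fun n : ℕ => blockEntropy T μ φ n / n)

/-- The classical entropy `h(X)` of a process. -/
def ZProc.entropy {Ω A : Type*} [MeasurableSpace Ω] [Fintype A] [MeasurableSpace A]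
    (X : ZProc Ω A) : ℝ :=
  entropyRate X.T X.μ X.φ

theorem shannon_map {α β : Type*} [Fintype α] [MeasurableSpace α] [MeasurableSingletonClass α]
    [Fintype β] [MeasurableSpace β] [MeasurableSingletonClass β] (μ : Measure α)
    (e : α ≃ β) : shannon (μ.map e) = shannon μ := by
  unfold shannon
  rw [← e.sum_comp]
  refine Finset.sum_congr rfl fun a _ => ?_
  rw [map_measureReal_apply (measurable_of_finite _) (measurableSet_singleton _)]
  congr 2
  ext x; simp

theorem shannon_le_add {α β : Type*} [Fintype α] [MeasurableSpace α] [MeasurableSingletonClass α]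
    [Fintype β] [MeasurableSpace β] [MeasurableSingletonClass β] (μ : Measure (α × β))
    [IsProbabilityMeasure μ] : shannon μ ≤ shannon μ.fst + shannon μ.snd := by
  classical
  have h1 : ∀ a, μ.fst.real {a} = ∑ b, μ.real {(a, b)} := by
    intro a
    rw [Measure.fst, map_measureReal_apply measurable_fst (measurableSet_singleton _)]
    rw [show (Prod.fst ⁻¹' {a} : Set (α × β)) =
      ((Finset.univ.image fun b => (a, b) : Finset (α × β)) : Set (α × β)) by
        ext ⟨x, y⟩; simp [eq_comm]]
    rw [← sum_measureReal_singleton, Finset.sum_image (by intro x _ y _ h; simpa using h)]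
  have h2 : ∀ b, μ.snd.real {b} = ∑ a, μ.real {(a, b)} := by
    intro b
    rw [Measure.snd, map_measureReal_apply measurable_snd (measurableSet_singleton _)]
    rw [show (Prod.snd ⁻¹' {b} : Set (α × β)) =
      ((Finset.univ.image fun a => (a, b) : Finset (α × β)) : Set (α × β)) by
        ext ⟨x, y⟩; simp [eq_comm]]
    rw [← sum_measureReal_singleton, Finset.sum_image (by intro x _ y _ h; simpa using h)]
  have t1 : ∑ a, μ.fst.real {a} = 1 := by
    rw [sum_measureReal_singleton]; simp
  have t2 : ∑ b, μ.snd.real {b} = 1 := by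
    rw [sum_measureReal_singleton]; simp
  have t3 : ∑ a, ∑ b, μ.real {(a, b)} = 1 := by simp_rw [← h1]; exact t1
  have e1 : shannon μ.fst = ∑ a, ∑ b, -(μ.real {(a, b)} * Real.log (μ.fst.real {a})) := by
    unfold shannon
    refine Finset.sum_congr rfl fun a _ => ?_
    rw [Finset.sum_neg_distrib, ← Finset.sum_mul, ← h1, Real.negMulLog]; ring
  have e2 : shannon μ.snd = ∑ a, ∑ b, -(μ.real {(a, b)} * Real.log (μ.snd.real {b})) := by
    unfold shannon
    rw [Finset.sum_comm]
    refine Finset.sum_congr rfl fun b _ => ?_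
    rw [Finset.sum_neg_distrib, ← Finset.sum_mul, ← h2, Real.negMulLog]; ring
  have key : ∀ a b, Real.negMulLog (μ.real {(a, b)}) ≤
      -(μ.real {(a, b)} * Real.log (μ.fst.real {a})) +
      -(μ.real {(a, b)} * Real.log (μ.snd.real {b})) +
      (μ.fst.real {a} * μ.snd.real {b} - μ.real {(a, b)}) := by
    intro a b
    have p0 : 0 ≤ μ.real {(a, b)} := measureReal_nonneg
    rcases p0.eq_or_lt with p | p
    · rw [← p]
      have : 0 ≤ μ.fst.real {a} * μ.snd.real {b} := by positivity
      simpa using this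
    · have pa : 0 < μ.fst.real {a} := by
        rw [h1]
        exact p.trans_le (Finset.single_le_sum (f := fun b => μ.real {(a, b)})
          (fun _ _ => measureReal_nonneg) (Finset.mem_univ b))
      have pb : 0 < μ.snd.real {b} := by
        rw [h2]
        exact p.trans_le (Finset.single_le_sum (f := fun a => μ.real {(a, b)})
          (fun _ _ => measureReal_nonneg) (Finset.mem_univ a))
      have hl := Real.log_le_sub_one_of_pos
        (div_pos (mul_pos pa pb) p)
      rw [Real.log_div (mul_pos pa pb).ne' p.ne', Real.log_mul pa.ne' pb.ne'] at hl
      have := mul_le_mul_of_nonneg_left hl p0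
      rw [mul_sub (μ.real {(a, b)}) (_ / _), mul_div_cancel₀ _ p.ne'] at this
      rw [Real.negMulLog]
      nlinarith
  have hs : ∑ a, ∑ b, (μ.fst.real {a} * μ.snd.real {b} - μ.real {(a, b)}) = 0 := by
    simp_rw [Finset.sum_sub_distrib, t3, ← Finset.mul_sum, t2, mul_one, t1, sub_self]
  calc shannon μ = ∑ a, ∑ b, Real.negMulLog (μ.real {(a, b)}) := by
        unfold shannon; rw [Fintype.sum_prod_type]
    _ ≤ _ := Finset.sum_le_sum fun a _ => Finset.sum_le_sum fun b _ => key a b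
    _ = _ := by
        simp_rw [Finset.sum_add_distrib]
        rw [← Finset.sum_add_distrib] 
        rw [hs, e1, e2]; simp [Finset.sum_add_distrib]

/-- Splitting the interval `{0, …, m + n - 1}` into `{0, …, m - 1}` and a translate of
`{0, …, n - 1}`. -/
def icoSumEquiv (m n : ℕ) : (Finset.Ico (0 : ℤ) m) ⊕ (Finset.Ico (0 : ℤ) n) ≃
    (Finset.Ico (0 : ℤ) (m + n : ℕ)) where
  toFun := Sum.elim
    (fun i => ⟨i.1, by have := Finset.mem_Ico.1 i.2; rw [Finset.mem_Ico]; push_cast; omega⟩)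
    (fun i => ⟨i.1 + m, by have := Finset.mem_Ico.1 i.2; rw [Finset.mem_Ico]; push_cast; omega⟩)
  invFun := fun i => if h : i.1 < m
    then Sum.inl ⟨i.1, by have := Finset.mem_Ico.1 i.2; rw [Finset.mem_Ico]; omega⟩
    else Sum.inr ⟨i.1 - m, by
      have := Finset.mem_Ico.1 i.2; rw [Finset.mem_Ico]; push_cast at this; omega⟩
  left_inv := by
    rintro (i | i)
    · have := Finset.mem_Ico.1 i.2
      simp [this.2]
    · have := Finset.mem_Ico.1 i.2
      have h : ¬ (i.1 + m < (m : ℤ)) := by omega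
      simp [h]
  right_inv := by
    intro i
    by_cases h : i.1 < (m : ℤ) <;> simp [h]

theorem ApproxProc.measurable_windowMap {Ω A : Type*} [MeasurableSpace Ω] [MeasurableSpace A]
    (X : ApproxProc Ω A) (W : Finset ℤ) : Measurable (windowMap X.T X.φ W) :=
  measurable_pi_lambda _ fun w => X.measurable_φ.comp (X.measurePreserving_T w).measurable

theorem subadditive_blockEntropy {Ω A : Type*} [MeasurableSpace Ω] [Fintype A]
    [MeasurableSpace A] [DiscreteMeasurableSpace A] (X : ZProc Ω A) :
    Subadditive (blockEntropy X.T X.μ X.φ) := by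
  intro m n
  let e : (Finset.Ico (0 : ℤ) (m + n : ℕ) → A) ≃
      (Finset.Ico (0 : ℤ) m → A) × (Finset.Ico (0 : ℤ) n → A) :=
    ((icoSumEquiv m n).arrowCongr (Equiv.refl A)).symm.trans (Equiv.sumArrowEquivProdArrow _ _ _)
  have hm := fun k : ℕ => X.measurable_windowMap (Finset.Ico (0 : ℤ) k)
  have he : ⇑e ∘ windowMap X.T X.φ (Finset.Ico (0 : ℤ) (m + n : ℕ)) = fun x =>
      (windowMap X.T X.φ (Finset.Ico (0 : ℤ) m) x,
        windowMap X.T X.φ (Finset.Ico (0 : ℤ) n) (X.T m x)) := by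
    funext x
    refine Prod.ext rfl ?_
    funext i
    change X.φ (X.T (i.1 + m) x) = X.φ (X.T i.1 (X.T m x))
    rw [X.T_add]; rfl
  have hT := X.measurePreserving_T m
  have hmeas := (hm m).prodMk ((hm n).comp hT.measurable)
  unfold blockEntropy
  rw [← shannon_map _ e, Measure.map_map (measurable_of_finite _) (hm (m + n)), he]
  have hp : IsProbabilityMeasure (X.μ.map fun x =>
      (windowMap X.T X.φ (Finset.Ico (0 : ℤ) m) x,
        windowMap X.T X.φ (Finset.Ico (0 : ℤ) n) (X.T m x))) :=
    Measure.isProbabilityMeasure_map hmeas.aemeasurable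
  refine (shannon_le_add _).trans (le_of_eq ?_)
  erw [Measure.fst_map_prodMk ((hm n).comp hT.measurable), Measure.snd_map_prodMk (hm m)]
  congr 2
  change X.μ.map (windowMap X.T X.φ (Finset.Ico (0 : ℤ) n) ∘ X.T m) = _
  rw [← Measure.map_map (hm n) hT.measurable, hT.map_eq]

/-- The limit defining the classical entropy of a process exists. -/
theorem tendsto_blockEntropy {Ω A : Type*} [MeasurableSpace Ω] [Fintype A]
    [MeasurableSpace A] [DiscreteMeasurableSpace A] (X : ZProc Ω A) :
    Tendsto (fun n : ℕ => blockEntropy X.T X.μ X.φ n / n) atTop (𝓝 X.entropy) := by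
  refine tendsto_nhds_limUnder ⟨_, (subadditive_blockEntropy X).tendsto_lim ⟨0, ?_⟩⟩
  rintro _ ⟨n, rfl⟩
  have hp : IsProbabilityMeasure (X.μ.map (windowMap X.T X.φ (Finset.Ico (0 : ℤ) n))) :=
    Measure.isProbabilityMeasure_map (X.measurable_windowMap _).aemeasurable
  refine div_nonneg (Finset.sum_nonneg fun a _ => ?_) n.cast_nonneg
  exact Real.negMulLog_nonneg measureReal_nonneg measureReal_le_one

/-- `h_μ(φ | ℱ) = inf_ψ (h_μ(φ ∨ ψ) - h_μ(ψ))`, the infimum being over all finite-range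
`ℱ`-measurable observables `ψ`. -/
def relEntropyRate {Ω A : Type*} (ℱ : MeasurableSpace Ω) [MeasurableSpace Ω] [Fintype A]
    [MeasurableSpace A] (T : ℤ → Ω → Ω) (μ : Measure Ω) (φ : Ω → A) : EReal :=
  ⨅ (k : ℕ) (ψ : Ω → Fin k) (_ : Measurable[ℱ] ψ),
    ((entropyRate T μ (fun x => (φ x, ψ x)) - entropyRate T μ ψ : ℝ) : EReal)

/-- The `ℤ`-invariant σ-algebra generated by an observable `ψ`. -/
@[reducible] def invariantSigmaAlgebra {Ω B : Type*} [MeasurableSpace B] (T : ℤ → Ω → Ω) (ψ : Ω → B) :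
    MeasurableSpace Ω :=
  ⨆ g : ℤ, MeasurableSpace.comap (fun x => ψ (T g x)) inferInstance

/-- The classical relative entropy `h(X | β ∘ X)`. -/
def ZProc.relEntropy {Ω A B : Type*} [MeasurableSpace Ω] [Fintype A] [MeasurableSpace A]
    [MeasurableSpace B] (X : ZProc Ω A) (β : A → B) : EReal :=
  relEntropyRate (invariantSigmaAlgebra X.T (β ∘ X.φ)) X.T X.μ X.φ

end SoficEntropy

end

/-!
The quantities `h(X_j) - h(β ∘ X_j)` are conditional entropies of a random configuration given its
image under `β`, and all three relative entropies are equal to `h(X) - h(β ∘ X)`.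

*Upper bound.* For a fixed permutation model `σ` and a window `F = {0, …, n - 1}`, the translates
`{σ g p | g ∈ F}` of the window cover almost every site exactly `n` times, by asymptotic freeness
alone. Hence a relative form of Shearer's inequality (`card_mul_shannon_sub_le`) bounds the
conditional entropy of a configuration by `1 / n` times the sum over `p` of the conditional
entropies of its restrictions to the translates. By Gibbs' inequality
(`shannon_sub_shannon_map_le`) each of them is at most an expected code length with respect to one
fixed kernel, taken from `X`. This bound is linear in the law of the configuration, so that after
averaging over the models it depends only on the local statistics, which converge. In the limit the
rate is at most `(H(φ^F) - H((β ∘ φ)^F)) / n` (`AdaptedSeq.relRate_le`); now let `n` tend to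
infinity. Weak convergence of the models suffices.

*Lower bound.* Most sites `p` satisfy `σ g p = (σ 1)^g p` for small `g` and lie in long cycles of
the permutation `σ 1`. Cutting these cycles into segments of length `n` (`exists_blockStarts`) and
filling the segments independently with samples of `φ^F` gives models whose conditional entropy is
exactly additive over the segments (`shannon_blockMeasure`, `shannon_blockMeasure_map`). Their
empirical statistics concentrate near those of `X` by Chebyshev's inequality
(`blockMeasure_modelDist_ge_le`). Letting `n` grow slowly along a subsequence gives a strongly
convergent adapted sequence with the full rate (`exists_strongly_convergent`).

*Classical relative entropy.* Taking `ψ = β ∘ φ` gives one inequality. For the other it suffices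
that an observable of the invariant σ-algebra generated by `β ∘ φ` has entropy rate at most that of
`β ∘ φ` (`entropyRate_le_of_measurable`): such an observable has arbitrarily small conditional
entropy given a large finite window of `β ∘ φ`.
-/

namespace SoficEntropy

/-! ### Shannon entropy of finite laws -/

section FiniteEntropy

variable {α γ : Type*} [Fintype α] [MeasurableSpace α]

theorem shannon_eq_sum (ρ : Measure α) :
    shannon ρ = ∑ a, ρ.real {a} * -Real.log (ρ.real {a}) := by
  unfold shannon
  refine Finset.sum_congr rfl fun a _ => ?_
  rw [Real.negMulLog]; ring

theorem shannon_nonneg (ρ : Measure α) [IsProbabilityMeasure ρ] : 0 ≤ shannon ρ :=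
  Finset.sum_nonneg fun _ _ => Real.negMulLog_nonneg measureReal_nonneg measureReal_le_one

variable [MeasurableSingletonClass α] [MeasurableSpace γ] [MeasurableSingletonClass γ]

theorem measureReal_map_singleton [DecidableEq γ] (ρ : Measure α) [IsFiniteMeasure ρ] (β : α → γ)
    (c : γ) : (ρ.map β).real {c} = ∑ a with β a = c, ρ.real {a} := by
  rw [map_measureReal_apply (measurable_of_finite _) (measurableSet_singleton _),
    sum_measureReal_singleton]
  congr 1
  ext x; simp

theorem sum_measureReal_map_mul [Fintype γ] (ρ : Measure α) [IsFiniteMeasure ρ] (β : α → γ)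
    (g : γ → ℝ) :
    ∑ c, (ρ.map β).real {c} * g c = ∑ a, ρ.real {a} * g (β a) := by
  classical
  rw [← Finset.sum_fiberwise Finset.univ β]
  refine Finset.sum_congr rfl fun c _ => ?_
  rw [measureReal_map_singleton, Finset.sum_mul]
  refine Finset.sum_congr rfl fun a ha => ?_
  rw [(Finset.mem_filter.1 ha).2]

theorem measureReal_le_map (ρ : Measure α) [IsFiniteMeasure ρ] (β : α → γ) (a : α) :
    ρ.real {a} ≤ (ρ.map β).real {β a} := by
  rw [map_measureReal_apply (measurable_of_finite _) (measurableSet_singleton _)]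
  exact measureReal_mono (by simp)

/-- Gibbs' inequality, relative to a map `β`: the conditional entropy of a law given its image under
`β` is at most the expected code length of any subprobability kernel `q` on the fibres of `β`. The
right-hand side is linear in the law. -/
theorem shannon_sub_shannon_map_le [Fintype γ] [DecidableEq γ] (ρ : Measure α)
    [IsProbabilityMeasure ρ] (β : α → γ) (q : α → ℝ) (hq0 : ∀ a, 0 ≤ q a) (hq : ∀ c, ∑ a with β a = c, q a ≤ 1)
    (hpos : ∀ a, ρ.real {a} ≠ 0 → 0 < q a) :
    shannon ρ - shannon (ρ.map β) ≤ ∑ a, ρ.real {a} * -Real.log (q a) := by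
  have hs : IsProbabilityMeasure (ρ.map β) :=
    Measure.isProbabilityMeasure_map (measurable_of_finite _).aemeasurable
  have t1 : ∑ a, ρ.real {a} = 1 := by rw [sum_measureReal_singleton]; simp
  have t2 : ∑ c, (ρ.map β).real {c} = 1 := by rw [sum_measureReal_singleton]; simp
  have hsum : ∑ a, (ρ.map β).real {β a} * q a ≤ 1 := by
    rw [← Finset.sum_fiberwise Finset.univ β, ← t2]
    refine Finset.sum_le_sum fun c _ => ?_
    calc ∑ a with β a = c, (ρ.map β).real {β a} * q a
        = (ρ.map β).real {c} * ∑ a with β a = c, q a := by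
          rw [Finset.mul_sum]
          refine Finset.sum_congr rfl fun a ha => ?_
          rw [(Finset.mem_filter.1 ha).2]
      _ ≤ (ρ.map β).real {c} * 1 := mul_le_mul_of_nonneg_left (hq c) measureReal_nonneg
      _ = _ := mul_one _
  have key : ∀ a, ρ.real {a} * -Real.log (ρ.real {a}) -
      ρ.real {a} * -Real.log ((ρ.map β).real {β a}) - ρ.real {a} * -Real.log (q a) ≤
      (ρ.map β).real {β a} * q a - ρ.real {a} := by
    intro a
    have p0 : 0 ≤ ρ.real {a} := measureReal_nonneg
    rcases p0.eq_or_lt with p | p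
    · rw [← p]
      have : 0 ≤ (ρ.map β).real {β a} * q a := mul_nonneg measureReal_nonneg (hq0 a)
      simpa using this
    · have pa : 0 < (ρ.map β).real {β a} := p.trans_le (measureReal_le_map ρ β a)
      have pb : 0 < q a := hpos a p.ne'
      have hl := Real.log_le_sub_one_of_pos (div_pos (mul_pos pa pb) p)
      rw [Real.log_div (mul_pos pa pb).ne' p.ne', Real.log_mul pa.ne' pb.ne'] at hl
      have := mul_le_mul_of_nonneg_left hl p0
      rw [mul_sub (ρ.real {a}) (_ / _), mul_div_cancel₀ _ p.ne'] at this
      linarith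
  have hfin := Finset.sum_le_sum fun a (_ : a ∈ Finset.univ) => key a
  rw [shannon_eq_sum, shannon_eq_sum,
    sum_measureReal_map_mul ρ β fun c => -Real.log ((ρ.map β).real {c})]
  simp only [Finset.sum_sub_distrib] at hfin
  linarith

theorem shannon_map_le [Fintype γ] (ρ : Measure α) [IsProbabilityMeasure ρ] (β : α → γ) :
    shannon (ρ.map β) ≤ shannon ρ := by
  rw [shannon_eq_sum, shannon_eq_sum,
    sum_measureReal_map_mul ρ β fun c => -Real.log ((ρ.map β).real {c})]
  refine Finset.sum_le_sum fun a _ => ?_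
  rcases (measureReal_nonneg : 0 ≤ ρ.real {a}).eq_or_lt with p | p
  · simp [← p]
  · exact mul_le_mul_of_nonneg_left (neg_le_neg (Real.log_le_log p (measureReal_le_map ρ β a)))
      p.le

theorem shannon_le_log_card (ρ : Measure α) [IsProbabilityMeasure ρ] :
    shannon ρ ≤ Real.log (Fintype.card α) := by
  classical
  have hα : Nonempty α := by
    by_contra h
    rw [not_nonempty_iff] at h
    have := measure_univ (μ := ρ)
    rw [Set.univ_eq_empty_iff.2 h] at this
    simp at this
  have hc : (0 : ℝ) < Fintype.card α := by exact_mod_cast Fintype.card_pos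
  have t1 : ∑ a, ρ.real {a} = 1 := by rw [sum_measureReal_singleton]; simp
  have h := shannon_sub_shannon_map_le ρ (fun _ => ()) (fun _ => (Fintype.card α : ℝ)⁻¹)
    (fun _ => by positivity) (fun c => by simp [hc.ne']) (fun _ _ => by positivity)
  have h0 : shannon (ρ.map fun _ => ()) = 0 := by
    simp [shannon, Measure.map_const, measureReal_def]
  rw [h0, ← Finset.sum_mul, t1, Real.log_inv] at h
  simpa using h

end FiniteEntropy

/-! ### Entropy of finite-valued random variables -/

/-- The Shannon entropy of the law of a finite-valued random variable. -/
noncomputable def ent {Ω α : Type*} [MeasurableSpace Ω] [Fintype α] [MeasurableSpace α]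
    (μ : Measure Ω) (f : Ω → α) : ℝ :=
  shannon (μ.map f)

theorem exists_comp_of_determined {Ω α γ : Type*} {f : Ω → α} {g : Ω → γ} [Nonempty α]
    (h : ∀ x y, g x = g y → f x = f y) : ∃ k : γ → α, f = k ∘ g := by
  classical
  obtain ⟨a⟩ := ‹Nonempty α›
  refine ⟨fun c => if hc : ∃ x, g x = c then f hc.choose else a, funext fun x => ?_⟩
  have hx : ∃ y, g y = g x := ⟨x, rfl⟩
  simp only [Function.comp, dif_pos hx]
  exact h _ _ hx.choose_spec.symm

section RandomVariables

variable {Ω α γ δ ε : Type*} [MeasurableSpace Ω] {μ : Measure Ω} [IsProbabilityMeasure μ]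
  [Fintype α] [MeasurableSpace α] [MeasurableSingletonClass α]
  [Fintype γ] [MeasurableSpace γ] [MeasurableSingletonClass γ]
  [Fintype δ] [MeasurableSpace δ] [MeasurableSingletonClass δ]
  [Fintype ε] [MeasurableSpace ε] [MeasurableSingletonClass ε]

theorem ent_le_log_card {f : Ω → α} (hf : Measurable f) :
    ent μ f ≤ Real.log (Fintype.card α) :=
  have := Measure.isProbabilityMeasure_map (μ := μ) hf.aemeasurable
  shannon_le_log_card _

theorem ent_const (a : α) : ent μ (fun _ => a) = 0 := by
  classical
  unfold ent shannon
  rw [Measure.map_const]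
  refine Finset.sum_eq_zero fun b _ => ?_
  by_cases h : a = b <;> simp [measureReal_def, h]

/-- Entropy is monotone: a random variable determined by another one has smaller entropy. -/
theorem ent_mono {f : Ω → α} {g : Ω → γ} (hg : Measurable g)
    (h : ∀ x y, g x = g y → f x = f y) : ent μ f ≤ ent μ g := by
  obtain ⟨x⟩ := nonempty_of_isProbabilityMeasure μ
  have : Nonempty α := ⟨f x⟩
  obtain ⟨k, rfl⟩ := exists_comp_of_determined h
  have := Measure.isProbabilityMeasure_map (μ := μ) hg.aemeasurable
  unfold ent
  rw [← Measure.map_map (measurable_of_finite k) hg]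
  exact shannon_map_le _ _

theorem ent_congr {f : Ω → α} {g : Ω → γ} (hf : Measurable f) (hg : Measurable g)
    (h : ∀ x y, g x = g y ↔ f x = f y) : ent μ f = ent μ g :=
  le_antisymm (ent_mono hg fun x y => (h x y).1) (ent_mono hf fun x y => (h x y).2)

/-- Strong subadditivity of entropy, for random variables ordered by "is determined by": here `u` is
determined by the pair `(v, w)`, and `z` is determined both by `v` and by `w`. -/
theorem ent_submodular {u : Ω → α} {v : Ω → γ} {w : Ω → δ} {z : Ω → ε}
    (hv : Measurable v) (hw : Measurable w)
    (hu : ∀ x y, v x = v y → w x = w y → u x = u y)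
    (hzv : ∀ x y, v x = v y → z x = z y) (hzw : ∀ x y, w x = w y → z x = z y) :
    ent μ u + ent μ z ≤ ent μ v + ent μ w := by
  classical
  obtain ⟨x⟩ := nonempty_of_isProbabilityMeasure μ
  have : Nonempty ε := ⟨z x⟩
  obtain ⟨kv, hkv⟩ := exists_comp_of_determined hzv
  obtain ⟨kw, hkw⟩ := exists_comp_of_determined hzw
  have hvw := hv.prodMk hw
  have i1 := Measure.isProbabilityMeasure_map (μ := μ) hvw.aemeasurable
  have i2 := Measure.isProbabilityMeasure_map (μ := μ) hv.aemeasurable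
  have i3 := Measure.isProbabilityMeasure_map (μ := μ) hw.aemeasurable
  have h1 : ent μ u ≤ ent μ (fun x => (v x, w x)) :=
    ent_mono hvw fun x y h => hu x y (congrArg Prod.fst h) (congrArg Prod.snd h)
  set ρ := μ.map fun x => (v x, w x) with hρ
  have hfst : ρ.map Prod.fst = μ.map v := by
    rw [hρ, Measure.map_map measurable_fst hvw]; rfl
  have hsnd : ρ.map Prod.snd = μ.map w := by
    rw [hρ, Measure.map_map measurable_snd hvw]; rfl
  have hz : μ.map z = (μ.map v).map kv := by
    rw [Measure.map_map (measurable_of_finite kv) hv, hkv]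
  set P := μ.map v
  have hle := fun c => measureReal_le_map P kv c
  have hsupp : ∀ p, ρ.real {p} ≠ 0 → kv p.1 = kw p.2 ∧ 0 < P.real {p.1} := by
    intro p hp
    have hne : (μ.real ((fun x => (v x, w x)) ⁻¹' {p})) ≠ 0 := by
      rwa [hρ, map_measureReal_apply hvw (measurableSet_singleton _)] at hp
    obtain ⟨x, hx⟩ : ((fun x => (v x, w x)) ⁻¹' {p}).Nonempty := by
      by_contra h
      rw [Set.not_nonempty_iff_eq_empty] at h
      simp [h] at hne
    have hx : (v x, w x) = p := hx
    refine ⟨?_, ?_⟩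
    · rw [← hx]; exact (congrFun hkv x).symm.trans (congrFun hkw x)
    · have := measureReal_le_map ρ Prod.fst p
      rw [hfst] at this
      exact (lt_of_le_of_ne measureReal_nonneg hp.symm).trans_le this
  -- The competing kernel is the conditional law of `v` given `z`.
  have h2 := shannon_sub_shannon_map_le ρ Prod.snd
    (fun p => if kv p.1 = kw p.2 then P.real {p.1} / (P.map kv).real {kv p.1} else 0)
    (fun p => by split_ifs; exacts [by positivity, le_rfl])
    (fun c => by
      have : ∑ p : γ × δ with p.2 = c,
          (if kv p.1 = kw p.2 then P.real {p.1} / (P.map kv).real {kv p.1} else 0) =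
          ∑ a with kv a = kw c, P.real {a} / (P.map kv).real {kw c} := by
        rw [Finset.sum_filter, Fintype.sum_prod_type, Finset.sum_filter]
        refine Finset.sum_congr rfl fun a _ => ?_
        rw [Finset.sum_ite_eq' Finset.univ c]
        simp only [Finset.mem_univ, if_true]
        split_ifs with h
        · rw [h]
        · rfl
      rw [this, ← Finset.sum_div, ← measureReal_map_singleton P kv (kw c)]
      exact div_self_le_one _)
    (fun p hp => by
      rw [if_pos (hsupp p hp).1]
      exact div_pos (hsupp p hp).2 ((hsupp p hp).2.trans_le (hle _)))
  rw [hsnd] at h2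
  have h3 : ∑ p, ρ.real {p} * -Real.log (if kv p.1 = kw p.2 then
      P.real {p.1} / (P.map kv).real {kv p.1} else 0) = shannon P - shannon (P.map kv) := by
    rw [shannon_eq_sum, shannon_eq_sum, sum_measureReal_map_mul P kv fun c =>
      -Real.log ((P.map kv).real {c}), ← Finset.sum_sub_distrib]
    simp_rw [← mul_sub]
    have := sum_measureReal_map_mul ρ Prod.fst fun a =>
      (-Real.log (P.real {a}) - -Real.log ((P.map kv).real {kv a}))
    rw [hfst] at this
    rw [this]
    refine Finset.sum_congr rfl fun p _ => ?_
    by_cases hp : ρ.real {p} = 0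
    · simp [hp]
    obtain ⟨hzx, hp1⟩ := hsupp p hp
    rw [if_pos hzx, Real.log_div hp1.ne' (hp1.trans_le (hle _)).ne']
    ring
  rw [h3] at h2
  have h4 : ent μ z = shannon (P.map kv) := by rw [ent, hz]
  have h5 : ent μ (fun x => (v x, w x)) = shannon ρ := rfl
  have h6 : ent μ v = shannon P := rfl
  have h7 : ent μ w = shannon (μ.map w) := rfl
  linarith

/-- Subadditivity of entropy. -/
theorem ent_subadditive {u : Ω → α} {v : Ω → γ} {w : Ω → δ}
    (hv : Measurable v) (hw : Measurable w)
    (hu : ∀ x y, v x = v y → w x = w y → u x = u y) :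
    ent μ u ≤ ent μ v + ent μ w := by
  have := ent_submodular (μ := μ) (z := fun _ => ()) hv hw hu (fun _ _ _ => rfl) (fun _ _ _ => rfl)
  rwa [ent_const, add_zero] at this

end RandomVariables

/-- The entropy of a finite product of copies of a law is additive. -/
theorem shannon_pi {ι α : Type*} [Fintype ι] [DecidableEq ι] [Fintype α] [MeasurableSpace α]
    [MeasurableSingletonClass α] (ρ : Measure α) [IsProbabilityMeasure ρ] :
    shannon (Measure.pi fun _ : ι => ρ) = Fintype.card ι * shannon ρ := by
  have t1 : ∑ a, ρ.real {a} = 1 := by rw [sum_measureReal_singleton]; simp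
  have hprod : ∀ x : ι → α, (Measure.pi fun _ : ι => ρ).real {x} = ∏ i, ρ.real {x i} := by
    intro x
    rw [measureReal_def, Measure.pi_singleton, ENNReal.toReal_prod]; rfl
  have hlog : ∀ (s : Finset ι) (y : ι → ℝ), Real.negMulLog (∏ i ∈ s, y i) =
      ∑ i ∈ s, ∏ j ∈ s, (if j = i then Real.negMulLog (y j) else y j) := by
    intro s y
    induction s using Finset.induction_on with
    | empty => simp
    | insert a s ha ih =>
      rw [Finset.prod_insert ha, Real.negMulLog_mul, ih, Finset.sum_insert ha,
        Finset.prod_insert ha, if_pos rfl, Finset.mul_sum]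
      refine congrArg₂ _ ?_ (Finset.sum_congr rfl fun i hi => ?_)
      · rw [mul_comm]
        refine congrArg _ (Finset.prod_congr rfl fun j hj => ?_)
        rw [if_neg]; rintro rfl; exact ha hj
      · rw [Finset.prod_insert ha, if_neg]
        rintro rfl; exact ha hi
  unfold shannon
  simp_rw [hprod, hlog]
  rw [Finset.sum_comm, ← nsmul_eq_mul, ← Finset.card_univ, ← Finset.sum_const]
  refine Finset.sum_congr rfl fun i _ => ?_
  have := (Fintype.prod_sum (fun (j : ι) (a : α) =>
    if j = i then Real.negMulLog (ρ.real {a}) else ρ.real {a})).symm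
  rw [this, Finset.prod_eq_single i]
  · simp
  · intro j _ hj
    simp [hj, t1]
  · simp

/-! ### A relative Shearer inequality -/

section Shearer

variable {m : ℕ} {A B : Type*} [Nonempty A]

/-- The restriction of a configuration to a set of sites, with a default symbol elsewhere. -/
noncomputable def restrictTo (S : Finset (Fin m)) (ψ : Fin m → A) : Fin m → A :=
  fun q => if q ∈ S then ψ q else Classical.arbitrary A

theorem restrictTo_eq_iff {S : Finset (Fin m)} {ψ ψ' : Fin m → A} :
    restrictTo S ψ = restrictTo S ψ' ↔ ∀ q ∈ S, ψ q = ψ' q := by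
  constructor
  · intro h q hq
    have := congrFun h q
    simpa [restrictTo, hq] using this
  · intro h
    funext q
    by_cases hq : q ∈ S <;> simp [restrictTo, hq, h]

variable [Fintype A] [MeasurableSpace A] [Fintype B] [MeasurableSpace B]

/-- The joint entropy of the restriction of a random configuration to `S` and of the whole image of
the configuration under `β`. -/
noncomputable def jointEnt (ν : Measure (Fin m → A)) (β : A → B) (S : Finset (Fin m)) : ℝ :=
  ent ν (fun ψ => (restrictTo S ψ, β ∘ ψ))

/-- The increment `H(ψ_q | ψ_{<q}, β ∘ ψ)` in the chain rule along the order of the sites. -/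
noncomputable def chainIncrement (ν : Measure (Fin m → A)) (β : A → B) (q : Fin m) : ℝ :=
  jointEnt ν β (insert q (Finset.Iio q)) - jointEnt ν β (Finset.Iio q)

theorem sum_chainIncrement_univ (ν : Measure (Fin m → A)) (β : A → B) :
    jointEnt ν β Finset.univ - jointEnt ν β ∅ ≤ ∑ q, chainIncrement ν β q := by
  have h : ∀ k : ℕ, k ≤ m → jointEnt ν β (Finset.univ.filter fun q : Fin m => q.1 < k) -
      jointEnt ν β ∅ ≤ ∑ q with q.1 < k, chainIncrement ν β q := by
    intro k
    induction k with
    | zero => simp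
    | succ k ih =>
      intro hk
      have h1 : (Finset.univ.filter fun q : Fin m => q.1 < k + 1) =
          insert ⟨k, hk⟩ (Finset.univ.filter fun q : Fin m => q.1 < k) := by
        ext q; simp [Fin.ext_iff]; omega
      have h2 : (Finset.univ.filter fun q : Fin m => q.1 < k) = Finset.Iio ⟨k, hk⟩ := by
        ext q; simp [Fin.lt_def]
      have h3 := ih (by omega)
      rw [h1, Finset.sum_insert (by simp), chainIncrement]
      rw [h2] at h3 ⊢
      linarith
  have := h m le_rfl
  simpa using this

variable [DiscreteMeasurableSpace A] [DiscreteMeasurableSpace B]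
  (ν : Measure (Fin m → A)) [IsProbabilityMeasure ν] (β : A → B)

theorem jointEnt_univ : jointEnt ν β Finset.univ = shannon ν := by
  have : shannon ν = ent ν id := by rw [ent, Measure.map_id]
  rw [this]
  refine ent_congr (measurable_of_finite _) (measurable_of_finite _) fun x y => ?_
  rw [Prod.mk.injEq, restrictTo_eq_iff]
  constructor
  · rintro h; simp only [id] at h; subst h; simp
  · rintro ⟨h, -⟩; funext q; exact h q (Finset.mem_univ q)

theorem jointEnt_empty : jointEnt ν β ∅ = shannon (ν.map (β ∘ ·)) := by
  refine ent_congr (measurable_of_finite _) (measurable_of_finite _) fun x y => ?_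
  rw [Prod.mk.injEq, restrictTo_eq_iff]
  simp

theorem chainIncrement_nonneg (q : Fin m) : 0 ≤ chainIncrement ν β q := by
  refine sub_nonneg.2 (ent_mono (measurable_of_finite _) fun x y h => ?_)
  rw [Prod.mk.injEq, restrictTo_eq_iff] at h ⊢
  exact ⟨fun p hp => h.1 p (Finset.mem_insert_of_mem hp), h.2⟩

theorem chainIncrement_le (q : Fin m) : chainIncrement ν β q ≤ Real.log (Fintype.card A) := by
  have h1 : jointEnt ν β (insert q (Finset.Iio q)) ≤
      ent ν (fun ψ : Fin m → A => ψ q) + jointEnt ν β (Finset.Iio q) := by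
    refine ent_subadditive (measurable_of_finite _) (measurable_of_finite _) fun x y h h' => ?_
    rw [Prod.mk.injEq, restrictTo_eq_iff] at h' ⊢
    refine ⟨fun p hp => ?_, h'.2⟩
    rcases Finset.mem_insert.1 hp with rfl | hp
    exacts [h, h'.1 p hp]
  have h2 : ent ν (fun ψ : Fin m → A => ψ q) ≤ Real.log (Fintype.card A) :=
    ent_le_log_card (measurable_of_finite _)
  rw [chainIncrement]
  linarith

/-- Conditioning on fewer sites increases the entropy of the next one; hence the entropy along any
set of sites dominates the sum of the corresponding increments of the chain rule. -/
theorem sum_chainIncrement_le (S : Finset (Fin m)) :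
    ∑ q ∈ S, chainIncrement ν β q ≤ jointEnt ν β S - jointEnt ν β ∅ := by
  induction S using Finset.induction_on_max with
  | empty => simp
  | insert q S hS ih =>
    rw [Finset.sum_insert fun h => lt_irrefl _ (hS q h)]
    have : jointEnt ν β (insert q (Finset.Iio q)) + jointEnt ν β S ≤
        jointEnt ν β (insert q S) + jointEnt ν β (Finset.Iio q) := by
      refine ent_submodular (measurable_of_finite _) (measurable_of_finite _)
        (fun x y h h' => ?_) (fun x y h => ?_) (fun x y h => ?_)
      · rw [Prod.mk.injEq, restrictTo_eq_iff] at h h' ⊢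
        refine ⟨fun p hp => ?_, h.2⟩
        rcases Finset.mem_insert.1 hp with rfl | hp
        exacts [h.1 _ (Finset.mem_insert_self _ _), h'.1 p hp]
      · rw [Prod.mk.injEq, restrictTo_eq_iff] at h ⊢
        exact ⟨fun p hp => h.1 p (Finset.mem_insert_of_mem hp), h.2⟩
      · rw [Prod.mk.injEq, restrictTo_eq_iff] at h ⊢
        exact ⟨fun p hp => h.1 p (Finset.mem_Iio.2 (hS p hp)), h.2⟩
    rw [chainIncrement]
    linarith

/-- A relative form of Shearer's inequality. Every site `q` lies in the translates
`{s g p | g ∈ F}` for `p = (s g)⁻¹ q`, `g ∈ F`; these are `|F|` different translates unless two of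
the permutations agree at a preimage of `q`. -/
theorem card_mul_shannon_sub_le (F : Finset ℤ) (s : ℤ → Equiv.Perm (Fin m)) :
    (F.card : ℝ) * (shannon ν - shannon (ν.map (β ∘ ·))) ≤
      ∑ p, (shannon (ν.map fun ψ => windowMap (fun g p => s g p) ψ F p) -
        shannon ((ν.map fun ψ => windowMap (fun g p => s g p) ψ F p).map (β ∘ ·))) +
      (F.card : ℝ) * Real.log (Fintype.card A) *
        ∑ x ∈ F.offDiag, ∑ p, (if s x.1 p = s x.2 p then 1 else 0 : ℝ) := by
  classical
  set D := chainIncrement ν β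
  have hD0 := chainIncrement_nonneg ν β
  have hD1 := chainIncrement_le ν β
  have hlog : 0 ≤ Real.log (Fintype.card A) :=
    Real.log_nonneg (by exact_mod_cast Fintype.card_pos)
  let I : Fin m → Finset (Fin m) := fun p => F.image fun g => s g p
  have hwin : ∀ p, jointEnt ν β (I p) - jointEnt ν β ∅ ≤
      shannon (ν.map fun ψ => windowMap (fun g p => s g p) ψ F p) -
        shannon ((ν.map fun ψ => windowMap (fun g p => s g p) ψ F p).map (β ∘ ·)) := by
    intro p
    rw [Measure.map_map (measurable_of_finite _) (measurable_of_finite _), jointEnt_empty]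
    have : jointEnt ν β (I p) + ent ν ((β ∘ ·) ∘ fun ψ => windowMap (fun g p => s g p) ψ F p) ≤
        ent ν (fun ψ => windowMap (fun g p => s g p) ψ F p) + ent ν (β ∘ ·) := by
      refine ent_submodular (measurable_of_finite _) (measurable_of_finite _)
        (fun x y h h' => ?_) (fun x y h => ?_) (fun x y h => ?_)
      · rw [Prod.mk.injEq, restrictTo_eq_iff]
        refine ⟨fun q hq => ?_, h'⟩
        obtain ⟨g, hg, rfl⟩ := Finset.mem_image.1 hq
        exact congrFun h ⟨g, hg⟩
      · simp only [Function.comp, h]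
      · funext g
        exact congrFun h (s g p)
    unfold ent at this
    linarith
  have hcount : ∀ q, (F.card : ℝ) * D q ≤ ∑ p, (if q ∈ I p then D q else 0) +
      F.card * Real.log (Fintype.card A) *
        ∑ x ∈ F.offDiag, (if (s x.1).symm q = (s x.2).symm q then 1 else 0) := by
    intro q
    by_cases hq : Set.InjOn (fun g => (s g).symm q) F
    · have h1 : (Finset.univ.filter fun p => q ∈ I p) = F.image fun g => (s g).symm q := by
        ext p
        simp only [I, Finset.mem_filter, Finset.mem_univ, true_and, Finset.mem_image]
        exact exists_congr fun g => and_congr_right fun _ => by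
          rw [Equiv.symm_apply_eq, eq_comm]
      rw [← Finset.sum_filter, h1, Finset.sum_const, Finset.card_image_of_injOn hq, nsmul_eq_mul]
      exact le_add_of_nonneg_right (mul_nonneg (mul_nonneg (by positivity) hlog)
        (Finset.sum_nonneg fun x _ => by split_ifs <;> norm_num))
    · have h1 : (1 : ℝ) ≤ ∑ x ∈ F.offDiag, (if (s x.1).symm q = (s x.2).symm q then 1 else 0) := by
        simp only [Set.InjOn, not_forall] at hq
        obtain ⟨g, hg, h, hh, he, hne⟩ := hq
        have := Finset.single_le_sum (f := fun x : ℤ × ℤ =>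
          (if (s x.1).symm q = (s x.2).symm q then 1 else 0 : ℝ))
          (fun x _ => by split_ifs <;> norm_num)
          (show (g, h) ∈ F.offDiag from Finset.mem_offDiag.2 ⟨hg, hh, hne⟩)
        simpa [he] using this
      have h2 : 0 ≤ ∑ p, (if q ∈ I p then D q else 0) :=
        Finset.sum_nonneg fun p _ => by split_ifs; exacts [hD0 q, le_rfl]
      have h3 : (F.card : ℝ) * D q ≤ F.card * Real.log (Fintype.card A) :=
        mul_le_mul_of_nonneg_left (hD1 q) (by positivity)
      have h4 := le_mul_of_one_le_right (mul_nonneg (Nat.cast_nonneg (α := ℝ) F.card) hlog) h1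
      linarith
  have hbad : ∀ x : ℤ × ℤ, ∑ q, (if (s x.1).symm q = (s x.2).symm q then 1 else 0 : ℝ) =
      ∑ p, (if s x.1 p = s x.2 p then 1 else 0 : ℝ) := by
    intro x
    rw [← Equiv.sum_comp (s x.1)]
    refine Finset.sum_congr rfl fun p _ => ?_
    congr 1
    rw [Equiv.symm_apply_apply, Equiv.eq_symm_apply]
    exact propext ⟨Eq.symm, Eq.symm⟩
  calc (F.card : ℝ) * (shannon ν - shannon (ν.map (β ∘ ·)))
      ≤ F.card * ∑ q, D q := by
        refine mul_le_mul_of_nonneg_left ?_ (by positivity)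
        rw [← jointEnt_univ ν β, ← jointEnt_empty]
        exact sum_chainIncrement_univ ν β
    _ = ∑ q, F.card * D q := Finset.mul_sum _ _ _
    _ ≤ _ := Finset.sum_le_sum fun q _ => hcount q
    _ ≤ _ := by
        rw [Finset.sum_add_distrib, Finset.sum_comm, ← Finset.mul_sum,
          Finset.sum_comm (s := Finset.univ) (t := F.offDiag),
          Finset.sum_congr rfl fun x _ => hbad x]
        refine add_le_add_left (Finset.sum_le_sum fun p _ => ?_) _
        rw [← Finset.sum_filter]
        have := sum_chainIncrement_le ν β (I p)
        rw [Finset.filter_mem_eq_inter, Finset.univ_inter]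
        exact this.trans (hwin p)

end Shearer

/-- Gibbs' inequality is sharp: up to `ε`, conditional entropy is attained as the expected code
length of an everywhere positive subprobability kernel. -/
theorem exists_kernel_sum_log_le {α γ : Type*} [Fintype α] [MeasurableSpace α]
    [MeasurableSingletonClass α] [Fintype γ] [DecidableEq γ] [MeasurableSpace γ]
    [MeasurableSingletonClass γ] (ρ : Measure α) [IsProbabilityMeasure ρ] (β : α → γ) {ε : ℝ}
    (hε : 0 < ε) : ∃ q : α → ℝ, (∀ a, 0 < q a) ∧ (∀ c, ∑ a with β a = c, q a ≤ 1) ∧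
      ∑ a, ρ.real {a} * -Real.log (q a) ≤ shannon ρ - shannon (ρ.map β) + ε := by
  have he : 0 < 1 - Real.exp (-ε) := by
    have : Real.exp (-ε) < 1 := by simpa using hε
    linarith
  have hα : Nonempty α := nonempty_of_isProbabilityMeasure ρ
  have hc : (0 : ℝ) < Fintype.card α := by exact_mod_cast Fintype.card_pos
  have t1 : ∑ a, ρ.real {a} = 1 := by rw [sum_measureReal_singleton]; simp
  refine ⟨fun a => Real.exp (-ε) * (ρ.real {a} / (ρ.map β).real {β a}) +
    (1 - Real.exp (-ε)) / Fintype.card α, fun a => by positivity, fun c => ?_, ?_⟩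
  · have h1 : ∑ a with β a = c, ρ.real {a} / (ρ.map β).real {β a} ≤ 1 := by
      have : ∑ a with β a = c, ρ.real {a} / (ρ.map β).real {β a} =
          ∑ a with β a = c, ρ.real {a} / (ρ.map β).real {c} :=
        Finset.sum_congr rfl fun a ha => by rw [(Finset.mem_filter.1 ha).2]
      rw [this, ← Finset.sum_div, ← measureReal_map_singleton ρ β c]
      exact div_self_le_one _
    have h2 : ∑ a with β a = c, (1 - Real.exp (-ε)) / Fintype.card α ≤ 1 - Real.exp (-ε) := by
      rw [Finset.sum_const, nsmul_eq_mul, mul_div_left_comm]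
      refine mul_le_of_le_one_right he.le ((div_le_one hc).2 ?_)
      exact_mod_cast Finset.card_le_univ _
    rw [Finset.sum_add_distrib, ← Finset.mul_sum]
    have := mul_le_mul_of_nonneg_left h1 (Real.exp_pos (-ε)).le
    linarith
  · have key : ∀ a, ρ.real {a} * -Real.log (Real.exp (-ε) * (ρ.real {a} / (ρ.map β).real {β a}) +
        (1 - Real.exp (-ε)) / Fintype.card α) ≤ ρ.real {a} * -Real.log (ρ.real {a}) -
        ρ.real {a} * -Real.log ((ρ.map β).real {β a}) + ρ.real {a} * ε := by
      intro a
      rcases (measureReal_nonneg : 0 ≤ ρ.real {a}).eq_or_lt with p | p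
      · simp [← p]
      rw [← mul_sub, ← mul_add]
      refine mul_le_mul_of_nonneg_left ?_ p.le
      have hs := p.trans_le (measureReal_le_map ρ β a)
      have := Real.log_le_log (mul_pos (Real.exp_pos (-ε)) (div_pos p hs))
        (le_add_of_nonneg_right (div_pos he hc).le :
          Real.exp (-ε) * (ρ.real {a} / (ρ.map β).real {β a}) ≤ _ +
            (1 - Real.exp (-ε)) / Fintype.card α)
      rw [Real.log_mul (Real.exp_pos _).ne' (div_pos p hs).ne', Real.log_exp,
        Real.log_div p.ne' hs.ne'] at this
      linarith
    refine (Finset.sum_le_sum fun a _ => key a).trans (le_of_eq ?_)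
    rw [Finset.sum_add_distrib, Finset.sum_sub_distrib, ← Finset.sum_mul, t1, one_mul,
      shannon_eq_sum, shannon_eq_sum,
      sum_measureReal_map_mul ρ β fun c => -Real.log ((ρ.map β).real {c})]

/-! ### Upper bound for the relative entropy of sofic models -/

theorem unif_singleton (m : ℕ) (p : Fin m) : unif m {p} = (m : ENNReal)⁻¹ := by
  rw [unif, uniformOn_univ]
  simp

theorem prod_unif_real {S : Type*} [MeasurableSpace S] {m : ℕ} (η : Measure S)
    [IsProbabilityMeasure η] [NeZero m] {E : Set (S × Fin m)} (hE : MeasurableSet E) :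
    (η.prod (unif m)).real E = (m : ℝ)⁻¹ * ∑ p, η.real {s | (s, p) ∈ E} := by
  rw [measureReal_def, Measure.prod_apply_symm hE, lintegral_fintype,
    ENNReal.toReal_sum fun p _ => ENNReal.mul_ne_top (measure_ne_top _ _) (measure_ne_top _ _),
    Finset.mul_sum]
  refine Finset.sum_congr rfl fun p _ => ?_
  rw [ENNReal.toReal_mul, unif_singleton, ENNReal.toReal_inv, ENNReal.toReal_natCast, mul_comm]
  rfl

theorem measurable_perm_apply {m : ℕ} (g : ℤ) :
    Measurable fun s : SymMaps m × Fin m => s.1 g s.2 := by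
  have h1 : Measurable fun q : Equiv.Perm (Fin m) × Fin m => q.1 q.2 := Measurable.of_discrete
  have h2 : Measurable fun s : SymMaps m × Fin m => (s.1 g, s.2) :=
    ((measurable_pi_apply g).comp measurable_fst).prodMk measurable_snd
  exact h1.comp h2

theorem pushFactor_compProd {m : ℕ} {A B : Type*} [Fintype A] [MeasurableSpace A]
    [DiscreteMeasurableSpace A] [MeasurableSpace B] (κ : Measure (SymMaps m)) [IsFiniteMeasure κ]
    (k : Kernel (SymMaps m) (Fin m → A)) [IsMarkovKernel k] (β : A → B) :
    pushFactor β (κ ⊗ₘ k) = κ ⊗ₘ (k.map (β ∘ ·)) := by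
  rw [Measure.compProd_map (measurable_of_finite _)]
  rfl

theorem compProd_real {S α : Type*} [MeasurableSpace S] [MeasurableSpace α] (κ : Measure S)
    [IsProbabilityMeasure κ] (k : Kernel S α) [IsMarkovKernel k] {E : Set (S × α)}
    (hE : MeasurableSet E) : (κ ⊗ₘ k).real E = ∫ σ, (k σ).real {ψ | (σ, ψ) ∈ E} ∂κ := by
  rw [measureReal_def, Measure.compProd_apply hE, ← integral_toReal]
  · rfl
  · exact (Kernel.measurable_kernel_prodMk_left hE).aemeasurable
  · exact ae_of_all _ fun σ => measure_lt_top _ _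

section Disintegration

variable {m : ℕ} {A B : Type*} [Fintype A] [MeasurableSpace A]
  [DiscreteMeasurableSpace A] [Fintype B] [Nonempty B] [MeasurableSpace B]
  [DiscreteMeasurableSpace B]

theorem measurable_shannon_kernel {S α : Type*} [MeasurableSpace S] [Fintype α]
    [MeasurableSpace α] [MeasurableSingletonClass α] (k : Kernel S α) :
    Measurable fun σ => shannon (k σ) := by
  unfold shannon
  refine Finset.measurable_sum _ fun a _ => ?_
  exact Real.continuous_negMulLog.measurable.comp
    (k.measurable_coe (measurableSet_singleton a)).ennreal_toReal

theorem integrable_shannon_kernel {S α : Type*} [MeasurableSpace S] [Fintype α]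
    [MeasurableSpace α] [MeasurableSingletonClass α] (κ : Measure S) [IsFiniteMeasure κ]
    (k : Kernel S α) [IsMarkovKernel k] : Integrable (fun σ => shannon (k σ)) κ := by
  refine Integrable.of_bound (measurable_shannon_kernel k).aestronglyMeasurable
    (Real.log (Fintype.card α)) (ae_of_all _ fun σ => ?_)
  rw [Real.norm_of_nonneg (shannon_nonneg _)]
  exact shannon_le_log_card _

/-- The model entropy, computed from any disintegration into Markov kernels. -/
theorem modelEntropy_compProd [Nonempty A] (κ : Measure (SymMaps m)) [IsFiniteMeasure κ]
    (k : Kernel (SymMaps m) (Fin m → A)) [IsMarkovKernel k] :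
    modelEntropy (κ ⊗ₘ k) = (1 / (m : ℝ)) * ∫ σ, shannon (k σ) ∂κ := by
  rw [modelEntropy, Measure.fst_compProd]
  congr 1
  refine integral_congr_ae ?_
  filter_upwards [ProbabilityTheory.condKernel_compProd κ k] with σ hσ
  rw [hσ]

theorem modelEntropy_pushFactor_compProd (κ : Measure (SymMaps m)) [IsFiniteMeasure κ]
    (k : Kernel (SymMaps m) (Fin m → A)) [IsMarkovKernel k] (β : A → B) :
    modelEntropy (pushFactor β (κ ⊗ₘ k)) =
      (1 / (m : ℝ)) * ∫ σ, shannon ((k σ).map (β ∘ ·)) ∂κ := by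
  have : IsMarkovKernel (k.map (β ∘ · : (Fin m → A) → (Fin m → B))) :=
    Kernel.IsMarkovKernel.map k (measurable_of_finite _)
  have h := modelEntropy_compProd κ (k.map (β ∘ · : (Fin m → A) → (Fin m → B)))
  simp_rw [← pushFactor_compProd, Kernel.map_apply _ (measurable_of_finite _)] at h
  exact h

/-- The relative entropy of a model as an average of conditional entropies over its fibres. -/
theorem modelEntropy_sub_compProd [Nonempty A] (κ : Measure (SymMaps m)) [IsFiniteMeasure κ]
    (k : Kernel (SymMaps m) (Fin m → A)) [IsMarkovKernel k] (β : A → B) :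
    modelEntropy (κ ⊗ₘ k) - modelEntropy (pushFactor β (κ ⊗ₘ k)) =
      (m : ℝ)⁻¹ * ∫ σ, (shannon (k σ) - shannon ((k σ).map (β ∘ ·))) ∂κ := by
  have : IsMarkovKernel (k.map (β ∘ · : (Fin m → A) → (Fin m → B))) :=
    Kernel.IsMarkovKernel.map k (measurable_of_finite _)
  have h := integrable_shannon_kernel κ (k.map (β ∘ · : (Fin m → A) → (Fin m → B)))
  simp_rw [Kernel.map_apply _ (measurable_of_finite _)] at h
  rw [integral_sub (integrable_shannon_kernel κ k) h, modelEntropy_compProd,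
    modelEntropy_pushFactor_compProd]
  ring

theorem measurable_eval_window (F : Finset ℤ) :
    Measurable fun x : (SymMaps m × (Fin m → A)) × Fin m =>
      windowMap (fun g p => x.1.1 g p) x.1.2 F x.2 := by
  refine measurable_pi_lambda _ fun g => ?_
  have h2 : Measurable (fun q : (Fin m → A) × Fin m => q.1 q.2) := Measurable.of_discrete
  have h3 : Measurable fun x : (SymMaps m × (Fin m → A)) × Fin m => x.1.1 (g : ℤ) x.2 :=
    (measurable_perm_apply (g : ℤ)).comp
      ((measurable_fst.comp measurable_fst).prodMk measurable_snd)
  exact h2.comp ((measurable_snd.comp measurable_fst).prodMk h3)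

/-- The local statistics of the constructed process average the statistics at the sites `p` with
respect to the fibre measures. -/
theorem localStatistics_compProd [NeZero m] (κ : Measure (SymMaps m)) [IsProbabilityMeasure κ]
    (k : Kernel (SymMaps m) (Fin m → A)) [IsMarkovKernel k] (F : Finset ℤ) (a : F → A) :
    ((constructed (κ ⊗ₘ k)).localStatistics F).real {a} = (m : ℝ)⁻¹ * ∑ p, ∫ σ,
      ((k σ).map fun ψ => windowMap (fun g p => σ g p) ψ F p).real {a} ∂κ := by
  have hE : MeasurableSet ((fun x : (SymMaps m × (Fin m → A)) × Fin m =>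
      windowMap (fun g p => x.1.1 g p) x.1.2 F x.2) ⁻¹' {a}) :=
    measurable_eval_window F (measurableSet_singleton a)
  have h0 : ((constructed (κ ⊗ₘ k)).localStatistics F).real {a} =
      ((κ ⊗ₘ k).prod (unif m)).real ((fun x : (SymMaps m × (Fin m → A)) × Fin m =>
      windowMap (fun g p => x.1.1 g p) x.1.2 F x.2) ⁻¹' {a}) :=
    map_measureReal_apply (measurable_eval_window F) (measurableSet_singleton a)
  rw [h0, prod_unif_real _ hE]
  congr 1
  refine Finset.sum_congr rfl fun p _ => ?_
  have hEp : MeasurableSet {s : SymMaps m × (Fin m → A) |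
      (s, p) ∈ ((fun x : (SymMaps m × (Fin m → A)) × Fin m =>
      windowMap (fun g p => x.1.1 g p) x.1.2 F x.2) ⁻¹' {a})} :=
    (measurable_id.prodMk measurable_const) hE
  rw [compProd_real κ k hEp]
  refine integral_congr_ae (ae_of_all _ fun σ => ?_)
  dsimp only
  rw [map_measureReal_apply (measurable_of_finite _) (measurableSet_singleton _)]
  rfl

theorem integrable_window_real (κ : Measure (SymMaps m)) [IsProbabilityMeasure κ]
    (k : Kernel (SymMaps m) (Fin m → A)) [IsMarkovKernel k] (F : Finset ℤ) (a : F → A)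
    (p : Fin m) : Integrable (fun σ : SymMaps m =>
      ((k σ).map fun ψ => windowMap (fun g p => σ g p) ψ F p).real {a}) κ := by
  have hE : MeasurableSet {s : SymMaps m × (Fin m → A) |
      windowMap (fun g p => s.1 g p) s.2 F p = a} :=
    ((measurable_eval_window F).comp (measurable_id.prodMk measurable_const))
      (measurableSet_singleton a)
  have hm : Measurable fun σ : SymMaps m =>
      ((k σ).map fun ψ => windowMap (fun g p => σ g p) ψ F p).real {a} := by
    have := (Kernel.measurable_kernel_prodMk_left (κ := k) hE).ennreal_toReal
    convert this using 2 with σ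
    rw [map_measureReal_apply (measurable_of_finite _) (measurableSet_singleton _)]
    rfl
  refine Integrable.of_bound hm.aestronglyMeasurable 1 (ae_of_all _ fun σ => ?_)
  have := Measure.isProbabilityMeasure_map (μ := k σ)
    (measurable_of_finite fun ψ : Fin m → A => windowMap (fun g p => σ g p) ψ F p).aemeasurable
  rw [Real.norm_of_nonneg measureReal_nonneg]
  exact measureReal_le_one

/-- The relative entropy of a model is bounded by the expected code length of its local statistics,
up to an error that measures the failure of freeness. -/
theorem modelEntropy_sub_le_compProd [Nonempty A] [NeZero m] (κ : Measure (SymMaps m))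
    [IsProbabilityMeasure κ] (k : Kernel (SymMaps m) (Fin m → A)) [IsMarkovKernel k]
    (β : A → B) {F : Finset ℤ}
    (hF : F.Nonempty) [DecidableEq (F → B)] (q : (F → A) → ℝ) (hq0 : ∀ a, 0 < q a)
    (hq : ∀ c, ∑ a with β ∘ a = c, q a ≤ 1) :
    modelEntropy (κ ⊗ₘ k) - modelEntropy (pushFactor β (κ ⊗ₘ k)) ≤
      (F.card : ℝ)⁻¹ * ∑ a, ((constructed (κ ⊗ₘ k)).localStatistics F).real {a} *
        -Real.log (q a) +
      Real.log (Fintype.card A) * ∑ x ∈ F.offDiag,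
        (κ.prod (unif m)).real {s | s.1 x.1 s.2 = s.1 x.2 s.2} := by
  have hc : (0 : ℝ) < F.card := by exact_mod_cast hF.card_pos
  have hmeas : ∀ x : ℤ × ℤ, MeasurableSet {s : SymMaps m × Fin m | s.1 x.1 s.2 = s.1 x.2 s.2} :=
    fun x => measurableSet_eq_fun (measurable_perm_apply x.1) (measurable_perm_apply x.2)
  have hmeasp : ∀ (x : ℤ × ℤ) (p : Fin m), MeasurableSet {σ : SymMaps m | σ x.1 p = σ x.2 p} :=
    fun x p => (measurable_id.prodMk measurable_const) (hmeas x)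
  set r : (F → A) → Fin m → SymMaps m → ℝ := fun a p σ =>
    ((k σ).map fun ψ => windowMap (fun g p => σ g p) ψ F p).real {a} with hr
  set e : ℤ × ℤ → Fin m → SymMaps m → ℝ := fun x p =>
    Set.indicator {σ : SymMaps m | σ x.1 p = σ x.2 p} 1 with he
  have hpt : ∀ σ : SymMaps m, shannon (k σ) - shannon ((k σ).map (β ∘ ·)) ≤
      (F.card : ℝ)⁻¹ * ∑ a, (∑ p, r a p σ) * -Real.log (q a) +
      Real.log (Fintype.card A) * ∑ x ∈ F.offDiag, ∑ p, e x p σ := by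
    intro σ
    have h1 := card_mul_shannon_sub_le (k σ) β F σ
    have h2 : ∀ p, shannon ((k σ).map fun ψ => windowMap (fun g p => σ g p) ψ F p) -
        shannon (((k σ).map fun ψ => windowMap (fun g p => σ g p) ψ F p).map (β ∘ ·)) ≤
        ∑ a, r a p σ * -Real.log (q a) := by
      intro p
      have := Measure.isProbabilityMeasure_map (μ := k σ) (measurable_of_finite
        fun ψ : Fin m → A => windowMap (fun g p => σ g p) ψ F p).aemeasurable
      exact shannon_sub_shannon_map_le _ _ q (fun a => (hq0 a).le) hq (fun a _ => hq0 a)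
    have h3 : ∑ x ∈ F.offDiag, ∑ p, (if σ x.1 p = σ x.2 p then 1 else 0 : ℝ) =
        ∑ x ∈ F.offDiag, ∑ p, e x p σ := by
      refine Finset.sum_congr rfl fun x _ => Finset.sum_congr rfl fun p _ => ?_
      simp [he, Set.indicator]
    have h4 := h1.trans (add_le_add_left (Finset.sum_le_sum fun p _ => h2 p) _)
    rw [h3, Finset.sum_comm, mul_assoc] at h4
    simp_rw [← Finset.sum_mul] at h4
    rw [← le_div_iff₀' hc, add_div, mul_div_cancel_left₀ _ hc.ne', div_eq_inv_mul] at h4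
    exact h4
  have hir : ∀ a p, Integrable (r a p) κ := fun a p => integrable_window_real κ k F a p
  have hie : ∀ x p, Integrable (e x p) κ := fun x p =>
    (integrable_const (1 : ℝ)).indicator (hmeasp x p)
  have hi1 : Integrable (fun σ => (F.card : ℝ)⁻¹ * ∑ a, (∑ p, r a p σ) * -Real.log (q a)) κ :=
    (integrable_finsetSum _ fun a _ =>
      (integrable_finsetSum _ fun p _ => hir a p).mul_const _).const_mul _
  have hi2 : Integrable (fun σ =>
      Real.log (Fintype.card A) * ∑ x ∈ F.offDiag, ∑ p, e x p σ) κ :=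
    (integrable_finsetSum _ fun x _ => integrable_finsetSum _ fun p _ => hie x p).const_mul _
  have : IsMarkovKernel (k.map (β ∘ · : (Fin m → A) → (Fin m → B))) :=
    Kernel.IsMarkovKernel.map k (measurable_of_finite _)
  have hi3 := integrable_shannon_kernel κ (k.map (β ∘ · : (Fin m → A) → (Fin m → B)))
  simp_rw [Kernel.map_apply _ (measurable_of_finite _)] at hi3
  have hint := integral_mono ((integrable_shannon_kernel κ k).sub hi3) (hi1.add hi2) hpt
  rw [modelEntropy_sub_compProd]
  refine (mul_le_mul_of_nonneg_left hint (by positivity)).trans (le_of_eq ?_)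
  simp only [Pi.add_apply]
  rw [integral_add hi1 hi2, integral_const_mul, integral_const_mul, integral_finsetSum,
    integral_finsetSum, mul_add, mul_left_comm, mul_left_comm _ (Real.log _)]
  · congr 1
    · congr 1
      rw [Finset.mul_sum]
      refine Finset.sum_congr rfl fun a _ => ?_
      rw [integral_mul_const, integral_finsetSum _ fun p _ => hir a p,
        localStatistics_compProd, mul_assoc]
    · congr 1
      rw [Finset.mul_sum]
      refine Finset.sum_congr rfl fun x _ => ?_
      rw [integral_finsetSum _ fun p _ => hie x p, prod_unif_real _ (hmeas x)]
      congr 1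
      refine Finset.sum_congr rfl fun p _ => ?_
      rw [he, integral_indicator_one (hmeasp x p)]
      rfl
  · exact fun x _ => integrable_finsetSum _ fun p _ => hie x p
  · exact fun a _ => (integrable_finsetSum _ fun p _ => hir a p).mul_const _

end Disintegration

theorem abs_sub_le_two_mul_tvDist {α : Type*} [Fintype α] [MeasurableSpace α] (μ ν : Measure α)
    (a : α) : |μ.real {a} - ν.real {a}| ≤ 2 * tvDist μ ν := by
  rw [tvDist, ← mul_assoc]
  norm_num
  exact Finset.single_le_sum (f := fun a => |μ.real {a} - ν.real {a}|)
    (fun _ _ => abs_nonneg _) (Finset.mem_univ a)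

theorem AdaptedSeq.ConvergesTo.tendsto_real {Ω A : Type*} [MeasurableSpace Ω] [Fintype A]
    [MeasurableSpace A] {K : RandomSoficApprox} {S : AdaptedSeq K A}
    {X : ApproxProc Ω A} (hS : S.ConvergesTo X) (W : Finset ℤ) (a : W → A) :
    Tendsto (fun j => ((constructed (S.η j)).localStatistics W).real {a}) atTop
      (𝓝 ((X.localStatistics W).real {a})) := by
  rw [tendsto_iff_norm_sub_tendsto_zero]
  refine squeeze_zero (fun _ => norm_nonneg _)
    (fun j => abs_sub_le_two_mul_tvDist _ _ a) ?_
  simpa [processDist] using (hS W).const_mul 2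

theorem RandomSoficApprox.tendsto_nonfree (K : RandomSoficApprox) {g h : ℤ} (hgh : g ≠ h) :
    Tendsto (fun i => ((K.κ i).prod (unif (K.m i))).real {s | s.1 g s.2 = s.1 h s.2})
      atTop (𝓝 0) := by
  have h1 := (ENNReal.tendsto_toReal ENNReal.one_ne_top).comp (K.asymp_free g h hgh)
  have h2 := h1.const_sub 1
  rw [ENNReal.toReal_one, sub_self] at h2
  refine h2.congr fun i => ?_
  have h4 : MeasurableSet {s : SymMaps (K.m i) × Fin (K.m i) | s.1 g s.2 ≠ s.1 h s.2} :=
    (measurableSet_eq_fun (measurable_perm_apply g) (measurable_perm_apply h)).compl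
  have h5 := probReal_compl_eq_one_sub (μ := (K.κ i).prod (unif (K.m i))) h4
  change 1 - ((K.κ i).prod (unif (K.m i))).real _ = _
  rw [← h5]
  congr 1
  ext s; simp

variable {Ω A B : Type*} [MeasurableSpace Ω] [Fintype A] [Nonempty A] [MeasurableSpace A]
  [DiscreteMeasurableSpace A] [Fintype B] [Nonempty B] [MeasurableSpace B]
  [DiscreteMeasurableSpace B]

/-- Along every convergent adapted sequence the relative rate is at most the relative block entropy
of the limit, for every block length. -/
theorem AdaptedSeq.relRate_le {K : RandomSoficApprox} (S : AdaptedSeq K A) (X : ZProc Ω A)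
    (hS : S.ConvergesTo X.toApproxProc) (β : A → B) {n : ℕ} (hn : 0 < n) :
    S.relRate β ≤ (((blockEntropy X.T X.μ X.φ n - blockEntropy X.T X.μ (β ∘ X.φ) n) / n : ℝ) :
      EReal) := by
  classical
  set F : Finset ℤ := Finset.Ico 0 n
  have hFc : F.card = n := by simp [F]
  have hF : F.Nonempty := Finset.card_pos.1 (by omega)
  have hn' : (0 : ℝ) < n := by exact_mod_cast hn
  have hp : IsProbabilityMeasure (X.localStatistics F) :=
    Measure.isProbabilityMeasure_map (X.measurable_windowMap F).aemeasurable
  have hβ : (X.localStatistics F).map (β ∘ ·) = X.μ.map (windowMap X.T (β ∘ X.φ) F) := by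
    rw [ApproxProc.localStatistics, Measure.map_map (measurable_of_finite _)
      (X.measurable_windowMap F)]
    rfl
  refine EReal.le_of_forall_lt_iff_le.1 fun z hz => ?_
  rw [EReal.coe_lt_coe_iff] at hz
  set c := (blockEntropy X.T X.μ X.φ n - blockEntropy X.T X.μ (β ∘ X.φ) n) / n with hcdef
  obtain ⟨q, hq0, hq, hqs⟩ := exists_kernel_sum_log_le (X.localStatistics F) (β ∘ ·)
    (mul_pos hn' (half_pos (sub_pos.2 hz)))
  rw [hβ] at hqs
  have hlim : Tendsto (fun j => (F.card : ℝ)⁻¹ *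
      ∑ a, ((constructed (S.η j)).localStatistics F).real {a} * -Real.log (q a) +
      Real.log (Fintype.card A) * ∑ x ∈ F.offDiag,
        ((K.κ (S.idx j)).prod (unif (K.m (S.idx j)))).real {s | s.1 x.1 s.2 = s.1 x.2 s.2}) atTop
      (𝓝 ((F.card : ℝ)⁻¹ * ∑ a, (X.localStatistics F).real {a} * -Real.log (q a) +
        Real.log (Fintype.card A) * ∑ x ∈ F.offDiag, 0)) := by
    refine ((tendsto_finsetSum _ fun a _ => (hS.tendsto_real F a).mul_const _).const_mul _).add
      ((tendsto_finsetSum _ fun x hx => ?_).const_mul _)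
    exact (K.tendsto_nonfree (Finset.mem_offDiag.1 hx).2.2).comp S.strictMono_idx.tendsto_atTop
  have hlt : (F.card : ℝ)⁻¹ * ∑ a, (X.localStatistics F).real {a} * -Real.log (q a) +
        Real.log (Fintype.card A) * ∑ x ∈ F.offDiag, 0 < z := by
    rw [Finset.sum_const_zero, mul_zero, add_zero, hFc]
    refine (mul_le_mul_of_nonneg_left hqs (by positivity)).trans_lt ?_
    rw [mul_add, inv_mul_cancel_left₀ hn'.ne', ← div_eq_inv_mul]
    change c + _ < z
    linarith
  refine (limsup_le_limsup ?_).trans (limsup_const (z : EReal)).le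
  filter_upwards [hlim.eventually (gt_mem_nhds hlt)] with j hj
  rw [EReal.coe_le_coe_iff]
  refine le_trans ?_ hj.le
  have hfst : (S.η j).fst ⊗ₘ (S.η j).condKernel = S.η j :=
    Measure.disintegrate (S.η j) (S.η j).condKernel
  have := modelEntropy_sub_le_compProd (S.η j).fst (S.η j).condKernel β hF q hq0 hq
  simp only [hfst] at this
  simp only [S.fst_eq] at this
  exact this

/-! ### Classical relative entropy of a process -/

section Classical

variable {Ω A B C : Type*} [MeasurableSpace Ω] [MeasurableSpace A]
  [Fintype C] [MeasurableSpace C] [DiscreteMeasurableSpace C]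
  [Fintype B] [MeasurableSpace B] [DiscreteMeasurableSpace B]

/-- The same measure-preserving action with another observable. -/
def ZProc.withObs {Ω A C : Type*} [MeasurableSpace Ω] [MeasurableSpace A] [MeasurableSpace C]
    (X : ZProc Ω A) (ψ : Ω → C) (hψ : Measurable ψ) : ZProc Ω C where
  μ := X.μ
  isProb := X.isProb
  T := X.T
  measurePreserving_T := X.measurePreserving_T
  φ := ψ
  measurable_φ := hψ
  T_zero := X.T_zero
  T_add := X.T_add

theorem ZProc.measurable_windowMap_obs {Ω A C : Type*} [MeasurableSpace Ω] [MeasurableSpace A]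
    [MeasurableSpace C] (X : ZProc Ω A) {ψ : Ω → C} (hψ : Measurable ψ) (W : Finset ℤ) :
    Measurable (windowMap X.T ψ W) :=
  (X.withObs ψ hψ).measurable_windowMap W

theorem ent_comp_measurePreserving {α : Type*} [Fintype α] [MeasurableSpace α] {μ : Measure Ω}
    {T : Ω → Ω} (hT : MeasurePreserving T μ μ) {f : Ω → α} (hf : Measurable f) :
    ent μ (f ∘ T) = ent μ f := by
  rw [ent, ← Measure.map_map hf hT.measurable, hT.map_eq, ent]

/-- If `ψ` costs at most `ε` given a window `W` of `b`, then each shift of `ψ` costs at most `ε`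
given a larger window, so `n` of them cost at most `n ε`. -/
theorem ent_block_le (X : ZProc Ω A) {ψ : Ω → C} (hψ : Measurable ψ) {b : Ω → B}
    (hb : Measurable b) (W : Finset ℤ) {ε : ℝ}
    (hW : ent X.μ (fun x => (ψ x, windowMap X.T b W x)) ≤ ent X.μ (windowMap X.T b W) + ε)
    (V : Finset ℤ) (n : ℕ) (hV : ∀ i : ℕ, i < n → ∀ w ∈ W, w + i ∈ V) :
    ent X.μ (fun x => (windowMap X.T ψ (Finset.Ico 0 n) x, windowMap X.T b V x)) ≤
      ent X.μ (windowMap X.T b V) + n * ε := by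
  have hmV := X.measurable_windowMap_obs hb V
  have hmW := X.measurable_windowMap_obs hb W
  have hmψ := fun n : ℕ => X.measurable_windowMap_obs hψ (Finset.Ico 0 n)
  induction n with
  | zero =>
    simp only [Nat.cast_zero, zero_mul, add_zero]
    refine ent_mono hmV fun x y h => Prod.ext ?_ h
    funext i
    have := i.2
    simp at this
  | succ n ih =>
    have ih := ih fun i hi => hV i (by omega)
    have hTn := (X.measurePreserving_T n).measurable
    have h1 : ent X.μ (fun x => (windowMap X.T ψ (Finset.Ico 0 (n + 1 : ℕ)) x,
        windowMap X.T b V x)) + ent X.μ (windowMap X.T b V) ≤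
        ent X.μ (fun x => (windowMap X.T ψ (Finset.Ico 0 n) x, windowMap X.T b V x)) +
        ent X.μ (fun x => (ψ (X.T n x), windowMap X.T b V x)) := by
      refine ent_submodular ((hmψ n).prodMk hmV) ((hψ.comp hTn).prodMk hmV)
        (fun x y h h' => ?_) (fun x y h => congrArg Prod.snd h) (fun x y h => congrArg Prod.snd h)
      rw [Prod.mk.injEq] at h h' ⊢
      refine ⟨?_, h.2⟩
      funext i
      have hi := Finset.mem_Ico.1 i.2
      rcases eq_or_ne i.1 n with hin | hin
      · have : ψ (X.T i.1 x) = ψ (X.T i.1 y) := by rw [hin]; exact h'.1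
        exact this
      · exact congrFun h.1 ⟨i.1, Finset.mem_Ico.2 ⟨hi.1, by push_cast at hi; omega⟩⟩
    have h2 : ent X.μ (fun x => (ψ (X.T n x), windowMap X.T b V x)) +
        ent X.μ (windowMap X.T b W ∘ X.T n) ≤ ent X.μ (windowMap X.T b V) +
        ent X.μ ((fun x => (ψ x, windowMap X.T b W x)) ∘ X.T n) := by
      refine ent_submodular hmV ((hψ.prodMk hmW).comp hTn)
        (fun x y h h' => Prod.ext (Prod.mk.inj h').1 h) (fun x y h => ?_)
        (fun x y h => congrArg Prod.snd h)
      funext w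
      have := congrFun h ⟨w.1 + n, hV n (by omega) w.1 w.2⟩
      simp only [windowMap, X.T_add] at this
      exact this
    rw [ent_comp_measurePreserving (X.measurePreserving_T n) hmW,
      ent_comp_measurePreserving (X.measurePreserving_T n) (hψ.prodMk hmW)] at h2
    push_cast at h1 ⊢
    linarith

/-- If `ψ` has small conditional entropy given some finite window of `b`, its entropy rate hardly
exceeds that of `b`. -/
theorem entropyRate_le_add (X : ZProc Ω A) {ψ : Ω → C} (hψ : Measurable ψ) {b : Ω → B}
    (hb : Measurable b) (W : Finset ℤ) {ε : ℝ}
    (hW : ent X.μ (fun x => (ψ x, windowMap X.T b W x)) ≤ ent X.μ (windowMap X.T b W) + ε) :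
    entropyRate X.T X.μ ψ ≤ entropyRate X.T X.μ b + ε := by
  obtain ⟨k, hk⟩ : ∃ k : ℕ, ∀ w ∈ W, |w| < k := by
    refine ⟨W.sup Int.natAbs + 1, fun w hw => ?_⟩
    have := Finset.le_sup (f := Int.natAbs) hw
    rw [Int.abs_eq_natAbs]
    omega
  have hmain : ∀ n : ℕ, blockEntropy X.T X.μ ψ n ≤
      blockEntropy X.T X.μ b n + (blockEntropy X.T X.μ b (2 * k) + n * ε) := by
    intro n
    have h1 := ent_block_le X hψ hb W hW (Finset.Ico (-k : ℤ) (n + k)) n (by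
      intro i hi w hw
      have := abs_lt.1 (hk w hw)
      rw [Finset.mem_Ico]
      omega)
    have h2 : blockEntropy X.T X.μ ψ n ≤ ent X.μ (fun x => (windowMap X.T ψ (Finset.Ico 0 n) x,
        windowMap X.T b (Finset.Ico (-k : ℤ) (n + k)) x)) :=
      ent_mono ((X.measurable_windowMap_obs hψ _).prodMk (X.measurable_windowMap_obs hb _))
        fun x y h => congrArg Prod.fst h
    have h3 : ent X.μ (windowMap X.T b (Finset.Ico (-k : ℤ) (n + k))) ≤
        blockEntropy X.T X.μ b (n + 2 * k) := by
      have hm := X.measurable_windowMap_obs hb (Finset.Ico (0 : ℤ) (n + 2 * k : ℕ))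
      have hT := X.measurePreserving_T (-k)
      have := ent_comp_measurePreserving hT hm
      change _ ≤ ent X.μ _
      rw [← this]
      refine ent_mono (hm.comp hT.measurable) fun x y h => ?_
      funext i
      have hi := Finset.mem_Ico.1 i.2
      have := congrFun h ⟨i.1 + k, by rw [Finset.mem_Ico]; push_cast; omega⟩
      simp only [windowMap, Function.comp] at this ⊢
      have hT : X.T i.1 = X.T (i.1 + k) ∘ X.T (-k) := by rw [← X.T_add]; congr 1; ring
      rw [hT]
      exact this
    have h4 := subadditive_blockEntropy (X.withObs b hb) n (2 * k)
    have h5 : blockEntropy X.T X.μ b (n + 2 * k) ≤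
      blockEntropy X.T X.μ b n + blockEntropy X.T X.μ b (2 * k) := h4
    linarith
  have l1 : Tendsto (fun n : ℕ => blockEntropy X.T X.μ ψ n / n) atTop
    (𝓝 (entropyRate X.T X.μ ψ)) := tendsto_blockEntropy (X.withObs ψ hψ)
  have l2 : Tendsto (fun n : ℕ => blockEntropy X.T X.μ b n / n) atTop
    (𝓝 (entropyRate X.T X.μ b)) := tendsto_blockEntropy (X.withObs b hb)
  have l3 := (l2.add (tendsto_const_div_atTop_nhds_zero_nat (blockEntropy X.T X.μ b (2 * k)))).add
    (tendsto_const_nhds (x := ε))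
  rw [add_zero] at l3
  refine le_of_tendsto_of_tendsto l1 l3 ?_
  filter_upwards [eventually_gt_atTop 0] with n hn
  have hn' : (0 : ℝ) < n := by exact_mod_cast hn
  rw [div_le_iff₀ hn', add_mul, add_mul, div_mul_cancel₀ _ hn'.ne', div_mul_cancel₀ _ hn'.ne']
  have := hmain n
  linarith

theorem windowMap_determines {Ω A : Type*} {T : ℤ → Ω → Ω} {b : Ω → A} {W V : Finset ℤ}
    (h : W ⊆ V) {x y : Ω} (hxy : windowMap T b V x = windowMap T b V y) :
    windowMap T b W x = windowMap T b W y :=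
  funext fun w => congrFun hxy ⟨w.1, h w.2⟩

theorem invariantSigmaAlgebra_le {Ω A C : Type*} [MeasurableSpace Ω] [MeasurableSpace A]
    [MeasurableSpace C] (X : ZProc Ω A) {b : Ω → C}
    (hb : Measurable b) : invariantSigmaAlgebra X.T b ≤ ‹MeasurableSpace Ω› :=
  iSup_le fun g => (hb.comp (X.measurePreserving_T g).measurable).comap_le

/-- Sets of the invariant σ-algebra are approximated by sets that depend on a finite window. -/
theorem exists_window_symmDiff_lt (X : ZProc Ω A) {b : Ω → B} (hb : Measurable b) {E : Set Ω}
    (hE : MeasurableSet[invariantSigmaAlgebra X.T b] E) {δ : ENNReal} (hδ : 0 < δ) :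
    ∃ (W : Finset ℤ) (S : Set (W → B)), X.μ (symmDiff (windowMap X.T b W ⁻¹' S) E) < δ := by
  have hle := invariantSigmaAlgebra_le X hb
  have hm : ∀ W, @Measurable _ _ (invariantSigmaAlgebra X.T b) _ (windowMap X.T b W) := by
    intro W
    refine @measurable_pi_lambda _ _ _ (invariantSigmaAlgebra X.T b) _ _ fun w => ?_
    exact Measurable.mono (comap_measurable fun x => b (X.T w x)) (le_iSup (fun g : ℤ =>
      MeasurableSpace.comap (fun x => b (X.T g x)) inferInstance) w.1) le_rfl
  let R : Set (Set Ω) := {E | ∃ (W : Finset ℤ) (S : Set (W → B)), windowMap X.T b W ⁻¹' S = E}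
  -- Two window sets are given over a common window.
  have hcommon : ∀ (W W' : Finset ℤ) (S : Set (W → B)) (S' : Set (W' → B)),
      ∃ U U' : Set ((W ∪ W' : Finset ℤ) → B),
        windowMap X.T b (W ∪ W') ⁻¹' U = windowMap X.T b W ⁻¹' S ∧
        windowMap X.T b (W ∪ W') ⁻¹' U' = windowMap X.T b W' ⁻¹' S' := fun W W' S S' =>
    ⟨{f | (fun w : W => f ⟨w.1, Finset.mem_union_left _ w.2⟩) ∈ S},
      {f | (fun w : W' => f ⟨w.1, Finset.mem_union_right _ w.2⟩) ∈ S'}, rfl, rfl⟩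
  have hring : IsSetRing R := by
    refine ⟨⟨∅, ∅, rfl⟩, ?_, ?_⟩
    · rintro _ _ ⟨W, S, rfl⟩ ⟨W', S', rfl⟩
      obtain ⟨U, U', h, h'⟩ := hcommon W W' S S'
      exact ⟨_, U ∪ U', by rw [Set.preimage_union, h, h']⟩
    · rintro _ _ ⟨W, S, rfl⟩ ⟨W', S', rfl⟩
      obtain ⟨U, U', h, h'⟩ := hcommon W W' S S'
      exact ⟨_, U \ U', by rw [Set.preimage_sdiff, h, h']⟩
  have hgen : invariantSigmaAlgebra X.T b = MeasurableSpace.generateFrom R := by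
    refine le_antisymm (iSup_le fun g => ?_) (MeasurableSpace.generateFrom_le ?_)
    · rintro _ ⟨S, -, rfl⟩
      exact MeasurableSpace.measurableSet_generateFrom
        ⟨{g}, {f | f ⟨g, Finset.mem_singleton_self g⟩ ∈ S}, rfl⟩
    · rintro _ ⟨W, S, rfl⟩
      exact hm W (Set.toFinite S).measurableSet
  obtain ⟨t, ⟨W, S, rfl⟩, ht⟩ := @exists_measure_symmDiff_lt_of_generateFrom_isSetRing Ω
    (invariantSigmaAlgebra X.T b) (X.μ.trim hle) _ R hring
    ⟨{Set.univ}, Set.countable_singleton _, by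
      rintro _ rfl; exact ⟨∅, Set.univ, rfl⟩, by simp⟩ hgen E hE δ hδ
  refine ⟨W, S, ?_⟩
  rwa [trim_measurableSet_eq hle] at ht
  exact MeasurableSet.symmDiff (hm W (Set.toFinite S).measurableSet) hE

/-- The indicator of a set of the invariant σ-algebra has small conditional entropy given large
windows: it differs from the indicator of a window set by an event of small probability, whose
indicator has small entropy. -/
theorem exists_window_ent_indicator_le (X : ZProc Ω A) {b : Ω → B} (hb : Measurable b)
    {f : Ω → Bool} (hf : Measurable[invariantSigmaAlgebra X.T b] f) {ε : ℝ} (hε : 0 < ε) :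
    ∃ W : Finset ℤ, ∀ V, W ⊆ V → ent X.μ (fun x => (f x, windowMap X.T b V x)) ≤
      ent X.μ (windowMap X.T b V) + ε := by
  classical
  have hfm : Measurable f := hf.mono (invariantSigmaAlgebra_le X hb) le_rfl
  have hlim : Tendsto (fun d => Real.negMulLog d + Real.negMulLog (1 - d)) (𝓝 0) (𝓝 0) := by
    have : Continuous fun d => Real.negMulLog d + Real.negMulLog (1 - d) :=
      Real.continuous_negMulLog.add
        (Real.continuous_negMulLog.comp (continuous_const.sub continuous_id))
    simpa using this.tendsto 0
  obtain ⟨δ, hδ, hsmall⟩ := Metric.eventually_nhds_iff.1 (hlim.eventually (gt_mem_nhds hε))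
  obtain ⟨W, S, hS⟩ := exists_window_symmDiff_lt X hb (hf (measurableSet_singleton true))
    (ENNReal.ofReal_pos.2 hδ)
  refine ⟨W, fun V hV => ?_⟩
  have hmV := X.measurable_windowMap_obs hb V
  have hmW := X.measurable_windowMap_obs hb W
  let d : Ω → Bool := fun x => decide (x ∈ symmDiff (windowMap X.T b W ⁻¹' S) (f ⁻¹' {true}))
  have hE : MeasurableSet (symmDiff (windowMap X.T b W ⁻¹' S) (f ⁻¹' {true})) :=
    (hmW (Set.toFinite S).measurableSet).symmDiff (hfm (measurableSet_singleton true))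
  have hd : Measurable d := by
    refine measurable_to_bool ?_
    convert hE using 1
    ext x; simp [d]
  have h1 : ent X.μ (fun x => (f x, windowMap X.T b V x)) ≤ ent X.μ d +
      ent X.μ (windowMap X.T b V) := by
    refine ent_subadditive hd hmV fun x y h h' => Prod.ext ?_ h'
    have h2 : (x ∈ windowMap X.T b W ⁻¹' S) = (y ∈ windowMap X.T b W ⁻¹' S) := by
      simp only [Set.mem_preimage, windowMap_determines hV h']
    simp only [d, decide_eq_decide, Set.mem_symmDiff, Set.mem_preimage,
      Set.mem_singleton_iff] at h
    rw [Bool.eq_iff_iff]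
    tauto
  have h2 : ent X.μ d ≤ ε := by
    have ht : (X.μ.map d).real {true} =
        X.μ.real (symmDiff (windowMap X.T b W ⁻¹' S) (f ⁻¹' {true})) := by
      rw [map_measureReal_apply hd (measurableSet_singleton _)]
      congr 1
      ext x; simp [d]
    have := Measure.isProbabilityMeasure_map (μ := X.μ) hd.aemeasurable
    have hfalse : (X.μ.map d).real {false} = 1 - (X.μ.map d).real {true} := by
      rw [← probReal_compl_eq_one_sub (measurableSet_singleton _)]
      congr 1
      ext x; simp
    have h3 := hsmall (y := (X.μ.map d).real {true}) (by
      rw [Real.dist_0_eq_abs, abs_of_nonneg measureReal_nonneg, ht, measureReal_def]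
      exact (ENNReal.lt_ofReal_iff_toReal_lt (measure_ne_top _ _)).1 hS)
    rw [ent, shannon, Fintype.sum_bool, hfalse]
    exact h3.le
  linarith

/-- A finite-valued observable of the invariant σ-algebra has small conditional entropy given large
windows. -/
theorem exists_window_ent_le (X : ZProc Ω A) {b : Ω → B} (hb : Measurable b) {k : ℕ}
    {ψ : Ω → Fin k} (hψ : Measurable[invariantSigmaAlgebra X.T b] ψ) {ε : ℝ} (hε : 0 < ε) :
    ∃ W : Finset ℤ, ent X.μ (fun x => (ψ x, windowMap X.T b W x)) ≤
      ent X.μ (windowMap X.T b W) + ε := by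
  have hψm : Measurable ψ := hψ.mono (invariantSigmaAlgebra_le X hb) le_rfl
  have hbool : ∀ c, Measurable fun x => decide (ψ x = c) := fun c =>
    (Measurable.of_discrete (f := fun a : Fin k => decide (a = c))).comp hψm
  have key : ∀ s : Finset (Fin k), ∀ ε : ℝ, 0 < ε → ∃ W : Finset ℤ, ∀ V, W ⊆ V →
      ent X.μ (fun x => ((fun c : s => decide (ψ x = c)), windowMap X.T b V x)) ≤
        ent X.μ (windowMap X.T b V) + ε := by
    intro s
    induction s using Finset.induction_on with
    | empty =>
      refine fun ε hε => ⟨∅, fun V _ => ?_⟩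
      refine (ent_mono (X.measurable_windowMap_obs hb V) fun x y h => Prod.ext ?_ h).trans
        (le_add_of_nonneg_right hε.le)
      funext c
      exact absurd c.2 (Finset.notMem_empty _)
    | insert c s _ ih =>
      intro ε hε
      obtain ⟨W₁, h₁⟩ := ih (ε / 2) (half_pos hε)
      obtain ⟨W₂, h₂⟩ := exists_window_ent_indicator_le X hb (f := fun x => decide (ψ x = c))
        ((Measurable.of_discrete (f := fun a : Fin k => decide (a = c))).comp hψ) (half_pos hε)
      refine ⟨W₁ ∪ W₂, fun V hV => ?_⟩
      have g₁ := h₁ V (Finset.union_subset_left hV)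
      have g₂ := h₂ V (Finset.union_subset_right hV)
      have hmV := X.measurable_windowMap_obs hb V
      have : ent X.μ (fun x => ((fun d : ↥(insert c s) => decide (ψ x = d)),
          windowMap X.T b V x)) + ent X.μ (windowMap X.T b V) ≤
          ent X.μ (fun x => ((fun c : s => decide (ψ x = c)), windowMap X.T b V x)) +
          ent X.μ (fun x => (decide (ψ x = c), windowMap X.T b V x)) := by
        refine ent_submodular ((measurable_pi_lambda _ fun c : s => hbool c).prodMk hmV)
          ((hbool c).prodMk hmV) (fun x y h h' => ?_) (fun x y h => (Prod.mk.inj h).2)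
          (fun x y h => (Prod.mk.inj h).2)
        rw [Prod.mk.injEq] at h h' ⊢
        refine ⟨?_, h.2⟩
        funext d
        rcases Finset.mem_insert.1 d.2 with hd | hd
        · rw [hd]; exact h'.1
        · exact congrFun h.1 ⟨d.1, hd⟩
      linarith
  obtain ⟨W, hW⟩ := key Finset.univ ε hε
  refine ⟨W, le_trans (ent_mono ((measurable_pi_lambda _
    fun c : (Finset.univ : Finset (Fin k)) => hbool c).prodMk (X.measurable_windowMap_obs hb W))
    fun x y h => ?_) (hW W subset_rfl)⟩
  rw [Prod.mk.injEq] at h ⊢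
  refine ⟨?_, h.2⟩
  have := congrFun h.1 ⟨ψ y, Finset.mem_univ _⟩
  simpa using this

/-- The entropy rate of an observable of the invariant σ-algebra generated by `b` is at most the
entropy rate of `b` (the theorem of Kolmogorov and Sinai). -/
theorem entropyRate_le_of_measurable (X : ZProc Ω A) {b : Ω → B} (hb : Measurable b) {k : ℕ}
    {ψ : Ω → Fin k} (hψ : Measurable[invariantSigmaAlgebra X.T b] ψ) :
    entropyRate X.T X.μ ψ ≤ entropyRate X.T X.μ b := by
  refine le_of_forall_pos_le_add fun ε hε => ?_
  obtain ⟨W, hW⟩ := exists_window_ent_le X hb hψ hε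
  exact entropyRate_le_add X (hψ.mono (invariantSigmaAlgebra_le X hb) le_rfl) hb W hW

theorem entropyRate_mono {D : Type*} [Fintype D] [MeasurableSpace D] [DiscreteMeasurableSpace D]
    (X : ZProc Ω A)
    {f : Ω → C} {g : Ω → D} (hf : Measurable f) (hg : Measurable g)
    (h : ∀ x y, g x = g y → f x = f y) : entropyRate X.T X.μ f ≤ entropyRate X.T X.μ g := by
  refine le_of_tendsto_of_tendsto' (tendsto_blockEntropy (X.withObs f hf))
    (tendsto_blockEntropy (X.withObs g hg)) fun n => ?_
  refine div_le_div_of_nonneg_right (ent_mono (X.measurable_windowMap_obs hg _)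
    fun x y hxy => ?_) n.cast_nonneg
  exact funext fun w => h _ _ (congrFun hxy w)

/-- Classical relative entropy is the difference of the entropies. -/
theorem ZProc.relEntropy_eq [Fintype A] [DiscreteMeasurableSpace A] (X : ZProc Ω A) (β : A → B) :
    X.relEntropy β = ((X.entropy - (X.factor β).entropy : ℝ) : EReal) := by
  have hb : Measurable (β ∘ X.φ) := (X.factor β).measurable_φ
  refine le_antisymm ?_ ?_
  · let e := Fintype.equivFin B
    have hℱ : Measurable[invariantSigmaAlgebra X.T (β ∘ X.φ)] (e ∘ β ∘ X.φ) := by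
      refine (measurable_of_finite e).comp ?_
      refine Measurable.mono (comap_measurable (β ∘ X.φ)) ?_ le_rfl
      refine le_trans (le_of_eq ?_) (le_iSup (fun g : ℤ =>
        MeasurableSpace.comap (fun x => (β ∘ X.φ) (X.T g x)) inferInstance) 0)
      simp only [X.T_zero]
      rfl
    have hm : Measurable (e ∘ β ∘ X.φ) := (measurable_of_finite e).comp hb
    refine iInf_le_of_le _ (iInf_le_of_le (e ∘ β ∘ X.φ) (iInf_le_of_le hℱ ?_))
    rw [EReal.coe_le_coe_iff]
    refine sub_le_sub (entropyRate_mono X (X.measurable_φ.prodMk hm) X.measurable_φ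
      fun x y h => ?_) (entropyRate_mono X hb hm fun x y h => e.injective h)
    simp only [Function.comp, h]
  · refine le_iInf fun k => le_iInf fun ψ => le_iInf fun hψ => ?_
    rw [EReal.coe_le_coe_iff]
    have hψm : Measurable ψ := hψ.mono (invariantSigmaAlgebra_le X hb) le_rfl
    exact sub_le_sub (entropyRate_mono X X.measurable_φ (X.measurable_φ.prodMk hψm)
      fun x y h => (Prod.mk.inj h).1) (entropyRate_le_of_measurable X hb hψ)

end Classical

/-! ### Cutting the cycles of a permutation into blocks -/

section Blocks

variable {m : ℕ} (τ : Equiv.Perm (Fin m))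

theorem zpow_apply_zpow_apply (i j : ℤ) (p : Fin m) : (τ ^ i) ((τ ^ j) p) = (τ ^ (i + j)) p := by
  rw [zpow_add, Equiv.Perm.mul_apply]

open Classical in
/-- The sites of a permutation whose period is smaller than `N`. -/
noncomputable def shortSites (N : ℕ) : Finset (Fin m) :=
  Finset.univ.filter fun p => ∃ k : ℕ, 0 < k ∧ k < N ∧ (τ ^ (k : ℤ)) p = p

/-- A transversal of the cycles has few points when few points lie in short cycles. -/
theorem exists_transversal : ∃ R : Finset (Fin m),
    (∀ q, ∃ k : ℕ, (τ ^ (-(k : ℤ))) q ∈ R) ∧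
    ∀ N : ℕ, N * R.card ≤ m + N * (shortSites τ N).card := by
  classical
  let rep : Fin m → Fin m := fun q => (Quotient.mk (Equiv.Perm.SameCycle.setoid τ) q).out
  have hrep : ∀ q, τ.SameCycle (rep q) q := fun q =>
    @Quotient.mk_out _ (Equiv.Perm.SameCycle.setoid τ) q
  have hrep' : ∀ q q', τ.SameCycle q q' → rep q = rep q' := fun q q' h => by
    have : Quotient.mk (Equiv.Perm.SameCycle.setoid τ) q = Quotient.mk _ q' := Quotient.sound h
    simp only [rep, this]
  have hidem : ∀ r ∈ Finset.univ.image rep, rep r = r := by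
    intro r hr
    obtain ⟨q, -, rfl⟩ := Finset.mem_image.1 hr
    exact hrep' _ _ (hrep q)
  refine ⟨Finset.univ.image rep, fun q => ?_, fun N => ?_⟩
  · obtain ⟨k, hk⟩ := (Equiv.Perm.sameCycle_inv.2 (hrep q).symm).exists_nat_pow_eq
    refine ⟨k, ?_⟩
    rw [zpow_neg, zpow_natCast, ← inv_pow, hk]
    exact Finset.mem_image_of_mem _ (Finset.mem_univ q)
  · set R := Finset.univ.image rep
    have hsplit : R.card ≤ (R \ shortSites τ N).card + (shortSites τ N).card := by
      have := Finset.le_card_sdiff (shortSites τ N) R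
      omega
    have hinj : Set.InjOn (fun x : Fin m × ℕ => (τ ^ (x.2 : ℤ)) x.1)
        ((R \ shortSites τ N) ×ˢ Finset.range N : Finset (Fin m × ℕ)) := by
      rintro ⟨r, k⟩ hr ⟨r', l⟩ hr' h
      simp only [Finset.coe_product, Set.mem_prod, Finset.mem_coe, Finset.mem_sdiff,
        Finset.mem_range] at hr hr' h
      have hc : τ.SameCycle r r' := ⟨k - l, by
        have := congrArg (τ ^ (-(l : ℤ))) h
        rw [zpow_apply_zpow_apply, zpow_apply_zpow_apply] at this
        simpa [sub_eq_neg_add] using this⟩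
      have hrr : r = r' := by
        rw [← hidem r hr.1.1, ← hidem r' hr'.1.1]; exact hrep' _ _ hc
      subst hrr
      have haux : ∀ k l : ℕ, k < N → l < N → (τ ^ (k : ℤ)) r = (τ ^ (l : ℤ)) r → ¬ k < l := by
        intro k l _ hl h hkl
        refine hr.1.2 (Finset.mem_filter.2 ⟨Finset.mem_univ _, l - k, by omega, by omega, ?_⟩)
        have := congrArg (τ ^ (-(k : ℤ))) h
        rw [zpow_apply_zpow_apply, zpow_apply_zpow_apply] at this
        rw [Nat.cast_sub hkl.le, sub_eq_neg_add, ← this]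
        simp
      have := haux k l hr.2 hr'.2 h
      have := haux l k hr'.2 hr.2 h.symm
      rw [show k = l by omega]
    have hcard := Finset.card_le_univ
      (((R \ shortSites τ N) ×ˢ Finset.range N).image fun x : Fin m × ℕ => (τ ^ (x.2 : ℤ)) x.1)
    rw [Finset.card_image_of_injOn hinj, Finset.card_product, Finset.card_range,
      Fintype.card_fin] at hcard
    calc N * R.card ≤ N * ((R \ shortSites τ N).card + (shortSites τ N).card) :=
          Nat.mul_le_mul_left _ hsplit
      _ = (R \ shortSites τ N).card * N + N * (shortSites τ N).card := by ring
      _ ≤ _ := Nat.add_le_add_right hcard _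

/-- Most of the sites of a permutation with few short cycles are covered by disjoint orbit segments
of a prescribed length `n`. -/
theorem exists_blockStarts {n : ℕ} (hn : 0 < n) : ∃ P : Finset (Fin m),
    Function.Injective (fun x : P × Finset.Ico (0 : ℤ) n => (τ ^ (x.2 : ℤ)) (x.1 : Fin m)) ∧
    ∀ N : ℕ, N * m ≤ N * (n * P.card) + n * (m + N * (shortSites τ N).card) := by
  classical
  obtain ⟨R, hR, hcard⟩ := exists_transversal τ
  -- The position of a site in its cycle, counted from the representative.
  let c : Fin m → ℕ := fun q => Nat.find (hR q)
  have hc : ∀ q k, c q = k ↔ (τ ^ (-(k : ℤ))) q ∈ R ∧ ∀ i < k, (τ ^ (-(i : ℤ))) q ∉ R :=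
    fun q k => Nat.find_eq_iff (hR q)
  have hback : ∀ q (j : ℕ), j ≤ c q → c ((τ ^ (-(j : ℤ))) q) = c q - j := by
    intro q j hj
    obtain ⟨h1, h2⟩ := (hc q _).1 rfl
    rw [hc]
    refine ⟨?_, fun i hi => ?_⟩
    · rw [zpow_apply_zpow_apply]
      convert h1 using 3
      push_cast [hj]
      ring
    · rw [zpow_apply_zpow_apply]
      convert h2 (i + j) (by omega) using 4
      push_cast
      ring
  -- Blocks start at the positions divisible by `n`, unless they would run past the end of the cycle.
  let P : Finset (Fin m) := Finset.univ.filter fun p =>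
    n ∣ c p ∧ ∀ j : ℕ, 0 < j → j < n → (τ ^ (j : ℤ)) p ∉ R
  have hfor : ∀ p ∈ P, ∀ k : ℕ, k < n → c ((τ ^ (k : ℤ)) p) = c p + k := by
    intro p hp k hk
    obtain ⟨h1, h2⟩ := (hc p _).1 rfl
    have hp := (Finset.mem_filter.1 hp).2
    rw [hc]
    refine ⟨?_, fun i hi => ?_⟩
    · rw [zpow_apply_zpow_apply]
      convert h1 using 3
      push_cast
      ring
    · rw [zpow_apply_zpow_apply]
      rcases lt_or_ge i k with hik | hik
      · convert hp.2 (k - i) (by omega) (by omega) using 4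
        push_cast [hik.le]
        ring
      · convert h2 (i - k) (by omega) using 4
        push_cast [hik]
        ring
  refine ⟨P, ?_, fun N => ?_⟩
  · rintro ⟨⟨p, hp⟩, g, hg⟩ ⟨⟨p', hp'⟩, g', hg'⟩ h
    rw [Finset.mem_Ico] at hg hg'
    lift g to ℕ using hg.1
    lift g' to ℕ using hg'.1
    have hg := hg.2
    have hg' := hg'.2
    rw [Nat.cast_lt] at hg hg'
    dsimp only at h
    have h1 := hfor p hp g hg
    have h2 := hfor p' hp' g' hg'
    rw [h, h2] at h1
    obtain ⟨u, hu⟩ := (Finset.mem_filter.1 hp).2.1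
    obtain ⟨v, hv⟩ := (Finset.mem_filter.1 hp').2.1
    have h3 : g = g' := by
      have := congrArg (· % n) h1
      simp only [hu, hv, Nat.mul_add_mod, Nat.mod_eq_of_lt hg, Nat.mod_eq_of_lt hg'] at this
      exact this.symm
    subst h3
    have := (τ ^ (g : ℤ)).injective h
    subst this
    rfl
  -- An uncovered site is followed by a representative within fewer than `n` steps.
  · set cov : Finset (Fin m) := (P ×ˢ Finset.range n).image fun x => (τ ^ (x.2 : ℤ)) x.1
    set unc : Finset (Fin m) := (Finset.range n ×ˢ R).image fun x => (τ ^ (-(x.1 : ℤ))) x.2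
    have hall : ∀ q, q ∈ cov ∪ unc := by
      intro q
      rw [Finset.mem_union, or_iff_not_imp_left]
      intro hq
      set k := c q % n with hk
      have hkc : k ≤ c q := Nat.mod_le _ _
      have hkn : k < n := Nat.mod_lt _ hn
      have hback' := hback q k hkc
      set p := (τ ^ (-(k : ℤ))) q with hp
      have hpq : (τ ^ (k : ℤ)) p = q := by
        rw [hp, zpow_apply_zpow_apply]; simp
      have hpP : p ∉ P := fun h => hq (Finset.mem_image.2
        ⟨(p, k), Finset.mem_product.2 ⟨h, Finset.mem_range.2 hkn⟩, hpq⟩)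
      have hdvd : n ∣ c p := by rw [hback']; exact Nat.dvd_sub_mod _
      simp only [P, Finset.mem_filter, Finset.mem_univ, true_and, not_and, not_forall,
        not_not] at hpP
      obtain ⟨j, hj0, hjn, hj⟩ := hpP hdvd
      have hkj : k < j := by
        by_contra hle
        refine ((hc q _).1 rfl).2 (k - j) (by omega) ?_
        rw [hp, zpow_apply_zpow_apply] at hj
        convert hj using 3
        push_cast [not_lt.1 hle]
        ring
      refine Finset.mem_image.2 ⟨(j - k, (τ ^ (j : ℤ)) p), Finset.mem_product.2
        ⟨Finset.mem_range.2 (by omega), hj⟩, ?_⟩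
      dsimp only
      rw [zpow_apply_zpow_apply, ← hpq]
      congr 2
      push_cast [hkj.le]
      ring
    have h1 : m ≤ n * P.card + n * R.card := by
      calc m = (Finset.univ : Finset (Fin m)).card := by simp
        _ ≤ (cov ∪ unc).card := Finset.card_le_card fun q _ => hall q
        _ ≤ cov.card + unc.card := Finset.card_union_le _ _
        _ ≤ (P ×ˢ Finset.range n).card + (Finset.range n ×ˢ R).card :=
          add_le_add Finset.card_image_le Finset.card_image_le
        _ = _ := by
          rw [Finset.card_product, Finset.card_product, Finset.card_range]; ring
    calc N * m ≤ N * (n * P.card + n * R.card) := Nat.mul_le_mul_left _ h1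
      _ = N * (n * P.card) + n * (N * R.card) := by ring
      _ ≤ _ := Nat.add_le_add_left (Nat.mul_le_mul_left _ (hcard N)) _

end Blocks

/-! ### Configurations made of independent blocks -/

section BlockMeasure

variable {m n : ℕ} {A B : Type*} [Nonempty A]

/-- The configuration with the block `ω p` along the orbit segment of length `n` that starts at `p`,
for `p ∈ P`, and with a default symbol at the sites outside these segments. -/
noncomputable def blockConfig (τ : Equiv.Perm (Fin m)) (P : Finset (Fin m))
    (ω : P → Finset.Ico (0 : ℤ) n → A) : Fin m → A :=
  Function.extend (fun x : P × Finset.Ico (0 : ℤ) n => (τ ^ (x.2 : ℤ)) (x.1 : Fin m))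
    (fun x => ω x.1 x.2) (fun _ => Classical.arbitrary A)

variable [MeasurableSpace A]

/-- The law of the configuration made of independent blocks with law `ρ`. -/
noncomputable def blockMeasure (τ : Equiv.Perm (Fin m)) (P : Finset (Fin m))
    (ρ : Measure (Finset.Ico (0 : ℤ) n → A)) : Measure (Fin m → A) :=
  (Measure.pi fun _ : P => ρ).map (blockConfig τ P)

variable [Fintype A] [DiscreteMeasurableSpace A] [Fintype B] [MeasurableSpace B]
  [DiscreteMeasurableSpace B]
  {τ : Equiv.Perm (Fin m)} {P : Finset (Fin m)}
  {ρ : Measure (Finset.Ico (0 : ℤ) n → A)} [IsProbabilityMeasure ρ]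

instance instIsProbBlockMeasure : IsProbabilityMeasure (blockMeasure τ P ρ) :=
  Measure.isProbabilityMeasure_map (measurable_of_finite _).aemeasurable

theorem shannon_blockMeasure (hinj : Function.Injective
    (fun x : P × Finset.Ico (0 : ℤ) n => (τ ^ (x.2 : ℤ)) (x.1 : Fin m))) :
    shannon (blockMeasure τ P ρ) = P.card * shannon ρ := by
  classical
  have h1 := shannon_pi (ι := P) ρ
  rw [Fintype.card_coe] at h1
  rw [← h1]
  have h2 : shannon (Measure.pi fun _ : P => ρ) = ent (Measure.pi fun _ : P => ρ) id := by
    rw [ent, Measure.map_id]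
  rw [h2]
  refine ent_congr (measurable_of_finite _) (measurable_of_finite _) fun x y => ?_
  constructor
  · intro h; simp only [id] at h; rw [h]
  · intro h
    funext p g
    have := congrFun h ((τ ^ (g : ℤ)) (p : Fin m))
    rwa [blockConfig, blockConfig, hinj.extend_apply _ _ (p, g),
      hinj.extend_apply _ _ (p, g)] at this

theorem shannon_blockMeasure_map (hinj : Function.Injective
    (fun x : P × Finset.Ico (0 : ℤ) n => (τ ^ (x.2 : ℤ)) (x.1 : Fin m))) (β : A → B) :
    shannon ((blockMeasure τ P ρ).map (β ∘ ·)) = P.card * shannon (ρ.map (β ∘ ·)) := by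
  classical
  have : IsProbabilityMeasure (ρ.map (β ∘ · : _ → Finset.Ico (0 : ℤ) n → B)) :=
    Measure.isProbabilityMeasure_map (measurable_of_finite _).aemeasurable
  have h1 := shannon_pi (ι := P) (ρ.map (β ∘ · : _ → Finset.Ico (0 : ℤ) n → B))
  rw [Fintype.card_coe, ← Measure.pi_map_pi fun _ => (measurable_of_finite _).aemeasurable] at h1
  rw [← h1, blockMeasure, Measure.map_map (measurable_of_finite _) (measurable_of_finite _)]
  refine ent_congr (measurable_of_finite _) (measurable_of_finite _) fun x y => ?_
  constructor
  · intro h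
    funext q
    simp only [Function.comp]
    by_cases hq : ∃ x : P × Finset.Ico (0 : ℤ) n, (τ ^ (x.2 : ℤ)) (x.1 : Fin m) = q
    · obtain ⟨⟨p, g⟩, rfl⟩ := hq
      rw [blockConfig, blockConfig, hinj.extend_apply _ _ (p, g), hinj.extend_apply _ _ (p, g)]
      exact congrFun (congrFun h p) g
    · rw [blockConfig, blockConfig, Function.extend_apply' _ _ _ hq,
        Function.extend_apply' _ _ _ hq]
  · intro h
    funext p g
    have := congrFun h ((τ ^ (g : ℤ)) (p : Fin m))
    simp only [Function.comp] at this
    rwa [blockConfig, blockConfig, hinj.extend_apply _ _ (p, g),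
      hinj.extend_apply _ _ (p, g)] at this

end BlockMeasure

/-! ### Concentration of the empirical statistics -/

section Concentration

variable {Ω A : Type*} {m n : ℕ}

theorem unif_real (m : ℕ) [NeZero m] (p : Fin m → Prop) [DecidablePred p] :
    (unif m).real {q | p q} = (m : ℝ)⁻¹ * (Finset.univ.filter p).card := by
  have h : {q | p q} = ((Finset.univ.filter p : Finset (Fin m)) : Set (Fin m)) := by ext; simp
  rw [h, ← sum_measureReal_singleton]
  simp_rw [measureReal_def, unif_singleton]
  rw [Finset.sum_const, nsmul_eq_mul, mul_comm]
  simp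

/-- The blocks that show the pattern `a` in the window `t + W`. -/
def patternSet {W : Finset ℤ} (n : ℕ) (a : W → A) (t : ℤ) : Set (Finset.Ico (0 : ℤ) n → A) :=
  {u | ∀ (w : W) (h : t + w ∈ Finset.Ico (0 : ℤ) n), u ⟨t + w, h⟩ = a w}

/-- The number of occurrences of the pattern `a` in a block, at distance at least `k` from its
ends. -/
noncomputable def patternCount {W : Finset ℤ} (n k : ℕ) (a : W → A)
    (u : Finset.Ico (0 : ℤ) n → A) : ℝ :=
  ∑ t ∈ Finset.Ico (k : ℤ) (n - k), (patternSet n a t).indicator 1 u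

theorem patternCount_nonneg {W : Finset ℤ} (k : ℕ) (a : W → A)
    (u : Finset.Ico (0 : ℤ) n → A) : 0 ≤ patternCount n k a u :=
  Finset.sum_nonneg fun _ _ => Set.indicator_nonneg (fun _ _ => zero_le_one) _

theorem patternCount_le {W : Finset ℤ} (k : ℕ) (a : W → A)
    (u : Finset.Ico (0 : ℤ) n → A) : patternCount n k a u ≤ n := by
  calc patternCount n k a u ≤ ∑ t ∈ Finset.Ico (k : ℤ) (n - k), (1 : ℝ) :=
        Finset.sum_le_sum fun t _ => Set.indicator_le_self' (fun _ _ => zero_le_one) _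
    _ ≤ n := by
        rw [Finset.sum_const, nsmul_eq_mul, mul_one, Int.card_Ico]
        exact_mod_cast (by omega : ((n : ℤ) - k - k).toNat ≤ n)

variable [MeasurableSpace Ω] [Fintype A] [MeasurableSpace A] [DiscreteMeasurableSpace A]

theorem localStatistics_patternSet (X : ZProc Ω A) {W : Finset ℤ} (a : W → A) {t : ℤ}
    (ht : ∀ w ∈ W, t + w ∈ Finset.Ico (0 : ℤ) n) :
    (X.localStatistics (Finset.Ico (0 : ℤ) n)).real (patternSet n a t) =
      (X.localStatistics W).real {a} := by
  rw [ApproxProc.localStatistics, ApproxProc.localStatistics,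
    map_measureReal_apply (X.measurable_windowMap _) (Set.toFinite _).measurableSet,
    map_measureReal_apply (X.measurable_windowMap _) (measurableSet_singleton _)]
  have hT := X.measurePreserving_T t
  rw [← hT.measureReal_preimage
    ((X.measurable_windowMap W (measurableSet_singleton a)).nullMeasurableSet)]
  congr 1
  ext x
  simp only [patternSet, Set.mem_preimage, Set.mem_ofPred_eq, Set.mem_singleton_iff, funext_iff,
    windowMap]
  refine forall_congr' fun w => ?_
  have : X.T (w.1) (X.T t x) = X.T (t + w.1) x := by rw [add_comm, X.T_add]; rfl
  rw [this]
  exact ⟨fun h => h (ht w.1 w.2), fun h _ => h⟩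

theorem integral_patternCount (X : ZProc Ω A) (k : ℕ) (a : Finset.Icc (-k : ℤ) k → A)
    (hk : 2 * k ≤ n) : ∫ u, patternCount n k a u ∂(X.localStatistics (Finset.Ico (0 : ℤ) n)) =
      ((n : ℝ) - 2 * k) * (X.localStatistics (Finset.Icc (-k : ℤ) k)).real {a} := by
  have hp : IsProbabilityMeasure (X.localStatistics (Finset.Ico (0 : ℤ) n)) :=
    Measure.isProbabilityMeasure_map (X.measurable_windowMap _).aemeasurable
  refine (integral_finsetSum _ fun t _ =>
    (integrable_const (1 : ℝ)).indicator (Set.toFinite _).measurableSet).trans ?_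
  have : ∀ t ∈ Finset.Ico (k : ℤ) (n - k), ∫ u, (patternSet n a t).indicator 1 u
      ∂(X.localStatistics (Finset.Ico (0 : ℤ) n)) =
      (X.localStatistics (Finset.Icc (-k : ℤ) k)).real {a} := by
    intro t ht
    rw [integral_indicator_one (Set.toFinite _).measurableSet]
    refine localStatistics_patternSet X a fun w hw => ?_
    rw [Finset.mem_Ico] at ht ⊢
    rw [Finset.mem_Icc] at hw
    omega
  refine (Finset.sum_congr rfl this).trans ?_
  rw [Finset.sum_const, nsmul_eq_mul, Int.card_Ico]
  congr 1
  have : (((n : ℤ) - k - k).toNat : ℤ) = n - 2 * k := by omega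
  exact_mod_cast this

/-- The number of pattern occurrences in independent blocks concentrates around its mean. -/
theorem pi_patternCount_deviation (X : ZProc Ω A) (P : Finset (Fin m)) (hP : n * P.card ≤ m)
    (k : ℕ) (a : Finset.Icc (-k : ℤ) k → A) (hk : 2 * k ≤ n) {δ : ℝ} (hδ : 0 < δ) (hm : 0 < m) :
    (Measure.pi fun _ : P => X.localStatistics (Finset.Ico (0 : ℤ) n)).real
      {ω | δ * m ≤ |∑ p, patternCount n k a (ω p) - P.card * (((n : ℝ) - 2 * k) *
        (X.localStatistics (Finset.Icc (-k : ℤ) k)).real {a})|} ≤ n / (m * δ ^ 2) := by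
  have hp : IsProbabilityMeasure (X.localStatistics (Finset.Ico (0 : ℤ) n)) :=
    Measure.isProbabilityMeasure_map (X.measurable_windowMap _).aemeasurable
  have hm' : (0 : ℝ) < m := by exact_mod_cast hm
  set ρ := X.localStatistics (Finset.Ico (0 : ℤ) n)
  set μP := Measure.pi fun _ : P => ρ
  have hmeas : Measurable (patternCount n k a) := measurable_of_finite _
  have hLp : ∀ p : P, MemLp (fun ω : P → _ => patternCount n k a (ω p)) 2 μP := fun p =>
    MemLp.of_bound (measurable_of_finite _).aestronglyMeasurable n (ae_of_all _ fun ω => by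
      rw [Real.norm_of_nonneg (patternCount_nonneg _ _ _)]; exact patternCount_le _ _ _)
  have hmean : ∀ p : P, ∫ ω, patternCount n k a (ω p) ∂μP =
      ((n : ℝ) - 2 * k) * (X.localStatistics (Finset.Icc (-k : ℤ) k)).real {a} := by
    intro p
    rw [← integral_patternCount X k a hk]
    have := (measurePreserving_eval (fun _ : P => ρ) p)
    have h := integral_map (μ := μP) this.measurable.aemeasurable (f := patternCount n k a)
      hmeas.aestronglyMeasurable
    rw [this.map_eq] at h
    exact h.symm
  have hindep : iIndepFun (fun (p : P) (ω : P → _) => patternCount n k a (ω p)) μP :=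
    iIndepFun_pi fun _ => hmeas.aemeasurable
  have hvar : Var[∑ p : P, fun ω : P → _ => patternCount n k a (ω p); μP] ≤ m * n := by
    rw [IndepFun.variance_sum (fun p _ => hLp p) fun p _ q _ hpq => hindep.indepFun hpq]
    calc ∑ p : P, Var[fun ω : P → _ => patternCount n k a (ω p); μP]
        ≤ ∑ p : P, (n : ℝ) ^ 2 := by
          refine Finset.sum_le_sum fun p _ => ?_
          refine (variance_le_sq_of_bounded (a := 0) (b := n) (ae_of_all _ fun ω =>
            ⟨patternCount_nonneg _ _ _, patternCount_le _ _ _⟩)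
            (measurable_of_finite _).aemeasurable).trans ?_
          nlinarith [Nat.cast_nonneg (α := ℝ) n]
      _ = (n * P.card : ℕ) * n := by
          simp only [Finset.sum_const, Finset.card_univ, Fintype.card_coe, nsmul_eq_mul]
          push_cast; ring
      _ ≤ m * n := by gcongr
  have hsum : MemLp (∑ p : P, fun ω : P → _ => patternCount n k a (ω p)) 2 μP :=
    memLp_finsetSum' _ fun p _ => hLp p
  have hE : μP[∑ p : P, fun ω : P → _ => patternCount n k a (ω p)] =
      P.card * (((n : ℝ) - 2 * k) *
        (X.localStatistics (Finset.Icc (-k : ℤ) k)).real {a}) := by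
    simp only [Finset.sum_apply]
    rw [integral_finsetSum _ fun p _ => (hLp p).integrable (by norm_num),
      Finset.sum_congr rfl fun p _ => hmean p]
    simp
  have hcheb := meas_ge_le_variance_div_sq hsum (mul_pos hδ hm')
  rw [hE] at hcheb
  simp only [Finset.sum_apply] at hcheb
  refine (ENNReal.toReal_le_of_le_ofReal (div_nonneg (variance_nonneg _ _) (sq_nonneg _))
    hcheb).trans ?_
  calc Var[∑ p : P, fun ω : P → _ => patternCount n k a (ω p); μP] / (δ * m) ^ 2
      ≤ m * n / (δ * m) ^ 2 := by gcongr
    _ = n / (m * δ ^ 2) := by field_simp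

variable [Nonempty A]

open Classical in
/-- The sites where some `σ w` with `|w| ≤ k` differs from the corresponding power of `σ 1`. -/
noncomputable def wildSites (σ : SymMaps m) (k : ℕ) : Finset (Fin m) :=
  Finset.univ.filter fun q => ∃ w ∈ Finset.Icc (-k : ℤ) k, σ w q ≠ (σ 1 ^ w) q

/-- Up to the sites near the block boundaries and the wild sites, the pattern frequency of a block
configuration is the normalized total of the pattern counts of its blocks. -/
theorem abs_freq_sub_le [NeZero m] (σ : SymMaps m) (P : Finset (Fin m))
    (hinj : Function.Injective
      (fun x : P × Finset.Ico (0 : ℤ) n => (σ 1 ^ (x.2 : ℤ)) (x.1 : Fin m)))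
    (k : ℕ) (hk : 2 * k ≤ n) (a : Finset.Icc (-k : ℤ) k → A)
    (ω : P → Finset.Ico (0 : ℤ) n → A) :
    |((unif m).map (windowMap (fun g p => σ g p) (blockConfig (σ 1) P ω)
        (Finset.Icc (-k : ℤ) k))).real {a} * m - ∑ p, patternCount n k a (ω p)| ≤
      m - P.card * ((n : ℝ) - 2 * k) + (wildSites σ k).card := by
  classical
  set τ := σ 1
  set ψ := blockConfig τ P ω with hψ
  set J := Finset.Ico (k : ℤ) (n - k)
  have hm : (m : ℝ) ≠ 0 := by exact_mod_cast NeZero.ne m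
  have hJcard : (J.card : ℝ) = (n : ℝ) - 2 * k := by
    rw [Int.card_Ico]
    have : (((n : ℤ) - k - k).toNat : ℤ) = n - 2 * k := by omega
    exact_mod_cast this
  have hJ : ∀ t ∈ J, ∀ w ∈ Finset.Icc (-k : ℤ) k, t + w ∈ Finset.Ico (0 : ℤ) n := by
    intro t ht w hw
    rw [Finset.mem_Ico] at ht ⊢
    rw [Finset.mem_Icc] at hw
    omega
  let sat : Fin m → Prop := fun q => ∀ w : Finset.Icc (-k : ℤ) k, ψ (σ w q) = a w
  let sat' : Fin m → Prop := fun q => ∀ w : Finset.Icc (-k : ℤ) k, ψ ((τ ^ (w : ℤ)) q) = a w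
  let Q : Finset (Fin m) := ((Finset.univ : Finset P) ×ˢ J).image fun x => (τ ^ x.2) x.1
  have hinj' : Set.InjOn (fun x : P × ℤ => (τ ^ x.2) (x.1 : Fin m))
      ((Finset.univ : Finset P) ×ˢ J : Finset (P × ℤ)) := by
    rintro ⟨p, t⟩ hx ⟨p', t'⟩ hx' h
    have ht := hJ t (Finset.mem_product.1 hx).2 0 (by simp)
    have ht' := hJ t' (Finset.mem_product.1 hx').2 0 (by simp)
    rw [add_zero] at ht ht'
    have := hinj (a₁ := (p, ⟨t, ht⟩)) (a₂ := (p', ⟨t', ht'⟩)) h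
    simp only [Prod.mk.injEq, Subtype.mk.injEq] at this
    rw [this.1, this.2]
  have hQcard : (Q.card : ℝ) = P.card * ((n : ℝ) - 2 * k) := by
    rw [Finset.card_image_of_injOn hinj', Finset.card_product, Nat.cast_mul, hJcard]
    simp
  have hfreq : ((unif m).map (windowMap (fun g p => σ g p) ψ
      (Finset.Icc (-k : ℤ) k))).real {a} * m = ∑ q, (if sat q then 1 else 0 : ℝ) := by
    rw [map_measureReal_apply (measurable_of_finite _) (measurableSet_singleton _)]
    have : windowMap (fun g p => σ g p) ψ (Finset.Icc (-k : ℤ) k) ⁻¹' {a} = {q | sat q} := by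
      ext q
      simp only [Set.mem_preimage, Set.mem_singleton_iff, funext_iff, windowMap, sat,
        Set.mem_ofPred_eq]
    rw [this, unif_real, Finset.sum_boole]
    field_simp
  have hcount : ∑ p, patternCount n k a (ω p) = ∑ q, (if q ∈ Q ∧ sat' q then 1 else 0 : ℝ) := by
    have h1 : ∑ q, (if q ∈ Q ∧ sat' q then 1 else 0 : ℝ) = ∑ q ∈ Q, if sat' q then 1 else 0 := by
      simp_rw [ite_and]
      rw [← Finset.sum_filter]
      simp
    rw [h1, Finset.sum_image hinj', Finset.sum_product]
    refine Finset.sum_congr rfl fun p _ => Finset.sum_congr rfl fun t ht => ?_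
    rw [Set.indicator_apply]
    refine if_congr ?_ rfl rfl
    refine forall_congr' fun w => ?_
    have hw := hJ t ht w.1 w.2
    have : ψ ((τ ^ (w : ℤ)) ((τ ^ t) (p : Fin m))) = ω p ⟨t + w, hw⟩ := by
      rw [zpow_apply_zpow_apply, add_comm]
      exact hinj.extend_apply _ _ (p, ⟨t + w, hw⟩)
    rw [this]
    exact ⟨fun h => h hw, fun h _ => h⟩
  rw [hfreq, hcount, ← Finset.sum_sub_distrib]
  refine (Finset.abs_sum_le_sum_abs _ _).trans ?_
  have hpt : ∀ q, |(if sat q then 1 else 0 : ℝ) - (if q ∈ Q ∧ sat' q then 1 else 0)| ≤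
      (1 - if q ∈ Q then 1 else 0) + if q ∈ wildSites σ k then 1 else 0 := by
    intro q
    by_cases hw : q ∈ wildSites σ k
    · rw [if_pos hw]
      by_cases h1 : q ∈ Q <;> by_cases h2 : sat q <;> by_cases h3 : sat' q <;>
        simp [h1, h2, h3]
    · have hs : sat q ↔ sat' q := by
        refine forall_congr' fun w => ?_
        have : σ w q = (τ ^ (w : ℤ)) q := by
          by_contra h
          exact hw (Finset.mem_filter.2 ⟨Finset.mem_univ _, w.1, w.2, h⟩)
        rw [this]
      rw [if_neg hw]
      by_cases h1 : q ∈ Q <;> by_cases h3 : sat' q <;> simp [h1, hs, h3]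
  refine (Finset.sum_le_sum fun q _ => hpt q).trans (le_of_eq ?_)
  rw [Finset.sum_add_distrib, Finset.sum_sub_distrib, ← hQcard]
  simp

/-- With high probability, the empirical statistics of a block configuration are close to the local
statistics of the process. -/
theorem blockMeasure_modelDist_ge_le [NeZero m] (X : ZProc Ω A) (σ : SymMaps m)
    (P : Finset (Fin m)) (hinj : Function.Injective
      (fun x : P × Finset.Ico (0 : ℤ) n => (σ 1 ^ (x.2 : ℤ)) (x.1 : Fin m)))
    (k : ℕ) (hk : 2 * k ≤ n) {δ θ : ℝ} (hδ : 0 < δ)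
    (hθ : m - P.card * ((n : ℝ) - 2 * k) + (wildSites σ k).card ≤ θ * m) :
    (blockMeasure (σ 1) P (X.localStatistics (Finset.Ico (0 : ℤ) n))).real
      {ψ | Fintype.card (Finset.Icc (-k : ℤ) k → A) / 2 * (δ + 2 * θ) ≤
        modelDist (Finset.Icc (-k : ℤ) k) (σ, ψ) X.toApproxProc} ≤
      Fintype.card (Finset.Icc (-k : ℤ) k → A) * (n / (m * δ ^ 2)) := by
  classical
  have hp : IsProbabilityMeasure (X.localStatistics (Finset.Ico (0 : ℤ) n)) :=
    Measure.isProbabilityMeasure_map (X.measurable_windowMap _).aemeasurable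
  have hp' : IsProbabilityMeasure (X.localStatistics (Finset.Icc (-k : ℤ) k)) :=
    Measure.isProbabilityMeasure_map (X.measurable_windowMap _).aemeasurable
  have hmpos : 0 < m := Nat.pos_of_ne_zero (NeZero.ne m)
  have hm : (0 : ℝ) < m := by exact_mod_cast hmpos
  have hPn : n * P.card ≤ m := by
    have := Fintype.card_le_of_injective _ hinj
    simpa [mul_comm] using this
  set W := Finset.Icc (-k : ℤ) k
  set bad : (W → A) → Set (P → Finset.Ico (0 : ℤ) n → A) := fun a =>
    {ω | δ * m ≤ |∑ p, patternCount n k a (ω p) - P.card * (((n : ℝ) - 2 * k) *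
        (X.localStatistics W).real {a})|} with hbad
  rw [blockMeasure, map_measureReal_apply (measurable_of_finite _) (Set.toFinite _).measurableSet]
  have hsub : blockConfig (σ 1) P ⁻¹' {ψ | Fintype.card (W → A) / 2 * (δ + 2 * θ) ≤
        modelDist W (σ, ψ) X.toApproxProc} ⊆ ⋃ a ∈ (Finset.univ : Finset (W → A)), bad a := by
    intro ω hω
    by_contra hcon
    simp only [Finset.mem_univ, Set.iUnion_true, Set.mem_iUnion, not_exists] at hcon
    have hω : Fintype.card (W → A) / 2 * (δ + 2 * θ) ≤
      modelDist W (σ, blockConfig (σ 1) P ω) X.toApproxProc := hω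
    refine absurd hω (not_le.2 ?_)
    have hne : (Finset.univ : Finset (W → A)).Nonempty := Finset.univ_nonempty
    rw [modelDist, tvDist]
    have hlt : ∀ a ∈ (Finset.univ : Finset (W → A)), |(X.localStatistics W).real {a} -
        ((unif m).map (windowMap (fun g p => σ g p) (blockConfig (σ 1) P ω) W)).real {a}| <
        δ + 2 * θ := by
      intro a _
      have h1 := abs_le.1 (abs_freq_sub_le σ P hinj k hk a ω)
      have h2 : |∑ p, patternCount n k a (ω p) - P.card * (((n : ℝ) - 2 * k) *
        (X.localStatistics W).real {a})| < δ * m := not_le.1 (hcon a)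
      have h2 := abs_lt.1 h2
      set r := (X.localStatistics W).real {a}
      have hr0 : 0 ≤ r := measureReal_nonneg
      have hr1 : r ≤ 1 := measureReal_le_one
      set fr := ((unif m).map (windowMap (fun g p => σ g p) (blockConfig (σ 1) P ω) W)).real {a}
      have hcover : (P.card : ℝ) * ((n : ℝ) - 2 * k) ≤ m := by
        have : (n : ℝ) * P.card ≤ m := by exact_mod_cast hPn
        nlinarith [Nat.cast_nonneg (α := ℝ) P.card, Nat.cast_nonneg (α := ℝ) k]
      have hwild : (0 : ℝ) ≤ (wildSites σ k).card := Nat.cast_nonneg _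
      have h3 : (P.card : ℝ) * (((n : ℝ) - 2 * k) * r) ≤ m * r := by
        rw [← mul_assoc]; exact mul_le_mul_of_nonneg_right hcover hr0
      have h4 : m * r - (P.card : ℝ) * (((n : ℝ) - 2 * k) * r) ≤ θ * m := by
        have : (m - (P.card : ℝ) * ((n : ℝ) - 2 * k)) * r ≤ m - P.card * ((n : ℝ) - 2 * k) :=
          mul_le_of_le_one_right (by linarith) hr1
        nlinarith
      have h5 : |r - fr| * m < (δ + 2 * θ) * m := by
        rw [← abs_of_pos hm, ← abs_mul, abs_of_pos hm, abs_lt]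
        constructor <;> nlinarith
      exact lt_of_mul_lt_mul_right h5 hm.le
    have := Finset.sum_lt_sum_of_nonempty hne hlt
    rw [Finset.sum_const, nsmul_eq_mul, Finset.card_univ] at this
    linarith
  calc _ ≤ (Measure.pi fun _ : P => X.localStatistics (Finset.Ico (0 : ℤ) n)).real
        (⋃ a ∈ (Finset.univ : Finset (W → A)), bad a) :=
        measureReal_mono hsub (measure_ne_top _ _)
    _ ≤ ∑ a, (Measure.pi fun _ : P => X.localStatistics (Finset.Ico (0 : ℤ) n)).real (bad a) :=
        measureReal_biUnion_finset_le _ _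
    _ ≤ ∑ a : W → A, (n / (m * δ ^ 2) : ℝ) := Finset.sum_le_sum fun a _ =>
        pi_patternCount_deviation X P hPn k a hk hδ hmpos
    _ = _ := by rw [Finset.sum_const, nsmul_eq_mul, Finset.card_univ]

end Concentration

/-! ### Most sites look like orbit segments of one permutation -/

section Sites

variable {m : ℕ}

theorem measurableSet_mem_wildSites (k : ℕ) :
    MeasurableSet {x : SymMaps m × Fin m | x.2 ∈ wildSites x.1 k} := by
  have h : {x : SymMaps m × Fin m | x.2 ∈ wildSites x.1 k} =
      ⋃ w ∈ Finset.Icc (-k : ℤ) k, {x | x.1 w x.2 = (x.1 1 ^ w) x.2}ᶜ := by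
    ext x; simp [wildSites]
  rw [h]
  refine Finset.measurableSet_biUnion _ fun w _ => (measurableSet_eq_fun
    (measurable_perm_apply w) ?_).compl
  have h1 : Measurable fun q : Equiv.Perm (Fin m) × Fin m => (q.1 ^ w) q.2 :=
    Measurable.of_discrete
  have h2 : Measurable fun s : SymMaps m × Fin m => (s.1 1, s.2) :=
    ((measurable_pi_apply 1).comp measurable_fst).prodMk measurable_snd
  exact h1.comp h2

theorem measurableSet_mem_shortSites (N : ℕ) :
    MeasurableSet {x : SymMaps m × Fin m | x.2 ∈ shortSites (x.1 1) N} := by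
  have h2 : Measurable fun s : SymMaps m × Fin m => (s.1 1, s.2) :=
    ((measurable_pi_apply 1).comp measurable_fst).prodMk measurable_snd
  have h1 : MeasurableSet {q : Equiv.Perm (Fin m) × Fin m | q.2 ∈ shortSites q.1 N} :=
    MeasurableSet.of_discrete
  exact h2 h1

/-- A site is tame as soon as the maps `σ g` are multiplicative there with respect to `σ 1`. -/
theorem notMem_wildSites {σ : SymMaps m} {k : ℕ} {q : Fin m}
    (h : ∀ g ∈ Finset.Icc (-k : ℤ) k, σ 1 (σ g q) = σ (1 + g) q) : q ∉ wildSites σ k := by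
  have h0 : σ 0 q = q := by
    have := h 0 (by simp)
    rw [add_zero] at this
    exact (σ 1).injective this
  have hup : ∀ j : ℕ, j ≤ k → σ j q = (σ 1 ^ (j : ℤ)) q := by
    intro j
    induction j with
    | zero => intro _; simpa using h0
    | succ j ih =>
      intro hj
      have := h j (by rw [Finset.mem_Icc]; omega)
      rw [ih (by omega)] at this
      push_cast
      rw [add_comm, ← this, zpow_one_add, Equiv.Perm.mul_apply]
  have hdown : ∀ j : ℕ, j ≤ k → σ (-j) q = (σ 1 ^ (-j : ℤ)) q := by
    intro j
    induction j with
    | zero => intro _; simpa using h0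
    | succ j ih =>
      intro hj
      have := h (-(j + 1 : ℕ)) (by rw [Finset.mem_Icc]; omega)
      rw [show (1 + -((j + 1 : ℕ) : ℤ)) = -j by push_cast; ring, ih (by omega)] at this
      apply (σ 1).injective
      rw [this, ← Equiv.Perm.mul_apply, ← zpow_one_add]
      congr 2
      push_cast
      ring
  simp only [wildSites, Finset.mem_filter, Finset.mem_univ, true_and, not_exists, not_and, not_not]
  intro w hw
  rw [Finset.mem_Icc] at hw
  obtain ⟨j, rfl | rfl⟩ := w.eq_nat_or_neg
  · exact hup j (by omega)
  · exact hdown j (by omega)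

theorem RandomSoficApprox.tendsto_wildSites (K : RandomSoficApprox) (k : ℕ) :
    Tendsto (fun i => ((K.κ i).prod (unif (K.m i))).real {x | x.2 ∈ wildSites x.1 k})
      atTop (𝓝 0) := by
  have hlim : Tendsto (fun i => ∑ g ∈ Finset.Icc (-k : ℤ) k,
      ((K.κ i).prod (unif (K.m i))).real {x | x.1 1 (x.1 g x.2) = x.1 (1 + g) x.2}ᶜ)
      atTop (𝓝 (∑ g ∈ Finset.Icc (-k : ℤ) k, 0)) := by
    refine tendsto_finsetSum _ fun g _ => ?_
    have h1 := ((ENNReal.tendsto_toReal ENNReal.one_ne_top).comp (K.asymp_hom 1 g)).const_sub 1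
    rw [ENNReal.toReal_one, sub_self] at h1
    refine h1.congr fun i => ?_
    have h2 : Measurable fun s : SymMaps (K.m i) × Fin (K.m i) => (s.1, s.1 g s.2) :=
      measurable_fst.prodMk (measurable_perm_apply g)
    have h3 : MeasurableSet {x : SymMaps (K.m i) × Fin (K.m i) |
        x.1 1 (x.1 g x.2) = x.1 (1 + g) x.2} :=
      measurableSet_eq_fun ((measurable_perm_apply 1).comp h2) (measurable_perm_apply (1 + g))
    exact (probReal_compl_eq_one_sub h3).symm
  rw [Finset.sum_const_zero] at hlim
  refine squeeze_zero (fun _ => measureReal_nonneg) (fun i => ?_) hlim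
  refine (measureReal_mono ?_ (measure_ne_top _ _)).trans (measureReal_biUnion_finset_le _ _)
  intro x hx
  by_contra hcon
  simp only [Set.mem_iUnion, not_exists, Set.mem_compl_iff, not_not] at hcon
  exact notMem_wildSites hcon hx

theorem RandomSoficApprox.tendsto_shortSites (K : RandomSoficApprox) (N : ℕ) :
    Tendsto (fun i => ((K.κ i).prod (unif (K.m i))).real {x | x.2 ∈ shortSites (x.1 1) N})
      atTop (𝓝 0) := by
  classical
  have hfree : Tendsto (fun i => ∑ j ∈ Finset.Ioo 0 N, ((K.κ i).prod (unif (K.m i))).real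
      {s | s.1 (j : ℤ) s.2 = s.1 0 s.2}) atTop (𝓝 (∑ j ∈ Finset.Ioo 0 N, 0)) :=
    tendsto_finsetSum _ fun j hj => K.tendsto_nonfree (by
      have := (Finset.mem_Ioo.1 hj).1
      exact_mod_cast this.ne')
  have hlim := (K.tendsto_wildSites N).add hfree
  rw [Finset.sum_const_zero, add_zero] at hlim
  refine squeeze_zero (fun _ => measureReal_nonneg) (fun i => ?_) hlim
  have hsub : {x : SymMaps (K.m i) × Fin (K.m i) | x.2 ∈ shortSites (x.1 1) N} ⊆
      {x | x.2 ∈ wildSites x.1 N} ∪ ⋃ j ∈ Finset.Ioo 0 N, {x | x.1 (j : ℤ) x.2 = x.1 0 x.2} := by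
    rintro ⟨σ, q⟩ hx
    rw [Set.mem_union, or_iff_not_imp_left]
    intro hw
    have hw : q ∉ wildSites σ N := hw
    have hx : q ∈ shortSites (σ 1) N := hx
    rw [shortSites, Finset.mem_filter] at hx
    obtain ⟨-, j, hj0, hjN, hj⟩ := hx
    have htame : ∀ w ∈ Finset.Icc (-N : ℤ) N, σ w q = (σ 1 ^ w) q := by
      intro w hwN
      by_contra h
      exact hw (Finset.mem_filter.2 ⟨Finset.mem_univ _, w, hwN, h⟩)
    refine Set.mem_biUnion (Finset.mem_coe.2 (Finset.mem_Ioo.2 ⟨hj0, hjN⟩)) ?_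
    have h1 := htame j (by rw [Finset.mem_Icc]; omega)
    have h2 := htame 0 (by simp)
    have h3 : (σ 1 ^ (j : ℤ)) q = q := hj
    change σ j q = σ 0 q
    rw [h1, h2, h3, zpow_zero]
    rfl
  refine (measureReal_mono hsub (measure_ne_top _ _)).trans ((measureReal_union_le _ _).trans ?_)
  exact add_le_add le_rfl (measureReal_biUnion_finset_le _ _)

theorem measurable_card_sites (S : SymMaps m → Finset (Fin m))
    (hS : MeasurableSet {x : SymMaps m × Fin m | x.2 ∈ S x.1}) :
    Measurable fun σ => ((S σ).card : ℝ) := by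
  classical
  have h : (fun σ => ((S σ).card : ℝ)) =
      fun σ => ∑ p, {σ | p ∈ S σ}.indicator (1 : SymMaps m → ℝ) σ := by
    funext σ
    simp [Set.indicator_apply]
  rw [h]
  refine Finset.measurable_sum _ fun p _ => measurable_one.indicator ?_
  exact (measurable_id.prodMk measurable_const) hS

/-- Markov's inequality for the number of sites with a given property. -/
theorem measureReal_card_sites_ge_le [NeZero m] (κ : Measure (SymMaps m)) [IsProbabilityMeasure κ]
    (S : SymMaps m → Finset (Fin m))
    (hS : MeasurableSet {x : SymMaps m × Fin m | x.2 ∈ S x.1}) {c : ℝ} (hc : 0 < c) :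
    κ.real {σ | c * m ≤ (S σ).card} ≤ (κ.prod (unif m)).real {x | x.2 ∈ S x.1} / c := by
  classical
  have hm : (0 : ℝ) < m := by exact_mod_cast Nat.pos_of_ne_zero (NeZero.ne m)
  have hSp : ∀ p, MeasurableSet {σ : SymMaps m | p ∈ S σ} := fun p =>
    (measurable_id.prodMk measurable_const) hS
  have hint : ∫ σ, ((S σ).card : ℝ) ∂κ = ∑ p, κ.real {σ | p ∈ S σ} := by
    have h : ∀ σ, ((S σ).card : ℝ) = ∑ p, {σ | p ∈ S σ}.indicator (1 : SymMaps m → ℝ) σ := by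
      intro σ
      simp [Set.indicator_apply]
    simp_rw [h]
    refine (integral_finsetSum _ fun p _ => (integrable_const (1 : ℝ)).indicator (hSp p)).trans ?_
    exact Finset.sum_congr rfl fun p _ => integral_indicator_one (hSp p)
  have hi : Integrable (fun σ => ((S σ).card : ℝ)) κ :=
    Integrable.of_bound (measurable_card_sites S hS).aestronglyMeasurable m (ae_of_all _ fun σ => by
      rw [Real.norm_of_nonneg (Nat.cast_nonneg _)]
      exact_mod_cast (Finset.card_le_univ _).trans (Fintype.card_fin m).le)
  have := mul_meas_ge_le_integral_of_nonneg (ae_of_all _ fun σ => Nat.cast_nonneg (S σ).card) hi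
    (c * m)
  rw [hint] at this
  rw [le_div_iff₀ hc, prod_unif_real _ hS]
  change _ ≤ (m : ℝ)⁻¹ * ∑ p, κ.real {σ | p ∈ S σ}
  rw [← div_eq_inv_mul, le_div_iff₀ hm]
  calc _ = c * m * κ.real {σ | c * m ≤ (S σ).card} := by ring
    _ ≤ _ := this

theorem RandomSoficApprox.tendsto_m (K : RandomSoficApprox) : Tendsto K.m atTop atTop := by
  refine tendsto_atTop.2 fun N => ?_
  have hlim : Tendsto (fun i => ∑ x ∈ (Finset.range N).offDiag,
      ((K.κ i).prod (unif (K.m i))).real {s | s.1 (x.1 : ℤ) s.2 = s.1 (x.2 : ℤ) s.2}) atTop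
      (𝓝 (∑ x ∈ (Finset.range N).offDiag, 0)) :=
    tendsto_finsetSum _ fun x hx => K.tendsto_nonfree
      (by exact_mod_cast (Finset.mem_offDiag.1 hx).2.2)
  rw [Finset.sum_const_zero] at hlim
  filter_upwards [hlim.eventually (gt_mem_nhds one_pos)] with i hi
  by_contra hlt
  -- With fewer than `N` sites, the points `σ 0 p, …, σ (N - 1) p` are never distinct.
  have hcov : (Set.univ : Set (SymMaps (K.m i) × Fin (K.m i))) ⊆
      ⋃ x ∈ (Finset.range N).offDiag, {s | s.1 (x.1 : ℤ) s.2 = s.1 (x.2 : ℤ) s.2} := by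
    rintro ⟨σ, p⟩ -
    obtain ⟨g, hg, h, hh, hne, he⟩ := Finset.exists_ne_map_eq_of_card_lt_of_maps_to
      (s := Finset.range N) (t := (Finset.univ : Finset (Fin (K.m i))))
      (by simpa using hlt) (f := fun g : ℕ => σ g p)
      (fun _ _ => Finset.mem_coe.2 (Finset.mem_univ _))
    simp only [Set.mem_iUnion]
    exact ⟨(g, h), Finset.mem_offDiag.2 ⟨hg, hh, hne⟩, he⟩
  have h1 := (measureReal_mono (μ := (K.κ i).prod (unif (K.m i))) hcov
    (measure_ne_top _ _)).trans (measureReal_biUnion_finset_le _ _)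
  rw [probReal_univ] at h1
  linarith

end Sites

/-! ### Distances between local statistics -/

section Distances

variable {Ω A : Type*} [MeasurableSpace Ω] [Fintype A] [MeasurableSpace A] {m : ℕ}

theorem tvDist_map_le {α γ : Type*} [Fintype α] [MeasurableSpace α] [MeasurableSingletonClass α]
    [Fintype γ] [MeasurableSpace γ] [MeasurableSingletonClass γ] (μ ν : Measure α)
    [IsFiniteMeasure μ] [IsFiniteMeasure ν] (f : α → γ) :
    tvDist (μ.map f) (ν.map f) ≤ tvDist μ ν := by
  classical
  unfold tvDist
  refine mul_le_mul_of_nonneg_left ?_ (by norm_num)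
  rw [← Finset.sum_fiberwise Finset.univ f]
  refine Finset.sum_le_sum fun c _ => ?_
  rw [measureReal_map_singleton, measureReal_map_singleton, ← Finset.sum_sub_distrib]
  exact Finset.abs_sum_le_sum_abs _ _

theorem modelDist_le [NeZero m] (W : Finset ℤ) (s : SymMaps m × (Fin m → A)) (X : ApproxProc Ω A) :
    modelDist W s X ≤ Fintype.card (W → A) := by
  have i1 : IsProbabilityMeasure (X.localStatistics W) :=
    Measure.isProbabilityMeasure_map (X.measurable_windowMap W).aemeasurable
  have i2 := Measure.isProbabilityMeasure_map (μ := unif m)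
    (measurable_of_finite (windowMap (fun g p => s.1 g p) s.2 W)).aemeasurable
  have h : ∑ a, |(X.localStatistics W).real {a} -
      ((unif m).map (windowMap (fun g p => s.1 g p) s.2 W)).real {a}| ≤ ∑ a : W → A, (1 : ℝ) :=
    Finset.sum_le_sum fun a _ => abs_le.2
      ⟨by linarith [measureReal_nonneg (μ := X.localStatistics W) (s := {a}),
        measureReal_le_one (μ := (unif m).map (windowMap (fun g p => s.1 g p) s.2 W)) (s := {a})],
      by linarith [measureReal_le_one (μ := X.localStatistics W) (s := {a}),
        measureReal_nonneg (μ := (unif m).map (windowMap (fun g p => s.1 g p) s.2 W)) (s := {a})]⟩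
  rw [Finset.sum_const, nsmul_eq_mul, mul_one, Finset.card_univ] at h
  rw [modelDist, tvDist]
  linarith [Nat.cast_nonneg (α := ℝ) (Fintype.card (W → A))]

variable [DiscreteMeasurableSpace A]

theorem measurable_freq (W : Finset ℤ) (a : W → A) :
    Measurable fun s : SymMaps m × (Fin m → A) =>
      ((unif m).map (windowMap (fun g p => s.1 g p) s.2 W)).real {a} := by
  have h := (measurable_measure_prodMk_left (ν := unif m)
    (measurable_eval_window (A := A) (m := m) W (measurableSet_singleton a))).ennreal_toReal
  convert h using 2 with s
  rw [map_measureReal_apply (measurable_of_finite _) (measurableSet_singleton _)]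
  rfl

theorem measurable_modelDist (W : Finset ℤ) (X : ApproxProc Ω A) :
    Measurable fun s : SymMaps m × (Fin m → A) => modelDist W s X := by
  unfold modelDist tvDist
  refine (Finset.measurable_sum _ fun a _ => ?_).const_mul _
  exact continuous_abs.measurable.comp ((measurable_freq W a).const_sub _)

variable [NeZero m]

theorem modelDist_mono (X : ApproxProc Ω A) (s : SymMaps m × (Fin m → A)) {W V : Finset ℤ}
    (h : W ⊆ V) : modelDist W s X ≤ modelDist V s X := by
  have h1 : X.localStatistics W =
      (X.localStatistics V).map (fun u w => u ⟨w.1, h w.2⟩) := by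
    rw [ApproxProc.localStatistics, ApproxProc.localStatistics,
      Measure.map_map (measurable_of_finite _) (X.measurable_windowMap V)]
    rfl
  have h2 : (unif m).map (windowMap (fun g p => s.1 g p) s.2 W) =
      ((unif m).map (windowMap (fun g p => s.1 g p) s.2 V)).map (fun u w => u ⟨w.1, h w.2⟩) := by
    rw [Measure.map_map (measurable_of_finite _) (measurable_of_finite _)]
    rfl
  have i1 : IsProbabilityMeasure (X.localStatistics V) :=
    Measure.isProbabilityMeasure_map (X.measurable_windowMap V).aemeasurable
  have i2 := Measure.isProbabilityMeasure_map (μ := unif m)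
    (measurable_of_finite (windowMap (fun g p => s.1 g p) s.2 V)).aemeasurable
  rw [modelDist, modelDist, h1, h2]
  exact tvDist_map_le _ _ _

/-- The local statistics of a constructed process average the empirical statistics of the models, so
their distance to those of `X` is small when most models are good. -/
theorem processDist_constructed_le (η : Measure (SymMaps m × (Fin m → A)))
    [IsProbabilityMeasure η] (W : Finset ℤ) (X : ApproxProc Ω A) {ε : ℝ} (hε : 0 ≤ ε) :
    processDist W (constructed η) X ≤
      ε + Fintype.card (W → A) * η.real {s | ε ≤ modelDist W s X} := by
  have i1 : IsProbabilityMeasure (X.localStatistics W) :=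
    Measure.isProbabilityMeasure_map (X.measurable_windowMap W).aemeasurable
  have hfi : ∀ a : W → A, Integrable (fun s : SymMaps m × (Fin m → A) =>
      ((unif m).map (windowMap (fun g p => s.1 g p) s.2 W)).real {a}) η := fun a =>
    Integrable.of_bound (measurable_freq W a).aestronglyMeasurable 1 (ae_of_all _ fun s => by
      have := Measure.isProbabilityMeasure_map (μ := unif m)
        (measurable_of_finite (windowMap (fun g p => s.1 g p) s.2 W)).aemeasurable
      rw [Real.norm_of_nonneg measureReal_nonneg]
      exact measureReal_le_one)
  have hstat : ∀ a : W → A, ((constructed η).localStatistics W).real {a} =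
      ∫ s, ((unif m).map (windowMap (fun g p => s.1 g p) s.2 W)).real {a} ∂η := by
    intro a
    have hE := measurable_eval_window (A := A) (m := m) W (measurableSet_singleton a)
    have h0 : ((constructed η).localStatistics W).real {a} =
        (η.prod (unif m)).real ((fun x : (SymMaps m × (Fin m → A)) × Fin m =>
          windowMap (fun g p => x.1.1 g p) x.1.2 W x.2) ⁻¹' {a}) :=
      map_measureReal_apply (measurable_eval_window W) (measurableSet_singleton a)
    rw [h0, measureReal_def, Measure.prod_apply hE, ← integral_toReal
      (measurable_measure_prodMk_left hE).aemeasurable (ae_of_all _ fun s => measure_lt_top _ _)]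
    refine integral_congr_ae (ae_of_all _ fun s => ?_)
    dsimp only
    rw [map_measureReal_apply (measurable_of_finite _) (measurableSet_singleton _)]
    rfl
  have hset : MeasurableSet {s : SymMaps m × (Fin m → A) | ε ≤ modelDist W s X} :=
    measurableSet_le measurable_const (measurable_modelDist W X)
  have hind : Integrable ({s : SymMaps m × (Fin m → A) | ε ≤ modelDist W s X}.indicator
      (1 : SymMaps m × (Fin m → A) → ℝ)) η := (integrable_const (1 : ℝ)).indicator hset
  have hmi : Integrable (fun s => modelDist W s X) η :=
    Integrable.of_bound (measurable_modelDist W X).aestronglyMeasurable (Fintype.card (W → A))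
      (ae_of_all _ fun s => by
        rw [Real.norm_of_nonneg (show 0 ≤ modelDist W s X from mul_nonneg (by norm_num)
          (Finset.sum_nonneg fun _ _ => abs_nonneg _))]
        exact modelDist_le W s X)
  calc processDist W (constructed η) X ≤ ∫ s, modelDist W s X ∂η := by
        unfold processDist modelDist tvDist
        have habs : ∀ a : W → A, Integrable (fun s : SymMaps m × (Fin m → A) =>
            |(X.localStatistics W).real {a} -
              ((unif m).map (windowMap (fun g p => s.1 g p) s.2 W)).real {a}|) η := fun a =>
          ((integrable_const _).sub (hfi a)).abs
        rw [integral_const_mul, integral_finsetSum _ fun a _ => habs a]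
        refine mul_le_mul_of_nonneg_left (Finset.sum_le_sum fun a _ => ?_) (by norm_num)
        rw [abs_sub_comm, hstat a]
        have : (X.localStatistics W).real {a} -
            ∫ s, ((unif m).map (windowMap (fun g p => s.1 g p) s.2 W)).real {a} ∂η =
            ∫ s, ((X.localStatistics W).real {a} -
              ((unif m).map (windowMap (fun g p => s.1 g p) s.2 W)).real {a}) ∂η := by
          rw [integral_sub (integrable_const _) (hfi a)]
          simp
        rw [this]
        exact abs_integral_le_integral_abs
    _ ≤ ∫ s, (ε + Fintype.card (W → A) *
          {s : SymMaps m × (Fin m → A) | ε ≤ modelDist W s X}.indicator 1 s) ∂η := by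
        refine integral_mono hmi ((integrable_const _).add (hind.const_mul _)) fun s => ?_
        by_cases hs : ε ≤ modelDist W s X
        · have : s ∈ {s : SymMaps m × (Fin m → A) | ε ≤ modelDist W s X} := hs
          simp only [Set.indicator_of_mem this, Pi.one_apply, mul_one]
          linarith [modelDist_le W s X]
        · have : s ∉ {s : SymMaps m × (Fin m → A) | ε ≤ modelDist W s X} := hs
          simp only [Set.indicator_of_notMem this, mul_zero, add_zero]
          exact (not_le.1 hs).le
    _ = _ := by
        rw [integral_add (integrable_const _) (hind.const_mul _), integral_const_mul,
          integral_indicator_one hset]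
        simp

end Distances

/-! ### Lower bound: models made of independent blocks -/

theorem blockEntropy_sub_nonneg {Ω A B : Type*} [MeasurableSpace Ω] [Fintype A] [MeasurableSpace A]
    [DiscreteMeasurableSpace A] [Fintype B] [MeasurableSpace B] [DiscreteMeasurableSpace B]
    (X : ZProc Ω A) (β : A → B) (n : ℕ) :
    0 ≤ blockEntropy X.T X.μ X.φ n - blockEntropy X.T X.μ (β ∘ X.φ) n :=
  sub_nonneg.2 (ent_mono (X.measurable_windowMap _) fun _ _ h =>
    funext fun w => congrArg β (congrFun h w))

section LowerBound

variable {Ω A B : Type*} [MeasurableSpace Ω] [Fintype A] [Nonempty A] [MeasurableSpace A]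
  [DiscreteMeasurableSpace A] [Fintype B] [Nonempty B] [MeasurableSpace B]
  [DiscreteMeasurableSpace B]

/-- The kernel that fills the orbit segments of `σ 1` starting at `P (σ 1)` with independent blocks
of law `ρ`. It depends only on `σ 1`, so it is measurable. -/
noncomputable def blockKernel {m n : ℕ} (P : Equiv.Perm (Fin m) → Finset (Fin m))
    (ρ : Measure (Finset.Ico (0 : ℤ) n → A)) : Kernel (SymMaps m) (Fin m → A) where
  toFun σ := blockMeasure (σ 1) (P (σ 1)) ρ
  measurable' := (Measurable.of_discrete
    (f := fun τ : Equiv.Perm (Fin m) => blockMeasure τ (P τ) ρ)).comp (measurable_pi_apply 1)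

instance instIsMarkovBlockKernel {m n : ℕ} (P : Equiv.Perm (Fin m) → Finset (Fin m))
    (ρ : Measure (Finset.Ico (0 : ℤ) n → A)) [IsProbabilityMeasure ρ] :
    IsMarkovKernel (blockKernel P ρ) :=
  ⟨fun _ => instIsProbBlockMeasure⟩

/-- An inequality that holds off a set `V`, up to an error that is at most `1` on `V`, integrates to
an inequality with the probability of `V` as additional error. -/
theorem integral_le_measureReal_add {S : Type*} [MeasurableSpace S] (κ : Measure S)
    [IsProbabilityMeasure κ] {V : Set S} (hV : MeasurableSet V) {f : S → ℝ} (hf : Integrable f κ)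
    {c : ℝ} (hc : 0 ≤ c) (h1 : ∀ σ, f σ ≤ 1) (h2 : ∀ σ ∉ V, f σ ≤ c) :
    ∫ σ, f σ ∂κ ≤ κ.real V + c := by
  have hind : Integrable (V.indicator (1 : S → ℝ)) κ := (integrable_const (1 : ℝ)).indicator hV
  calc ∫ σ, f σ ∂κ ≤ ∫ σ, (V.indicator 1 σ + c) ∂κ := by
        refine integral_mono hf (hind.add (integrable_const _)) fun σ => ?_
        by_cases hσ : σ ∈ V
        · simp only [Set.indicator_of_mem hσ, Pi.one_apply]
          linarith [h1 σ]
        · simp only [Set.indicator_of_notMem hσ, zero_add]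
          exact h2 σ hσ
    _ = κ.real V + c := by
        rw [integral_add hind (integrable_const _),
          integral_indicator_one hV]
        simp

/-- The density estimates for blocks of length `n`: the uncovered sites, the sites within `k` of a
block boundary and the wild sites together have density at most `θ`. -/
theorem block_density_bounds {m n k N p s w θ : ℝ} (hm : 0 < m) (hn : 0 < n) (hN : 0 < N)
    (hp : 0 ≤ p) (hθ : 0 < θ) (hs : s < θ / (4 * n) * m) (hw : w < θ / 4 * m)
    (hcov : N * m ≤ N * (n * p) + n * (m + N * s)) (hnN : n / N ≤ θ / 4) (hpn : n * p ≤ m)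
    (hkn : 2 * k / n ≤ θ / 4) :
    m - p * (n - 2 * k) + w ≤ θ * m ∧ (1 - θ) * m ≤ n * p := by
  have h4 : n * s ≤ θ / 4 * m := by
    calc n * s ≤ n * (θ / (4 * n) * m) := by gcongr
      _ = θ / 4 * m := by field_simp
  have h5 : n ≤ θ / 4 * N := (div_le_iff₀ hN).1 hnN
  have h6 : m - n * p ≤ θ / 2 * m := by
    refine le_of_mul_le_mul_left ?_ hN
    nlinarith [mul_le_mul_of_nonneg_right h5 hm.le, mul_le_mul_of_nonneg_left h4 hN.le]
  have h8 : 2 * k ≤ θ / 4 * n := (div_le_iff₀ hn).1 hkn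
  have h9 : p * (2 * k) ≤ θ / 4 * m := by
    calc p * (2 * k) ≤ p * (θ / 4 * n) := by gcongr
      _ = θ / 4 * (n * p) := by ring
      _ ≤ θ / 4 * m := by gcongr
  have h10 : 0 < θ * m := by positivity
  constructor <;> linarith

theorem blockKernel_modelDist_ge_le {m n : ℕ} [NeZero m] (κ : Measure (SymMaps m))
    [IsProbabilityMeasure κ] (P : Equiv.Perm (Fin m) → Finset (Fin m))
    (ρ : Measure (Finset.Ico (0 : ℤ) n → A)) [IsProbabilityMeasure ρ] (X : ApproxProc Ω A)
    (W : Finset ℤ) {V : Set (SymMaps m)} (hV : MeasurableSet V) {ε c : ℝ} (hc : 0 ≤ c)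
    (h : ∀ σ ∉ V, (blockMeasure (σ 1) (P (σ 1)) ρ).real {ψ | ε ≤ modelDist W (σ, ψ) X} ≤ c) :
    (κ ⊗ₘ blockKernel P ρ).real {s | ε ≤ modelDist W s X} ≤ κ.real V + c := by
  have hset : MeasurableSet {s : SymMaps m × (Fin m → A) | ε ≤ modelDist W s X} :=
    measurableSet_le measurable_const (measurable_modelDist W X)
  rw [compProd_real κ _ hset]
  refine integral_le_measureReal_add κ hV ?_ hc (fun σ => measureReal_le_one) h
  refine Integrable.of_bound
    (Kernel.measurable_kernel_prodMk_left hset).ennreal_toReal.aestronglyMeasurable 1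
    (ae_of_all _ fun σ => ?_)
  rw [Real.norm_of_nonneg measureReal_nonneg]
  exact measureReal_le_one

theorem le_modelEntropy_sub_blockKernel {m n : ℕ} [NeZero m] (hn : 0 < n)
    (κ : Measure (SymMaps m)) [IsProbabilityMeasure κ]
    (P : Equiv.Perm (Fin m) → Finset (Fin m)) (hinj : ∀ τ, Function.Injective
      (fun x : P τ × Finset.Ico (0 : ℤ) n => (τ ^ (x.2 : ℤ)) (x.1 : Fin m)))
    (ρ : Measure (Finset.Ico (0 : ℤ) n → A)) [IsProbabilityMeasure ρ] (β : A → B)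
    {V : Set (SymMaps m)} (hV : MeasurableSet V) {c : ℝ} (hc : 0 ≤ c)
    (h : ∀ σ ∉ V, (1 - c) * m ≤ n * (P (σ 1)).card) :
    (1 - (κ.real V + c)) * ((shannon ρ - shannon (ρ.map (β ∘ ·))) / n) ≤
      modelEntropy (κ ⊗ₘ blockKernel P ρ) - modelEntropy (pushFactor β (κ ⊗ₘ blockKernel P ρ)) := by
  have hm : (0 : ℝ) < m := by exact_mod_cast Nat.pos_of_ne_zero (NeZero.ne m)
  have hn : (0 : ℝ) < n := by exact_mod_cast hn
  have hD0 : 0 ≤ shannon ρ - shannon (ρ.map (β ∘ ·)) := sub_nonneg.2 (shannon_map_le ρ _)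
  set D := shannon ρ - shannon (ρ.map (β ∘ ·)) with hD
  have hfib : ∀ σ : SymMaps m, shannon (blockKernel P ρ σ) -
      shannon ((blockKernel P ρ σ).map (β ∘ ·)) = (P (σ 1)).card * D := by
    intro σ
    have h1 : shannon (blockKernel P ρ σ) = (P (σ 1)).card * shannon ρ :=
      shannon_blockMeasure (hinj (σ 1))
    have h2 : shannon ((blockKernel P ρ σ).map (β ∘ ·)) =
        (P (σ 1)).card * shannon (ρ.map (β ∘ ·)) := shannon_blockMeasure_map (hinj (σ 1)) β
    rw [h1, h2, ← mul_sub]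
  have hPi : Integrable (fun σ : SymMaps m => ((P (σ 1)).card : ℝ)) κ := by
    have hmeas : Measurable fun σ : SymMaps m => ((P (σ 1)).card : ℝ) :=
      (Measurable.of_discrete (f := fun τ : Equiv.Perm (Fin m) => ((P τ).card : ℝ))).comp
        (measurable_pi_apply 1)
    refine Integrable.of_bound hmeas.aestronglyMeasurable m (ae_of_all _ fun σ => ?_)
    rw [Real.norm_of_nonneg (Nat.cast_nonneg _)]
    exact_mod_cast (Finset.card_le_univ _).trans (Fintype.card_fin m).le
  have hPint : (1 - (κ.real V + c)) * m ≤ n * ∫ σ, ((P (σ 1)).card : ℝ) ∂κ := by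
    have h1 := integral_le_measureReal_add κ hV
      (f := fun σ => 1 - n / m * ((P (σ 1)).card : ℝ))
      ((integrable_const _).sub (hPi.const_mul _)) hc
      (fun σ => sub_le_self _ (by positivity)) fun σ hσ => by
        rw [sub_le_comm, div_mul_eq_mul_div, le_div_iff₀ hm]
        exact h σ hσ
    rw [integral_sub (integrable_const _) (hPi.const_mul _), integral_const_mul] at h1
    simp only [integral_const, probReal_univ, smul_eq_mul, mul_one] at h1
    have h2 : 1 - (κ.real V + c) ≤ n / m * ∫ σ, ((P (σ 1)).card : ℝ) ∂κ := by linarith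
    rwa [div_mul_eq_mul_div, le_div_iff₀ hm] at h2
  rw [modelEntropy_sub_compProd]
  simp_rw [hfib]
  rw [integral_mul_const]
  calc (1 - (κ.real V + c)) * (D / n)
      = (m : ℝ)⁻¹ * (((1 - (κ.real V + c)) * m) / n * D) := by field_simp
    _ ≤ (m : ℝ)⁻¹ * ((∫ σ, ((P (σ 1)).card : ℝ) ∂κ) * D) := by
        refine mul_le_mul_of_nonneg_left (mul_le_mul_of_nonneg_right ?_ hD0) (by positivity)
        rw [div_le_iff₀ hn]
        linarith

/-- For all large `i` there is a model over `κ i` that is close to `X` with high probability and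
has almost the relative entropy of `X`: the orbits of `σ 1` are cut into long segments, which are
filled independently with samples of `X`. -/
theorem exists_good_model (K : RandomSoficApprox) (X : ZProc Ω A) (β : A → B) (k : ℕ) {ε : ℝ}
    (hε : 0 < ε) (hε1 : ε < 1) : ∀ᶠ i in atTop,
    ∃ (η : Measure (SymMaps (K.m i) × (Fin (K.m i) → A))) (_ : IsProbabilityMeasure η),
      η.fst = K.κ i ∧
      η.real {s | ε ≤ modelDist (Finset.Icc (-k : ℤ) k) s X.toApproxProc} ≤ ε ∧
      (1 - ε) * (X.entropy - (X.factor β).entropy - ε) ≤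
        modelEntropy η - modelEntropy (pushFactor β η) := by
  set W := Finset.Icc (-k : ℤ) k
  set C : ℝ := (Fintype.card (W → A) : ℝ) with hCdef
  have hC : 1 ≤ C := Nat.one_le_cast.2 Fintype.card_pos
  have hC0 : 0 < C := by linarith
  set δ := ε / C
  set θ := ε / (4 * C) with hθdef
  have hδ : 0 < δ := by positivity
  have hθ : 0 < θ := by positivity
  have hθε : θ ≤ ε / 4 := by
    rw [hθdef, div_le_div_iff₀ (by positivity) (by norm_num)]
    nlinarith
  have hCθ : C / 2 * (δ + 2 * θ) ≤ ε := by
    have h1 : C / 2 * (δ + 2 * θ) = 3 / 4 * ε := by simp only [δ, hθdef]; field_simp; norm_num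
    linarith
  -- The block length `n`, with negligible boundary and almost optimal block entropy.
  have hrate : Tendsto (fun n : ℕ => (blockEntropy X.T X.μ X.φ n -
      blockEntropy X.T X.μ (β ∘ X.φ) n) / n) atTop (𝓝 (X.entropy - (X.factor β).entropy)) := by
    have := (tendsto_blockEntropy X).sub (tendsto_blockEntropy (X.factor β))
    simp_rw [← sub_div] at this
    exact this
  obtain ⟨n, hn0, hnk, hnθ, hnrate⟩ : ∃ n : ℕ, 0 < n ∧ 2 * k ≤ n ∧ 2 * (k : ℝ) / n ≤ θ / 4 ∧
      X.entropy - (X.factor β).entropy - ε ≤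
        (blockEntropy X.T X.μ X.φ n - blockEntropy X.T X.μ (β ∘ X.φ) n) / n :=
    ((eventually_gt_atTop 0).and ((eventually_ge_atTop (2 * k)).and
      (((tendsto_const_div_atTop_nhds_zero_nat (2 * (k : ℝ))).eventually_le_const
        (by positivity)).and (hrate.eventually_const_le (by linarith))))).exists
  have hn : (0 : ℝ) < n := by exact_mod_cast hn0
  -- The length `N` below which a cycle counts as short.
  obtain ⟨N, hN0, hNθ⟩ : ∃ N : ℕ, 0 < N ∧ (n : ℝ) / N ≤ θ / 4 :=
    ((eventually_gt_atTop 0).and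
      ((tendsto_const_div_atTop_nhds_zero_nat (n : ℝ)).eventually_le_const
      (by positivity))).exists
  have hN : (0 : ℝ) < N := by exact_mod_cast hN0
  have hc1 : 0 < θ / (4 * n) := by positivity
  have hc2 : 0 < θ / 4 := by positivity
  have hcheb : Tendsto (fun i => C * (n / (K.m i * δ ^ 2))) atTop (𝓝 0) := by
    have h1 : Tendsto (fun i => (K.m i : ℝ) * δ ^ 2) atTop atTop :=
      (tendsto_natCast_atTop_atTop.comp K.tendsto_m).atTop_mul_const (by positivity)
    simpa using (h1.const_div_atTop (n : ℝ)).const_mul C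
  have hbad := ((K.tendsto_shortSites N).div_const (θ / (4 * n))).add
    ((K.tendsto_wildSites k).div_const (θ / 4))
  rw [zero_div, zero_div, add_zero] at hbad
  filter_upwards [hcheb.eventually_le_const (half_pos hε),
    hbad.eventually_le_const (half_pos hε)] with i hi1 hi2
  set m := K.m i
  have hm : (0 : ℝ) < m := by exact_mod_cast Nat.pos_of_ne_zero (NeZero.ne (K.m i))
  set κ := K.κ i
  choose P hPinj hPcov using fun τ : Equiv.Perm (Fin m) => exists_blockStarts τ hn0
  set ρ := X.localStatistics (Finset.Ico (0 : ℤ) n)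
  have hρ : IsProbabilityMeasure ρ :=
    Measure.isProbabilityMeasure_map (X.measurable_windowMap _).aemeasurable
  set D := blockEntropy X.T X.μ X.φ n - blockEntropy X.T X.μ (β ∘ X.φ) n with hD
  have hD0 : 0 ≤ D := blockEntropy_sub_nonneg X β n
  have hDρ : shannon ρ - shannon (ρ.map (β ∘ ·)) = D := by
    simp only [ρ, ApproxProc.localStatistics]
    rw [Measure.map_map (measurable_of_finite _) (X.measurable_windowMap _)]
    rfl
  -- The exceptional permutations, with many short cycles or many wild sites.
  set V : Set (SymMaps m) := {σ | θ / (4 * n) * m ≤ (shortSites (σ 1) N).card} ∪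
    {σ | θ / 4 * m ≤ (wildSites σ k).card} with hVdef
  have hVm : MeasurableSet V :=
    (measurableSet_le measurable_const (measurable_card_sites (fun σ => shortSites (σ 1) N)
      (measurableSet_mem_shortSites N))).union
      (measurableSet_le measurable_const (measurable_card_sites (fun σ => wildSites σ k)
        (measurableSet_mem_wildSites k)))
  have hVle : κ.real V ≤ ε / 2 :=
    ((measureReal_union_le _ _).trans (add_le_add
      (measureReal_card_sites_ge_le κ (fun σ => shortSites (σ 1) N)
        (measurableSet_mem_shortSites N) hc1)
      (measureReal_card_sites_ge_le κ (fun σ => wildSites σ k)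
        (measurableSet_mem_wildSites k) hc2))).trans hi2
  have hgood : ∀ σ ∉ V, m - (P (σ 1)).card * ((n : ℝ) - 2 * k) + (wildSites σ k).card ≤ θ * m ∧
      (1 - θ) * m ≤ n * (P (σ 1)).card := by
    intro σ hσ
    rw [hVdef, Set.mem_union, not_or] at hσ
    have h1 : ((shortSites (σ 1) N).card : ℝ) < θ / (4 * n) * m := not_le.1 hσ.1
    have h2 : ((wildSites σ k).card : ℝ) < θ / 4 * m := not_le.1 hσ.2
    have h3 : (N : ℝ) * m ≤ N * (n * (P (σ 1)).card) + n * (m + N * (shortSites (σ 1) N).card) := by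
      exact_mod_cast hPcov (σ 1) N
    have h4 : (n : ℝ) * (P (σ 1)).card ≤ m := by
      have := Fintype.card_le_of_injective _ (hPinj (σ 1))
      have : n * (P (σ 1)).card ≤ m := by simpa [mul_comm] using this
      exact_mod_cast this
    exact block_density_bounds hm hn hN (Nat.cast_nonneg _) hθ h1 h2 h3 hNθ h4 hnθ
  refine ⟨κ ⊗ₘ blockKernel P ρ, inferInstance, Measure.fst_compProd _ _, ?_, ?_⟩
  · refine (blockKernel_modelDist_ge_le κ P ρ X.toApproxProc W hVm (half_pos hε).le
      fun σ hσ => ?_).trans (by linarith)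
    refine le_trans (measureReal_mono ?_ (measure_ne_top _ _))
      ((blockMeasure_modelDist_ge_le X σ (P (σ 1)) (hPinj (σ 1)) k hnk hδ (hgood σ hσ).1).trans hi1)
    intro ψ hψ
    exact hCθ.trans hψ
  · refine le_trans ?_ (le_modelEntropy_sub_blockKernel hn0 κ P hPinj ρ β hVm hθ.le
      fun σ hσ => (hgood σ hσ).2)
    rw [hDρ]
    calc (1 - ε) * (X.entropy - (X.factor β).entropy - ε) ≤ (1 - ε) * (D / n) :=
          mul_le_mul_of_nonneg_left hnrate (by linarith)
      _ ≤ (1 - (κ.real V + θ)) * (D / n) :=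
          mul_le_mul_of_nonneg_right (by linarith) (div_nonneg hD0 hn.le)

/-- Some adapted sequence converges strongly to `X` and has at least the classical relative
entropy. -/
theorem exists_strongly_convergent (K : RandomSoficApprox) (X : ZProc Ω A) (β : A → B) :
    ∃ S : AdaptedSeq K A, S.ConvergesStronglyTo X.toApproxProc ∧
      ((X.entropy - (X.factor β).entropy : ℝ) : EReal) ≤ S.relRate β := by
  have hε : ∀ j : ℕ, (0 : ℝ) < 1 / (j + 2) := fun j => by positivity
  have hε1 : ∀ j : ℕ, (1 : ℝ) / (j + 2) < 1 := fun j => by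
    rw [div_lt_one (by positivity)]
    linarith [Nat.cast_nonneg (α := ℝ) j]
  have hε0 : Tendsto (fun j : ℕ => (1 : ℝ) / (j + 2)) atTop (𝓝 0) :=
    tendsto_const_nhds.div_atTop (tendsto_natCast_atTop_atTop.atTop_add tendsto_const_nhds)
  obtain ⟨idx, hidx, hη⟩ := extraction_forall_of_eventually
    fun j : ℕ => exists_good_model K X β j (hε j) (hε1 j)
  choose η hprob hfst hclose hent using hη
  have hreal : ∀ (W : Finset ℤ) (ε : ℝ), 0 < ε →
      Tendsto (fun j => (η j).real {s | ε ≤ modelDist W s X.toApproxProc}) atTop (𝓝 0) := by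
    intro W ε hε'
    refine squeeze_zero' (Eventually.of_forall fun _ => measureReal_nonneg) ?_ hε0
    filter_upwards [hε0.eventually_le_const hε', eventually_ge_atTop (W.sup Int.natAbs)]
      with j hj hjW
    refine (measureReal_mono ?_ (measure_ne_top _ _)).trans (hclose j)
    have hWj : W ⊆ Finset.Icc (-j : ℤ) j := by
      intro w hw
      have := Finset.le_sup (f := Int.natAbs) hw
      rw [Finset.mem_Icc]
      omega
    intro s hs
    have hs : ε ≤ modelDist W s X.toApproxProc := hs
    exact hj.trans (hs.trans (modelDist_mono X.toApproxProc s hWj))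
  refine ⟨⟨idx, hidx, η, hprob, hfst⟩, ⟨fun W => ?_, fun W ε hε' => ?_⟩, ?_⟩
  · rw [Metric.tendsto_atTop']
    intro ε hε'
    have hC : (0 : ℝ) < Fintype.card (W → A) := by exact_mod_cast Fintype.card_pos
    have h1 := (hreal W (ε / 2) (half_pos hε')).const_mul (Fintype.card (W → A) : ℝ)
    rw [mul_zero] at h1
    obtain ⟨j₀, hj₀⟩ := eventually_atTop.1 (h1.eventually (gt_mem_nhds (half_pos hε')))
    refine ⟨j₀, fun j hj => ?_⟩
    have h2 := processDist_constructed_le (η j) W X.toApproxProc (half_pos hε').le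
    have h3 := hj₀ j hj.le
    rw [Real.dist_0_eq_abs, abs_of_nonneg (mul_nonneg (by norm_num)
      (Finset.sum_nonneg fun _ _ => abs_nonneg _))]
    change processDist W (constructed (η j)) X.toApproxProc < ε
    linarith
  · have h1 := (hreal W ε hε').const_sub 1
    rw [sub_zero] at h1
    rw [← ENNReal.tendsto_toReal_iff (fun j => measure_ne_top _ _) ENNReal.one_ne_top,
      ENNReal.toReal_one]
    refine h1.congr fun j => ?_
    have hset : MeasurableSet {s : SymMaps (K.m (idx j)) × (Fin (K.m (idx j)) → A) |
        ε ≤ modelDist W s X.toApproxProc} :=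
      measurableSet_le measurable_const (measurable_modelDist W X.toApproxProc)
    rw [← probReal_compl_eq_one_sub hset]
    change (η j).real _ = (η j).real _
    congr 1
    ext s; simp
  · have hlim : Tendsto (fun j : ℕ => (1 - (1 : ℝ) / (j + 2)) *
        (X.entropy - (X.factor β).entropy - 1 / (j + 2))) atTop
        (𝓝 (X.entropy - (X.factor β).entropy)) := by
      simpa using (hε0.const_sub 1).mul (hε0.const_sub (X.entropy - (X.factor β).entropy))
    have hlim' := (continuous_coe_real_ereal.tendsto _).comp hlim
    rw [← hlim'.limsup_eq]
    exact limsup_le_limsup (Eventually.of_forall fun j => EReal.coe_le_coe_iff.2 (hent j))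

/-- Every adapted sequence that converges to `X` has at most the classical relative entropy. -/
theorem AdaptedSeq.relRate_le_entropy_sub {K : RandomSoficApprox} (S : AdaptedSeq K A)
    (X : ZProc Ω A) (hS : S.ConvergesTo X.toApproxProc) (β : A → B) :
    S.relRate β ≤ ((X.entropy - (X.factor β).entropy : ℝ) : EReal) := by
  have hrate : Tendsto (fun n : ℕ => (blockEntropy X.T X.μ X.φ n -
      blockEntropy X.T X.μ (β ∘ X.φ) n) / n) atTop (𝓝 (X.entropy - (X.factor β).entropy)) := by
    have := (tendsto_blockEntropy X).sub (tendsto_blockEntropy (X.factor β))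
    simp_rw [← sub_div] at this
    exact this
  refine ge_of_tendsto ((continuous_coe_real_ereal.tendsto _).comp hrate) ?_
  filter_upwards [eventually_gt_atTop 0] with n hn
  exact S.relRate_le X hS β hn

end LowerBound

end SoficEntropy

theorem mainTheorem6 {Ω A B : Type*} [MeasurableSpace Ω]
    [Fintype A] [Nonempty A] [MeasurableSpace A] [DiscreteMeasurableSpace A]
    [Fintype B] [Nonempty B] [MeasurableSpace B] [DiscreteMeasurableSpace B]
    (K : SoficEntropy.RandomSoficApprox) (X : SoficEntropy.ZProc Ω A) (β : A → B) :
    SoficEntropy.upperRelSoficEntropy K X β = SoficEntropy.relSoficEntropy K X β ∧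
    SoficEntropy.relSoficEntropy K X β = X.relEntropy β ∧
    X.relEntropy β = ((X.entropy - (X.factor β).entropy : ℝ) : EReal) := by
  have hupper : SoficEntropy.upperRelSoficEntropy K X β ≤
      ((X.entropy - (X.factor β).entropy : ℝ) : EReal) :=
    iSup_le fun S => iSup_le fun hS => S.relRate_le_entropy_sub X hS β
  have hle : SoficEntropy.relSoficEntropy K X β ≤ SoficEntropy.upperRelSoficEntropy K X β :=
    iSup_le fun S => iSup_le fun hS => le_iSup_of_le S (le_iSup_of_le hS.1 le_rfl)
  have hlower : ((X.entropy - (X.factor β).entropy : ℝ) : EReal) ≤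
      SoficEntropy.relSoficEntropy K X β := by
    obtain ⟨S, hS, hrate⟩ := SoficEntropy.exists_strongly_convergent K X β
    exact le_iSup_of_le S (le_iSup_of_le hS hrate)
  rw [X.relEntropy_eq β]
  exact ⟨le_antisymm (hupper.trans hlower) hle, le_antisymm (hle.trans hupper) hlower, rfl⟩
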